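/- **Setting.** Let $N\ge 1$, $d\ge 0$, $H\ge1$ be integers. For $c\in\{1,\dots,N\}$ let $\xi_c$ be a probability measure on a measurable space $\mathsf Z$, let $(z,\theta)\mapsto F_c^{z}(\theta)$, $\mathsf Z\times\mathbb R^d\to\mathbb R$, be measurable with $F_c^{Z_c}(\theta)$ integrable for all $\theta$ when $Z_c\sim\xi_c$, and put $f_c(\theta)=\mathbb E[F_c^{Z_c}(\theta)]$, $f=\frac1N\sum_{c=1}^N f_c$. Let $\theta^\star$ be the minimizer of $f$, and let $\varepsilon_c^z(\theta)=\nabla F_c^z(\theta)-\nabla f_c(\theta)$. FedAvg with step size $\gamma>0$ and $H$ local steps is the Markov chain $\theta_{t+1}=\frac1N\sum_{c=1}^N\theta_{c,t}^{H}$, where $\theta_{c,t}^0=\theta_t$, $\theta_{c,t}^{h+1}=\theta_{c,t}^h-\gamma\nabla F_c^{Z_{c,t}^{h+1}}(\theta_{c,t}^h)$ for $0\le h<H$, and the $Z_{c,t}^{h}\sim\xi_c$ are all independent. **Assumptions.** 1. (Regularity) Each $f_c$ is three times differentiable and, for constants $\mu,L>0$, $\mu\,\mathrm{Id}\preccurlyeq\nabla^2f_c(\theta)\preccurlyeq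 L\,\mathrm{Id}$ for all $\theta$. For all $c$ and $z$, $F_c^z$ is differentiable with $L$-Lipschitz gradient and, for all $\theta,\vartheta$, $\|\nabla F_c^z(\theta)-\nabla F_c^z(\vartheta)\|^2\le 2L\langle\theta-\vartheta,\nabla F_c^z(\theta)-\nabla F_c^z(\vartheta)\rangle$. Moreover, the Taylor remainder at $\theta^\star$ is cubic: for each $c$, as $\theta\to\theta^\star$, $$\nabla f_c(\theta)=\nabla f_c(\theta^\star)+\nabla^2f_c(\theta^\star)(\theta-\theta^\star)+\tfrac12\nabla^3f_c(\theta^\star)(\theta-\theta^\star)^{\otimes2}+O(\|\theta-\theta^\star\|^3)$$ (this is automatic if $f_c$ is four times continuously differentiable near $\theta^\star$). 2. (Heterogeneity) There are $\zeta_1,\zeta_2>0$ with $\frac1N\sum_{c=1}^N\|\nabla^if_c(\theta^\star)-\nabla^if(\theta^\star)\|^2\le\zeta_i^2$ for $i\in\{1,2\}$. 3. (Polynomially growing gradient variance) There are $\tau,k\ge0$ such that $\mathbb E^{1/p}\big[\|\varepsilon_c^{Z_c}(\theta)\|^{2p}\big]\le\tau^2(1+\|\theta-\theta^\star\|^k)$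 for all $\theta\in\mathbb R^d$, $p\in\{1,2,3\}$ and all $c$. **Notation.** Let $\mathcal C(\theta^\star)=\frac1N\sum_{c=1}^N\mathbb E\big[\varepsilon_c^{Z_c}(\theta^\star)^{\otimes2}\big]$; let $\mathbf A$ be the inverse of the operator $M\mapsto M\nabla^2f(\theta^\star)+\nabla^2f(\theta^\star)M$ on $\mathbb R^{d\times d}$; let $\nabla^3f(\theta^\star)M$ be the vector with $k$-th coordinate $\sum_{i,j}\partial_{ijk}f(\theta^\star)M_{ij}$; and let $$\mathrm b_{\mathrm s}=\nabla^2f(\theta^\star)^{-1}\nabla^3f(\theta^\star)\mathbf A\,\mathcal C(\theta^\star),\qquad \mathrm b_{\mathrm h}=\frac1N\sum_{c=1}^N\nabla^2f(\theta^\star)^{-1}\big(\nabla^2f_c(\theta^\star)-\nabla^2f(\theta^\star)\big)\nabla f_c(\theta^\star).$$ **Theorem (Bias of FedAvg, Heterogeneous).** Under these assumptions, for all $H\ge1$ and $0<\gamma\le\min\{1/(25L),1/H\}$, the chain has a unique stationary distribution $\pi^{(\gamma,H)}$, it has a finite second moment, and $\bar\theta^{(\gamma,H)}=\int\vartheta\,\pi^{(\gamma,H)}(\mathrm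 d\vartheta)$ and $\bar\Sigma^{(\gamma,H)}=\int(\vartheta-\theta^\star)^{\otimes2}\,\pi^{(\gamma,H)}(\mathrm d\vartheta)$ satisfy $$\bar\theta^{(\gamma,H)}-\theta^\star=-\frac{\gamma}{2N}\,\mathrm b_{\mathrm s}+\frac{\gamma(H-1)}2\,\mathrm b_{\mathrm h}+O(\gamma^2H^2+\gamma^{3/2}H),\qquad \bar\Sigma^{(\gamma,H)}=\frac\gamma N\mathbf A\,\mathcal C(\theta^\star)+O(\gamma^2H^2+\gamma^{3/2}H),$$ where the constants in the $O(\cdot)$ may depend on the problem ($N$, $d$, the $\xi_c$ and $F_c$) but not on $\gamma$ and $H$. -/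

import Mathlib

open MeasureTheory
open scoped Topology

namespace FedAvg

/-- The parameter space `ℝ^d` with its Euclidean norm. -/
abbrev Vec (d : ℕ) : Type := EuclideanSpace ℝ (Fin d)

noncomputable section

/-! ### Derivatives, tensor contractions and the operator `𝐀` -/

/-- The Hessian `∇²g(θ)`, as a linear operator on `ℝ^d`. -/
def hessian {d : ℕ} (g : Vec d → ℝ) (θ : Vec d) : Vec d →L[ℝ] Vec d :=
  fderiv ℝ (gradient g) θ

/-- The third derivative `∇³g(θ)`, as a bilinear map: `∇³g(θ) u v` is the vector whose inner product
with `w` is the third derivative of `g` at `θ` in the directions `u, v, w`. -/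
def third {d : ℕ} (g : Vec d → ℝ) (θ : Vec d) : Vec d →L[ℝ] Vec d →L[ℝ] Vec d :=
  fderiv ℝ (fderiv ℝ (gradient g)) θ

/-- The tensor square `v ⊗ v`, i.e. the matrix `v vᵀ`, as an operator `x ↦ ⟨v, x⟩ v`. -/
def tensorSq {d : ℕ} (v : Vec d) : Vec d →L[ℝ] Vec d :=
  InnerProductSpace.rankOne ℝ v v

/-- The contraction `∑ᵢⱼ Mᵢⱼ T(eᵢ, eⱼ)` of a bilinear map with a matrix `M`;
it sends `v ⊗ v` to `T(v, v)`. -/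
def contract {d : ℕ} (T : Vec d →L[ℝ] Vec d →L[ℝ] Vec d) (M : Vec d →L[ℝ] Vec d) : Vec d :=
  ∑ i : Fin d, T (EuclideanSpace.basisFun (Fin d) ℝ i) (M (EuclideanSpace.basisFun (Fin d) ℝ i))

/-- The operator `Id ⊗ S + S ⊗ Id : M ↦ M S + S M` on matrices. -/
def lyapunov {d : ℕ} (S : Vec d →L[ℝ] Vec d) :
    (Vec d →L[ℝ] Vec d) →L[ℝ] (Vec d →L[ℝ] Vec d) :=
  (ContinuousLinearMap.compL ℝ (Vec d) (Vec d) (Vec d)).flip S +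
    ContinuousLinearMap.compL ℝ (Vec d) (Vec d) (Vec d) S

/-! ### The federated problem -/

section Problem

variable {N d : ℕ} {Z : Type*} [MeasurableSpace Z]

/-- The local objective `f_c(θ) = 𝔼[F_c^{Z_c}(θ)]` with `Z_c ∼ ξ_c`. -/
def localObj (F : Fin N → Z → Vec d → ℝ) (ξ : Fin N → Measure Z) (c : Fin N) (θ : Vec d) : ℝ :=
  ∫ z, F c z θ ∂(ξ c)

/-- The global objective `f = N⁻¹ ∑_c f_c`. -/
def globalObj (F : Fin N → Z → Vec d → ℝ) (ξ : Fin N → Measure Z) (θ : Vec d) : ℝ :=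
  (N : ℝ)⁻¹ * ∑ c, localObj F ξ c θ

/-- The centered stochastic gradient `ε_c^z(θ) = ∇F_c^z(θ) - ∇f_c(θ)`. -/
def noise (F : Fin N → Z → Vec d → ℝ) (ξ : Fin N → Measure Z) (c : Fin N) (z : Z) (θ : Vec d) :
    Vec d :=
  gradient (F c z) θ - gradient (localObj F ξ c) θ

/-- The stochastic problem is well posed: `(z, θ) ↦ F_c^z(θ)` is measurable and the expectation that
defines `f_c(θ)` is finite. -/
structure WellPosed (F : Fin N → Z → Vec d → ℝ) (ξ : Fin N → Measure Z) : Prop where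
  measurable : ∀ c, Measurable (fun p : Z × Vec d => F c p.1 p.2)
  integrable : ∀ c θ, Integrable (fun z => F c z θ) (ξ c)

/-- Regularity: `f_c` is three times differentiable, `μ Id ≼ ∇²f_c ≼ L Id`, and every `F_c^z` is
`L`-smooth with co-coercive gradient. -/
structure Regular (F : Fin N → Z → Vec d → ℝ) (ξ : Fin N → Measure Z) (μ L : ℝ) : Prop where
  diff_one : ∀ c, Differentiable ℝ (localObj F ξ c)
  diff_two : ∀ c, Differentiable ℝ (gradient (localObj F ξ c))
  diff_three : ∀ c, Differentiable ℝ (fderiv ℝ (gradient (localObj F ξ c)))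
  strongConvex : ∀ c θ v, μ * ‖v‖ ^ 2 ≤ inner ℝ (hessian (localObj F ξ c) θ v) v
  hessian_le : ∀ c θ v, inner ℝ (hessian (localObj F ξ c) θ v) v ≤ L * ‖v‖ ^ 2
  sample_diff : ∀ c z, Differentiable ℝ (F c z)
  sample_smooth : ∀ c z θ ϑ, ‖gradient (F c z) θ - gradient (F c z) ϑ‖ ≤ L * ‖θ - ϑ‖
  sample_cocoercive : ∀ c z θ ϑ, ‖gradient (F c z) θ - gradient (F c z) ϑ‖ ^ 2 ≤
    2 * L * inner ℝ (θ - ϑ) (gradient (F c z) θ - gradient (F c z) ϑ)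

/-- The second-order Taylor expansion of every `∇f_c` at `θ⋆` has a remainder of third order. -/
def CubicRemainder (F : Fin N → Z → Vec d → ℝ) (ξ : Fin N → Measure Z) (θs : Vec d) : Prop :=
  ∀ c, (fun θ => gradient (localObj F ξ c) θ - (gradient (localObj F ξ c) θs
      + hessian (localObj F ξ c) θs (θ - θs)
      + (1 / 2 : ℝ) • third (localObj F ξ c) θs (θ - θs) (θ - θs)))
    =O[𝓝 θs] (fun θ => ‖θ - θs‖ ^ 3)

/-- Bounded heterogeneity of the gradients and of the Hessians (in operator norm) at `θ⋆`. -/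
structure Heterogeneity (F : Fin N → Z → Vec d → ℝ) (ξ : Fin N → Measure Z) (θs : Vec d)
    (ζ₁ ζ₂ : ℝ) : Prop where
  grad : (N : ℝ)⁻¹ * ∑ c, ‖gradient (localObj F ξ c) θs - gradient (globalObj F ξ) θs‖ ^ 2 ≤ ζ₁ ^ 2
  hess : (N : ℝ)⁻¹ * ∑ c, ‖hessian (localObj F ξ c) θs - hessian (globalObj F ξ) θs‖ ^ 2 ≤ ζ₂ ^ 2

/-- Polynomially growing moments of the gradient noise, of orders `2p` with `p = 1, 2, 3`. -/
def NoiseGrowth (F : Fin N → Z → Vec d → ℝ) (ξ : Fin N → Measure Z) (θs : Vec d)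
    (τ k : ℝ) : Prop :=
  ∀ θ : Vec d, ∀ p ∈ ({1, 2, 3} : Finset ℕ), ∀ c : Fin N,
    Integrable (fun z => ‖noise F ξ c z θ‖ ^ (2 * p)) (ξ c) ∧
    (∫ z, ‖noise F ξ c z θ‖ ^ (2 * p) ∂(ξ c)) ^ (1 / (p : ℝ)) ≤ τ ^ 2 * (1 + ‖θ - θs‖ ^ k)

/-! ### The algorithm and its stationary distributions -/

/-- `H` local steps of stochastic gradient descent with step size `γ` on client `c`, started
at `θ`, with samples `z 0, …, z (H-1)`. -/
def localIter (F : Fin N → Z → Vec d → ℝ) (γ : ℝ) (c : Fin N) (θ : Vec d) :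
    (H : ℕ) → (Fin H → Z) → Vec d
  | 0, _ => θ
  | h + 1, z =>
      localIter F γ c θ h (fun i => z i.castSucc) -
        γ • gradient (F c (z (Fin.last h))) (localIter F γ c θ h (fun i => z i.castSucc))

/-- One round of FedAvg: the average of the clients' last local iterates. -/
def globalStep (F : Fin N → Z → Vec d → ℝ) (γ : ℝ) (H : ℕ) (θ : Vec d)
    (z : Fin N → Fin H → Z) : Vec d :=
  (N : ℝ)⁻¹ • ∑ c, localIter F γ c θ H (z c)

/-- The law of the samples of one round: independent, with `Z_c^h ∼ ξ_c`. -/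
def sampleLaw (ξ : Fin N → Measure Z) (H : ℕ) : Measure (Fin N → Fin H → Z) :=
  Measure.pi fun c => Measure.pi fun _ : Fin H => ξ c

/-- The Markov transition `κ(θ, ·)` of the global iterates. -/
def transition (F : Fin N → Z → Vec d → ℝ) (ξ : Fin N → Measure Z) (γ : ℝ) (H : ℕ)
    (θ : Vec d) : Measure (Vec d) :=
  (sampleLaw ξ H).map (globalStep F γ H θ)

/-- `π` is a stationary distribution of FedAvg: a probability measure with `π κ = π`. -/
def IsStationary (F : Fin N → Z → Vec d → ℝ) (ξ : Fin N → Measure Z) (γ : ℝ) (H : ℕ)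
    (π : Measure (Vec d)) : Prop :=
  IsProbabilityMeasure π ∧
    ∀ B : Set (Vec d), MeasurableSet B → π B = ∫⁻ θ, transition F ξ γ H θ B ∂π

/-- The stationary mean `θ̄ = ∫ ϑ π(dϑ)`. -/
def statMean (π : Measure (Vec d)) : Vec d :=
  ∫ ϑ, ϑ ∂π

/-- The stationary covariance around `θ⋆`, `∫ (ϑ - θ⋆)^{⊗2} π(dϑ)`. -/
def statCov (θs : Vec d) (π : Measure (Vec d)) : Vec d →L[ℝ] Vec d :=
  ∫ ϑ, tensorSq (ϑ - θs) ∂π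

/-! ### Leading terms -/

/-- The averaged noise covariance `𝒞(θ) = 𝔼[N⁻¹ ∑_c ε_c^{Z_c}(θ)^{⊗2}]`. -/
def noiseCov (F : Fin N → Z → Vec d → ℝ) (ξ : Fin N → Measure Z) (θ : Vec d) :
    Vec d →L[ℝ] Vec d :=
  (N : ℝ)⁻¹ • ∑ c, ∫ z, tensorSq (noise F ξ c z θ) ∂(ξ c)

/-- `𝐀 𝒞(θ⋆)`, where `𝐀 = (Id ⊗ ∇²f(θ⋆) + ∇²f(θ⋆) ⊗ Id)⁻¹`. -/
def ACov (F : Fin N → Z → Vec d → ℝ) (ξ : Fin N → Measure Z) (θs : Vec d) :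
    Vec d →L[ℝ] Vec d :=
  (lyapunov (hessian (globalObj F ξ) θs)).inverse (noiseCov F ξ θs)

/-- `b_s = ∇²f(θ⋆)⁻¹ ∇³f(θ⋆) 𝐀 𝒞(θ⋆)`. -/
def stochBias (F : Fin N → Z → Vec d → ℝ) (ξ : Fin N → Measure Z) (θs : Vec d) : Vec d :=
  (hessian (globalObj F ξ) θs).inverse (contract (third (globalObj F ξ) θs) (ACov F ξ θs))

/-- `b_h = N⁻¹ ∑_c ∇²f(θ⋆)⁻¹ (∇²f_c(θ⋆) - ∇²f(θ⋆)) ∇f_c(θ⋆)`. -/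
def heterBias (F : Fin N → Z → Vec d → ℝ) (ξ : Fin N → Measure Z) (θs : Vec d) : Vec d :=
  (N : ℝ)⁻¹ • ∑ c, (hessian (globalObj F ξ) θs).inverse
    ((hessian (localObj F ξ c) θs - hessian (globalObj F ξ) θs) (gradient (localObj F ξ c) θs))

end Problem

end

end FedAvg

/-! One round is a random map `θ ↦ Φ θ s`, and everything follows from a few estimates on `Φ`,
collected in `RoundModel`, where `η = γH` is the size of a round. Their constants do not depend on
`γ` or `H`, which makes the final bounds uniform.

Stationary law. Co-coercivity and `γL ≤ 1/2` make every local step nonexpansive for each sample, and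
strong monotonicity shrinks squared distances by `1 - γμ` in mean. For two chains driven by the same
samples, the second and fourth moments of the distance therefore shrink by `1 - cη` per round. A
random map contracting in L⁴ has exactly one stationary law `π`, and this law has a finite fourth
moment (`exists_stationary_of_contracting`, `stationary_unique_of_contracting`).

Moments. Started at `θ⋆`, a round moves by about `-V`, where `V` averages the stochastic gradients
at `θ⋆`. The client gradients at `θ⋆` sum to zero, so `V` is centred, with variance `O(γη)` by
independence, and the mean displacement is only `O(η²)`. Drift inequalities give `∫ ‖θ - θ⋆‖² = O(γ
+ η²)` and `∫ ‖θ - θ⋆‖⁴ = O(η²)`; with `δ = √γ + η` the third moment is then `O(ηδ)`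
(`moments_stationary`).

Expansion. Write `x = θ - θ⋆`, `A = ∇²f(θ⋆)`, `T = ∇³f(θ⋆)`. The mean displacement of a round is
about `-η (A x + ½ T(x, x) - b)`. The term `b` is client drift: before its step number `h`, counted
from 0, client `c` has moved by about `-γh ∇f_c(θ⋆)`, which changes its gradient by `-γh ∇²f_c
∇f_c`, and `∑_{h<H} h = H(H-1)/2`. The mean increment of `x ⊗ x` is about `-η (x ⊗ A x + A x ⊗ x) +
γη Q`, with `Q = 𝒞(θ⋆)/N`. Under `π` both increments integrate to zero; dividing by `η` leaves two
linear equations for the stationary mean and covariance with error `O(ηδ)` (`mean_stationary`,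
`covariance_stationary`). Inverting the Lyapunov operator and then the Hessian gives the leading
terms (`norm_sub_leading_terms_le`), and `ηδ = γ²H² + γ^{3/2}H`. -/

namespace FedAvg

open ProbabilityTheory
open scoped ENNReal NNReal

set_option linter.unusedSectionVars false

/-! ### Stationary laws of random maps that contract in L⁴. -/

section RandomMaps

/-- The vector-valued form is needed because invariance is applied to test functions, to powers of
the norm, to the identity and to tensor squares. -/
lemma integral_stationary {E S : Type*} [MeasurableSpace E] [MeasurableSpace S]
    {ν : Measure S} [IsProbabilityMeasure ν] {G : E → S → E} {F : Type*} [NormedAddCommGroup F] [NormedSpace ℝ F]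
    (hG : Measurable (Function.uncurry G)) {π : Measure E} [SFinite π]
    (hπ : π = (π.prod ν).map (Function.uncurry G)) {φ : E → F} (hφ : Integrable φ π) :
    Integrable (fun p : E × S => φ (G p.1 p.2)) (π.prod ν) ∧
      ∫ θ, φ θ ∂π = ∫ θ, ∫ s, φ (G θ s) ∂ν ∂π := by
  have h1 : Integrable (fun p : E × S => φ (G p.1 p.2)) (π.prod ν) := by
    rw [hπ] at hφ
    exact hφ.comp_measurable hG
  refine ⟨h1, ?_⟩
  rw [← integral_prod _ h1]
  have h2 : AEStronglyMeasurable φ ((π.prod ν).map (Function.uncurry G)) := hπ ▸ hφ.1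
  conv_lhs => rw [hπ]
  exact integral_map hG.aemeasurable h2

/-- For an i.i.d. sequence, the first term and the shifted sequence are independent, and the shifted
sequence has the same law. -/
lemma map_head_tail_infinitePi {S : Type*} [MeasurableSpace S] (ν : Measure S)
    [IsProbabilityMeasure ν] :
    (Measure.infinitePi fun _ : ℕ => ν).map (fun ω => (fun n => ω (n + 1), ω 0)) =
      (Measure.infinitePi fun _ : ℕ => ν).prod ν := by
  set P := Measure.infinitePi fun _ : ℕ => ν with hP
  -- It is easier to identify the law of the inverse map `cons`, whose preimages of boxes are boxes;
  -- the claim follows because splitting after `cons` is the identity.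
  let cons : (ℕ → S) × S → (ℕ → S) := fun p n => Nat.casesOn n p.2 p.1
  have hcons : Measurable cons := by
    refine measurable_pi_lambda _ fun n => ?_
    cases n with
    | zero => exact measurable_snd
    | succ n => exact (measurable_pi_apply n).comp measurable_fst
  have hmap : (P.prod ν).map cons = P := by
    refine Measure.eq_infinitePi _ fun s t ht => ?_
    have hpre : cons ⁻¹' (Set.pi s t) =
        (Set.pi (s.erase 0 |>.image Nat.pred : Finset ℕ) (fun n => t (n + 1))) ×ˢ
          (if 0 ∈ s then t 0 else Set.univ) := by
      ext p
      simp only [Set.mem_preimage, Set.mem_pi, Finset.mem_coe, Set.mem_prod, Finset.mem_image,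
        Finset.mem_erase]
      constructor
      · intro h
        refine ⟨?_, ?_⟩
        · rintro i ⟨j, ⟨hj0, hj⟩, rfl⟩
          obtain ⟨m, rfl⟩ := Nat.exists_eq_succ_of_ne_zero hj0
          exact h _ hj
        · split_ifs with h0
          · exact h 0 h0
          · trivial
      · rintro ⟨h1, h2⟩ i hi
        cases i with
        | zero => rw [if_pos hi] at h2; exact h2
        | succ m => exact h1 m ⟨m + 1, ⟨by simp, hi⟩, rfl⟩
    rw [Measure.map_apply hcons (.pi (Finset.countable_toSet _) fun i _ => ht i), hpre,
      Measure.prod_prod, Measure.infinitePi_pi _ (fun i _ => ht _)]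
    rw [Finset.prod_image]
    · have h1 : ∏ x ∈ s.erase 0, ν (t (Nat.pred x + 1)) = ∏ x ∈ s.erase 0, ν (t x) := by
        refine Finset.prod_congr rfl fun x hx => ?_
        have := Finset.ne_of_mem_erase hx
        rw [Nat.pred_eq_sub_one, Nat.sub_add_cancel (Nat.one_le_iff_ne_zero.2 this)]
      rw [h1]
      split_ifs with h0
      · rw [Finset.prod_erase_mul _ _ h0]
      · rw [Finset.erase_eq_of_notMem h0]; simp
    · intro a ha b hb hab
      have h1 := Finset.ne_of_mem_erase ha
      have h2 := Finset.ne_of_mem_erase hb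
      simp only [Nat.pred_eq_sub_one] at hab
      omega
  have hsplit : Measurable fun ω : ℕ → S => (fun n => ω (n + 1), ω 0) := by fun_prop
  conv_lhs => rw [← hmap]
  rw [Measure.map_map hsplit hcons]
  exact Measure.map_id

variable {E : Type*} [NormedAddCommGroup E]

lemma eLpNorm_four_pow {Ω : Type*} [MeasurableSpace Ω] (P : Measure Ω) (X : Ω → E) :
    eLpNorm X 4 P ^ 4 = ∫⁻ ω, ‖X ω‖ₑ ^ 4 ∂P := by
  have h := eLpNorm_nnreal_pow_eq_lintegral (μ := P) (f := X) (p := 4) (by norm_num)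
  have h4 : (((4 : ℝ≥0) : ℝ)) = ((4 : ℕ) : ℝ) := by norm_num
  rw [h4] at h
  simpa only [ENNReal.rpow_natCast, ENNReal.coe_ofNat] using h

variable [MeasurableSpace E] [BorelSpace E] [SecondCountableTopology E] {S : Type*} [MeasurableSpace S]
  {ν : Measure S} [IsProbabilityMeasure ν] {G : E → S → E} {K : ℝ≥0}

/-- A random map that is a strict contraction in `L⁴` has a stationary law with a finite fourth
moment: the law of the fixed point of `X ↦ G (X ∘ shift) (ω 0)` in `L⁴`. -/
theorem exists_stationary_of_contracting [CompleteSpace E]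
    (hG : Measurable (Function.uncurry G)) (hK : K < 1)
    (hcontr : ∀ θ ϑ, ∫⁻ s, ‖G θ s - G ϑ s‖ₑ ^ 4 ∂ν ≤ (K : ℝ≥0∞) ^ 4 * ‖θ - ϑ‖ₑ ^ 4)
    (θ₀ : E) (hθ₀ : MemLp (G θ₀) 4 ν) :
    ∃ π : Measure E, IsProbabilityMeasure π ∧ MemLp id 4 π ∧
      π = (π.prod ν).map (Function.uncurry G) := by
  set P := Measure.infinitePi fun _ : ℕ => ν with hP
  let split : (ℕ → S) → (ℕ → S) × S := fun ω => (fun n => ω (n + 1), ω 0)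
  have hsplit : Measurable split := by fun_prop
  have hmp : MeasurePreserving split P (P.prod ν) := ⟨hsplit, map_head_tail_infinitePi ν⟩
  let T : ((ℕ → S) → E) → (ℕ → S) → E := fun X ω => G (X (split ω).1) (split ω).2
  have hTeq : ∀ X : (ℕ → S) → E, T X = (fun p : (ℕ → S) × S => G (X p.1) p.2) ∘ split :=
    fun X => rfl
  have hGm : ∀ X : (ℕ → S) → E, AEMeasurable X P →
      AEMeasurable (fun p : (ℕ → S) × S => G (X p.1) p.2) (P.prod ν) := fun X hX =>
    hG.comp_aemeasurable ((hX.comp_fst).prodMk measurable_snd.aemeasurable)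
  have hTm : ∀ X : (ℕ → S) → E, AEMeasurable X P → AEMeasurable (T X) P := fun X hX =>
    (hTeq X) ▸ (hGm X hX).comp_quasiMeasurePreserving hmp.quasiMeasurePreserving
  have hTcontr : ∀ X Y : (ℕ → S) → E, AEMeasurable X P → AEMeasurable Y P →
      eLpNorm (T X - T Y) 4 P ≤ K * eLpNorm (X - Y) 4 P := by
    intro X Y hX hY
    rw [← ENNReal.pow_le_pow_left_iff (n := 4) (by norm_num), mul_pow, eLpNorm_four_pow,
      eLpNorm_four_pow]
    have hm : AEMeasurable (fun p : (ℕ → S) × S => ‖G (X p.1) p.2 - G (Y p.1) p.2‖ₑ ^ 4)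
        (P.prod ν) := (((hGm X hX).sub (hGm Y hY)).enorm).pow_const 4
    calc ∫⁻ ω, ‖(T X - T Y) ω‖ₑ ^ 4 ∂P
        = ∫⁻ p, ‖G (X p.1) p.2 - G (Y p.1) p.2‖ₑ ^ 4 ∂(P.prod ν) := by
          rw [← hmp.map_eq] at hm ⊢
          rw [lintegral_map' hm hsplit.aemeasurable]; rfl
      _ = ∫⁻ ω, ∫⁻ s, ‖G (X ω) s - G (Y ω) s‖ₑ ^ 4 ∂ν ∂P := lintegral_prod _ hm
      _ ≤ ∫⁻ ω, (K : ℝ≥0∞) ^ 4 * ‖X ω - Y ω‖ₑ ^ 4 ∂P := lintegral_mono fun ω => hcontr _ _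
      _ = _ := by exact lintegral_const_mul'' _ (((hX.sub hY).enorm).pow_const 4)
  have hconst : MemLp (T fun _ => θ₀) 4 P := by
    have h1 : T (fun _ => θ₀) = G θ₀ ∘ (fun ω : ℕ → S => ω 0) := rfl
    rw [h1]
    exact hθ₀.comp_measurePreserving (measurePreserving_eval_infinitePi (fun _ : ℕ => ν) 0)
  have hTmem : ∀ X : (ℕ → S) → E, MemLp X 4 P → MemLp (T X) 4 P := by
    intro X hX
    have hX' := hX.1.aemeasurable
    have h2 : MemLp (T X - T fun _ => θ₀) 4 P := by
      refine ⟨((hTm X hX').sub (hTm _ aemeasurable_const)).aestronglyMeasurable, ?_⟩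
      refine (hTcontr X _ hX' aemeasurable_const).trans_lt ?_
      exact ENNReal.mul_lt_top ENNReal.coe_lt_top (hX.sub (memLp_const θ₀)).2
    simpa using h2.add hconst
  have : Fact ((1 : ℝ≥0∞) ≤ 4) := ⟨by norm_num⟩
  let Φ : Lp E 4 P → Lp E 4 P := fun X => (hTmem X (Lp.memLp X)).toLp
  have hΦ : ContractingWith K Φ := by
    refine ⟨hK, fun X Y => ?_⟩
    rw [Lp.edist_toLp_toLp, Lp.edist_def]
    exact hTcontr X Y (Lp.memLp X).1.aemeasurable (Lp.memLp Y).1.aemeasurable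
  obtain ⟨X, hX, -⟩ := hΦ.exists_fixedPoint 0 (edist_ne_top _ _)
  have hXT : (X : (ℕ → S) → E) =ᵐ[P] T X := by
    have h := (hTmem X (Lp.memLp X)).coeFn_toLp
    have h' : ((Φ X : Lp E 4 P) : (ℕ → S) → E) =ᵐ[P] T X := h
    rwa [hX.eq] at h'
  have hXm : AEMeasurable X P := (Lp.memLp X).1.aemeasurable
  refine ⟨P.map X, Measure.isProbabilityMeasure_map hXm, ?_, ?_⟩
  · rw [memLp_map_measure_iff aestronglyMeasurable_id hXm]
    exact Lp.memLp X
  -- The fixed point read at the shifted sequence is independent of the first sample and has the law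
  -- of `X`, so `X = T X` almost surely says that this law is invariant.
  · conv_lhs => rw [Measure.map_congr hXT]
    have hprod : (P.map X).prod ν = (P.prod ν).map (fun p => (X p.1, p.2)) := by
      have := Measure.map_prod_map P ν (Lp.stronglyMeasurable X).measurable measurable_id
      rwa [Measure.map_id] at this
    rw [hprod, AEMeasurable.map_map_of_aemeasurable hG.aemeasurable
      ((hXm.comp_fst).prodMk measurable_snd.aemeasurable), hTeq, ← AEMeasurable.map_map_of_aemeasurable,
      hmp.map_eq]
    · rfl
    · rw [hmp.map_eq]; exact hGm X hXm
    · exact hsplit.aemeasurable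

/-- Averaging a bounded Lipschitz function over one step of a random contraction. -/
lemma exists_lipschitz_bounded_pushforward
    (hG : Measurable (Function.uncurry G))
    (hcontr : ∀ θ ϑ, ∫⁻ s, ‖G θ s - G ϑ s‖ₑ ^ 4 ∂ν ≤ (K : ℝ≥0∞) ^ 4 * ‖θ - ϑ‖ₑ ^ 4)
    {φ : E → ℂ} {C : ℝ≥0} (hφ : LipschitzWith C φ) (hb : ∀ x, ‖φ x‖ ≤ 1) :
    LipschitzWith (C * K) (fun θ => ∫ s, φ (G θ s) ∂ν) ∧ ∀ x, ‖∫ s, φ (G x s) ∂ν‖ ≤ 1 := by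
  have hGm : ∀ θ, Measurable (G θ) := fun θ => hG.comp measurable_prodMk_left
  have hint : ∀ θ, Integrable (fun s => φ (G θ s)) ν := fun θ =>
    Integrable.of_bound (hφ.continuous.measurable.comp (hGm θ)).aestronglyMeasurable 1
      (ae_of_all _ fun s => hb _)
  refine ⟨fun θ ϑ => ?_, fun x => ?_⟩
  · have hK : ∫⁻ s, ‖G θ s - G ϑ s‖ₑ ∂ν ≤ K * ‖θ - ϑ‖ₑ := by
      have hm := ((hGm θ).sub (hGm ϑ)).aestronglyMeasurable (μ := ν)
      have h1 : eLpNorm (fun s => G θ s - G ϑ s) 1 ν ≤ eLpNorm (fun s => G θ s - G ϑ s) 4 ν :=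
        eLpNorm_le_eLpNorm_of_exponent_le (by norm_num) hm
      rw [eLpNorm_one_eq_lintegral_enorm] at h1
      refine h1.trans ?_
      rw [← ENNReal.pow_le_pow_left_iff (n := 4) (by norm_num), mul_pow, eLpNorm_four_pow]
      exact hcontr θ ϑ
    rw [edist_eq_enorm_sub, edist_eq_enorm_sub, ← integral_sub (hint θ) (hint ϑ)]
    calc ‖∫ s, (φ (G θ s) - φ (G ϑ s)) ∂ν‖ₑ ≤ ∫⁻ s, ‖φ (G θ s) - φ (G ϑ s)‖ₑ ∂ν :=
          enorm_integral_le_lintegral_enorm _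
      _ ≤ ∫⁻ s, C * ‖G θ s - G ϑ s‖ₑ ∂ν := by
          refine lintegral_mono fun s => ?_
          have := hφ (G θ s) (G ϑ s)
          rwa [edist_eq_enorm_sub, edist_eq_enorm_sub] at this
      _ = C * ∫⁻ s, ‖G θ s - G ϑ s‖ₑ ∂ν :=
          lintegral_const_mul _ ((hGm θ).sub (hGm ϑ)).enorm
      _ ≤ C * (K * ‖θ - ϑ‖ₑ) := by gcongr
      _ = _ := by rw [ENNReal.coe_mul, mul_assoc]
  · calc ‖∫ s, φ (G x s) ∂ν‖ ≤ 1 * ν.real Set.univ :=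
        norm_integral_le_of_norm_le_const (ae_of_all _ fun s => hb _)
      _ = 1 := by simp

/-- Replacing a test function by its average over one round changes neither integral but multiplies
its Lipschitz constant by `K`. After `n` rounds the function is almost constant, so the two
integrals agree in the limit. Boundedness supplies the domination, hence neither law needs moments.
-/
theorem integral_eq_of_stationary_of_contracting
    (hG : Measurable (Function.uncurry G)) (hK : K < 1)
    (hcontr : ∀ θ ϑ, ∫⁻ s, ‖G θ s - G ϑ s‖ₑ ^ 4 ∂ν ≤ (K : ℝ≥0∞) ^ 4 * ‖θ - ϑ‖ₑ ^ 4)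
    {π π' : Measure E} [IsProbabilityMeasure π] [IsProbabilityMeasure π']
    (hπ : π = (π.prod ν).map (Function.uncurry G))
    (hπ' : π' = (π'.prod ν).map (Function.uncurry G))
    {φ : E → ℂ} {C : ℝ≥0} (hφ : LipschitzWith C φ) (hb : ∀ x, ‖φ x‖ ≤ 1) :
    ∫ x, φ x ∂π = ∫ x, φ x ∂π' := by
  have hint : ∀ (ρ : Measure E) [IsProbabilityMeasure ρ] (ψ : E → ℂ) (D : ℝ≥0),
      LipschitzWith D ψ → (∀ x, ‖ψ x‖ ≤ 1) → Integrable ψ ρ := fun ρ _ ψ D hψ h1 =>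
    Integrable.of_bound hψ.continuous.aestronglyMeasurable 1 (ae_of_all _ h1)
  have key : ∀ n : ℕ, ∃ ψ : E → ℂ, LipschitzWith (C * K ^ n) ψ ∧ (∀ x, ‖ψ x‖ ≤ 1) ∧
      ∫ x, ψ x ∂π = ∫ x, φ x ∂π ∧ ∫ x, ψ x ∂π' = ∫ x, φ x ∂π' := by
    intro n
    induction n with
    | zero => exact ⟨φ, by simpa using hφ, hb, rfl, rfl⟩
    | succ n ih =>
      obtain ⟨ψ, h1, h2, h3, h4⟩ := ih
      obtain ⟨h5, h6⟩ := exists_lipschitz_bounded_pushforward hG hcontr h1 h2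
      refine ⟨_, ?_, h6, ?_, ?_⟩
      · rwa [pow_succ, ← mul_assoc]
      · rw [← (integral_stationary hG hπ (hint π ψ _ h1 h2)).2, h3]
      · rw [← (integral_stationary hG hπ' (hint π' ψ _ h1 h2)).2, h4]
  choose ψ h1 h2 h3 h4 using key
  -- Writing the difference over the product coupling exposes `ψ n p.1 - ψ n p.2`, which is at most
  -- 2 in norm and tends to 0 pointwise.
  have hrep : ∀ n, ∫ x, φ x ∂π - ∫ x, φ x ∂π' = ∫ p, (ψ n p.1 - ψ n p.2) ∂(π.prod π') := by
    intro n
    have i1 : Integrable (fun p : E × E => ψ n p.1) (π.prod π') :=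
      (hint π _ _ (h1 n) (h2 n)).comp_fst π'
    have i2 : Integrable (fun p : E × E => ψ n p.2) (π.prod π') :=
      (hint π' _ _ (h1 n) (h2 n)).comp_snd π
    rw [integral_sub i1 i2, ← h3 n, ← h4 n]
    congr 1
    · rw [integral_fun_fst]; simp
    · rw [integral_fun_snd]; simp
  have hlim : Filter.Tendsto (fun n => ∫ p, (ψ n p.1 - ψ n p.2) ∂(π.prod π')) Filter.atTop
      (𝓝 (∫ _p : E × E, (0 : ℂ) ∂(π.prod π'))) := by
    refine tendsto_integral_of_dominated_convergence (fun _ => 2) (fun n => ?_)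
      (integrable_const _) (fun n => ae_of_all _ fun p => ?_) (ae_of_all _ fun p => ?_)
    · exact (((h1 n).continuous.comp continuous_fst).sub
        ((h1 n).continuous.comp continuous_snd)).aestronglyMeasurable
    · calc ‖ψ n p.1 - ψ n p.2‖ ≤ ‖ψ n p.1‖ + ‖ψ n p.2‖ := norm_sub_le _ _
        _ ≤ 2 := by linarith [h2 n p.1, h2 n p.2]
    · rw [tendsto_zero_iff_norm_tendsto_zero]
      have hz : Filter.Tendsto (fun n : ℕ => (C : ℝ) * (K : ℝ) ^ n * dist p.1 p.2) Filter.atTop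
          (𝓝 (C * 0 * dist p.1 p.2)) :=
        ((tendsto_pow_atTop_nhds_zero_of_lt_one K.2 (by exact_mod_cast hK)).const_mul _).mul_const _
      rw [mul_zero, zero_mul] at hz
      refine squeeze_zero (fun n => norm_nonneg _) (fun n => ?_) hz
      have := (h1 n).dist_le_mul p.1 p.2
      rw [dist_eq_norm] at this
      simpa using this
  simp_rw [← hrep, integral_zero] at hlim
  exact sub_eq_zero.1 (tendsto_nhds_unique tendsto_const_nhds hlim)

end RandomMaps

/-- A random map that is a strict contraction in `L⁴` has at most one stationary law. -/
theorem stationary_unique_of_contracting {E : Type*} [NormedAddCommGroup E] [InnerProductSpace ℝ E]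
    [CompleteSpace E] [MeasurableSpace E] [BorelSpace E] [SecondCountableTopology E]
    {S : Type*} [MeasurableSpace S] {ν : Measure S} [IsProbabilityMeasure ν] {G : E → S → E}
    {K : ℝ≥0} (hG : Measurable (Function.uncurry G)) (hK : K < 1)
    (hcontr : ∀ θ ϑ, ∫⁻ s, ‖G θ s - G ϑ s‖ₑ ^ 4 ∂ν ≤ (K : ℝ≥0∞) ^ 4 * ‖θ - ϑ‖ₑ ^ 4)
    {π π' : Measure E} [IsProbabilityMeasure π] [IsProbabilityMeasure π']
    (hπ : π = (π.prod ν).map (Function.uncurry G))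
    (hπ' : π' = (π'.prod ν).map (Function.uncurry G)) : π = π' := by
  refine Measure.ext_of_charFun (funext fun t => ?_)
  rw [charFun_apply, charFun_apply]
  refine integral_eq_of_stationary_of_contracting hG hK hcontr hπ hπ' (C := ‖t‖₊) ?_ ?_
  · refine LipschitzWith.of_dist_le_mul fun x y => ?_
    rw [dist_eq_norm, dist_eq_norm]
    have h1 : Complex.exp ((inner ℝ x t : ℝ) * Complex.I) -
        Complex.exp ((inner ℝ y t : ℝ) * Complex.I) = Complex.exp ((inner ℝ y t : ℝ) * Complex.I) *
          (Complex.exp (Complex.I * ((inner ℝ x t - inner ℝ y t : ℝ) : ℂ)) - 1) := by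
      rw [mul_sub, ← Complex.exp_add, mul_one]
      congr 2
      push_cast
      ring
    rw [h1, norm_mul, Complex.norm_exp_ofReal_mul_I, one_mul]
    refine Real.norm_exp_I_mul_ofReal_sub_one_le.trans ?_
    rw [← inner_sub_left, mul_comm]
    exact norm_inner_le_norm _ _
  · intro x
    rw [Complex.norm_exp_ofReal_mul_I]

/-! ### Local SGD of one client: pathwise bounds, moments and contraction. -/

section SingleClient

variable {Z : Type*} [MeasurableSpace Z]

lemma measurePreserving_splitLast (ξ : Measure Z) [IsProbabilityMeasure ξ] (h : ℕ) :
    ∃ e : (Fin (h + 1) → Z) ≃ᵐ (Fin h → Z) × Z,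
      (∀ z, e z = (fun i => z i.castSucc, z (Fin.last h))) ∧
      MeasurePreserving e (Measure.pi fun _ => ξ) ((Measure.pi fun _ => ξ).prod ξ) := by
  refine ⟨(MeasurableEquiv.piFinSuccAbove (fun _ => Z) (Fin.last h)).trans MeasurableEquiv.prodComm,
    fun z => ?_, ?_⟩
  · refine Prod.ext (funext fun i => ?_) rfl
    change z ((Fin.last h).succAbove i) = _
    rw [Fin.succAbove_last]
  · exact Measure.measurePreserving_swap.comp
      (measurePreserving_piFinSuccAbove (fun _ : Fin (h + 1) => ξ) (Fin.last h))

/-- Conditions on all samples but the last, which is the one that the outermost step of `sgdIter`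
consumes. -/
lemma integral_pi_succ {F : Type*} [NormedAddCommGroup F] [NormedSpace ℝ F] (ξ : Measure Z)
    [IsProbabilityMeasure ξ] (h : ℕ) (φ : (Fin h → Z) → Z → F)
    (hφ : Integrable (fun z : Fin (h + 1) → Z => φ (fun i => z i.castSucc) (z (Fin.last h)))
      (Measure.pi fun _ => ξ)) :
    Integrable (fun z => ∫ w, φ z w ∂ξ) (Measure.pi fun _ : Fin h => ξ) ∧
    ∫ z : Fin (h + 1) → Z, φ (fun i => z i.castSucc) (z (Fin.last h)) ∂(Measure.pi fun _ => ξ) =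
      ∫ z, ∫ w, φ z w ∂ξ ∂(Measure.pi fun _ : Fin h => ξ) := by
  obtain ⟨e, he, hmp⟩ := measurePreserving_splitLast ξ h
  have h1 : (fun z : Fin (h + 1) → Z => φ (fun i => z i.castSucc) (z (Fin.last h))) =
      (fun p : (Fin h → Z) × Z => φ p.1 p.2) ∘ e := by
    ext z; simp [he]
  rw [h1, hmp.integrable_comp_emb e.measurableEmbedding] at hφ
  refine ⟨hφ.integral_prod_left, ?_⟩
  rw [← integral_prod _ hφ, ← hmp.integral_comp e.measurableEmbedding]
  simp [he]

variable {E : Type*} [NormedAddCommGroup E] [InnerProductSpace ℝ E]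

/-- `h` steps of stochastic gradient descent with stochastic gradient `g`. -/
def sgdIter (g : Z → E → E) (γ : ℝ) (θ : E) : (h : ℕ) → (Fin h → Z) → E
  | 0, _ => θ
  | h + 1, z =>
      sgdIter g γ θ h (fun i => z i.castSucc) -
        γ • g (z (Fin.last h)) (sgdIter g γ θ h (fun i => z i.castSucc))

/-- The sum of the stochastic gradients at a fixed point along the samples of one round. -/
def gradSum (g : Z → E → E) (γ : ℝ) (θ : E) (h : ℕ) (z : Fin h → Z) : E :=
  γ • ∑ i, g (z i) θ

/-- The sum of the norms of the stochastic gradients at a fixed point. -/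
def gradNormSum (g : Z → E → E) (γ : ℝ) (θ : E) (h : ℕ) (z : Fin h → Z) : ℝ :=
  γ * ∑ i, ‖g (z i) θ‖

/-- A stochastic gradient oracle: an unbiased estimate `g` of a strongly monotone field `G`, which
is Lipschitz and co-coercive for every sample. -/
structure Oracle [MeasurableSpace E] (ξ : Measure Z) (g : Z → E → E) (G : E → E) (μ L : ℝ) :
    Prop where
  meas : Measurable fun p : Z × E => g p.1 p.2
  lip : ∀ z θ ϑ, ‖g z θ - g z ϑ‖ ≤ L * ‖θ - ϑ‖
  cocoercive : ∀ z θ ϑ, ‖g z θ - g z ϑ‖ ^ 2 ≤ 2 * L * inner ℝ (θ - ϑ) (g z θ - g z ϑ)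
  mean : ∀ θ, ∫ z, g z θ ∂ξ = G θ
  mono : ∀ θ ϑ, μ * ‖θ - ϑ‖ ^ 2 ≤ inner ℝ (θ - ϑ) (G θ - G ϑ)
  memLp : ∀ θ, MemLp (fun z => g z θ) 4 ξ

lemma norm_gradSum_le (g : Z → E → E) {γ : ℝ} (hγ : 0 ≤ γ) (θ : E) (h : ℕ) (z : Fin h → Z) :
    ‖gradSum g γ θ h z‖ ≤ gradNormSum g γ θ h z := by
  rw [gradSum, norm_smul, Real.norm_of_nonneg hγ]
  exact mul_le_mul_of_nonneg_left (norm_sum_le _ _) hγ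

lemma gradNormSum_nonneg (g : Z → E → E) {γ : ℝ} (hγ : 0 ≤ γ) (θ : E) (h : ℕ) (z : Fin h → Z) :
    0 ≤ gradNormSum g γ θ h z := by
  unfold gradNormSum; positivity

lemma gradNormSum_succ (g : Z → E → E) (γ : ℝ) (θ : E) (h : ℕ) (z : Fin (h + 1) → Z) :
    gradNormSum g γ θ (h + 1) z =
      gradNormSum g γ θ h (fun i => z i.castSucc) + γ * ‖g (z (Fin.last h)) θ‖ := by
  rw [gradNormSum, Fin.sum_univ_castSucc, mul_add, gradNormSum]

lemma gradSum_succ (g : Z → E → E) (γ : ℝ) (θ : E) (h : ℕ) (z : Fin (h + 1) → Z) :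
    gradSum g γ θ (h + 1) z =
      gradSum g γ θ h (fun i => z i.castSucc) + γ • g (z (Fin.last h)) θ := by
  rw [gradSum, Fin.sum_univ_castSucc, smul_add, gradSum]

variable [MeasurableSpace E] {ξ : Measure Z} {g : Z → E → E} {G : E → E} {μ L γ : ℝ}

namespace Oracle

section Pointwise

lemma inner_nonneg (o : Oracle ξ g G μ L) (hL : 0 < L) (z : Z) (θ ϑ : E) :
    0 ≤ inner ℝ (θ - ϑ) (g z θ - g z ϑ) := by
  have h := (sq_nonneg _).trans (o.cocoercive z θ ϑ)
  by_contra hc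
  push Not at hc
  nlinarith [mul_pos hL (neg_pos.2 hc)]

/-- Expand the square: co-coercivity bounds `γ² ‖g z θ - g z ϑ‖²` by `2γL · γ` times the inner
product, at most half of the cross term. The other half is kept, since its mean produces the
contraction. -/
lemma norm_step_sq_le (o : Oracle ξ g G μ L) (hL : 0 < L) (hγ : 0 < γ) (hγL : γ * L ≤ 1 / 2)
    (z : Z) (θ ϑ : E) :
    ‖(θ - γ • g z θ) - (ϑ - γ • g z ϑ)‖ ^ 2 ≤
      ‖θ - ϑ‖ ^ 2 - γ * inner ℝ (θ - ϑ) (g z θ - g z ϑ) := by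
  have h1 : (θ - γ • g z θ) - (ϑ - γ • g z ϑ) = (θ - ϑ) - γ • (g z θ - g z ϑ) := by
    rw [smul_sub]; abel
  rw [h1, norm_sub_sq_real, inner_smul_right, norm_smul, Real.norm_of_nonneg hγ.le, mul_pow]
  have h2 := o.cocoercive z θ ϑ
  have h3 := o.inner_nonneg hL z θ ϑ
  have h4 : γ ^ 2 * ‖g z θ - g z ϑ‖ ^ 2 ≤
      γ * (2 * (γ * L)) * inner ℝ (θ - ϑ) (g z θ - g z ϑ) := by
    calc γ ^ 2 * ‖g z θ - g z ϑ‖ ^ 2 ≤ γ ^ 2 * (2 * L * inner ℝ (θ - ϑ) (g z θ - g z ϑ)) := by gcongr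
      _ = _ := by ring
  have h5 : γ * (2 * (γ * L)) * inner ℝ (θ - ϑ) (g z θ - g z ϑ) ≤
      γ * 1 * inner ℝ (θ - ϑ) (g z θ - g z ϑ) := by
    gcongr; linarith
  linarith

lemma norm_step_le (o : Oracle ξ g G μ L) (hL : 0 < L) (hγ : 0 < γ) (hγL : γ * L ≤ 1 / 2)
    (z : Z) (θ ϑ : E) :
    ‖(θ - γ • g z θ) - (ϑ - γ • g z ϑ)‖ ≤ ‖θ - ϑ‖ := by
  have h1 := o.norm_step_sq_le hL hγ hγL z θ ϑ
  have h2 := mul_nonneg hγ.le (o.inner_nonneg hL z θ ϑ)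
  exact le_of_sq_le_sq (by linarith) (norm_nonneg _)

lemma norm_sgdIter_sub_sgdIter_le (o : Oracle ξ g G μ L) (hL : 0 < L) (hγ : 0 < γ)
    (hγL : γ * L ≤ 1 / 2) (θ ϑ : E) (h : ℕ) (z : Fin h → Z) :
    ‖sgdIter g γ θ h z - sgdIter g γ ϑ h z‖ ≤ ‖θ - ϑ‖ := by
  induction h with
  | zero => exact le_rfl
  | succ h ih => exact (o.norm_step_le hL hγ hγL _ _ _).trans (ih _)

/-- Comparing each step with the step taken from `ϑ` on the same sample costs nothing by
nonexpansiveness, so only the gradients at `ϑ` accumulate and no factor exponential in `h` appears.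
-/
lemma norm_sgdIter_sub_le (o : Oracle ξ g G μ L) (hL : 0 < L) (hγ : 0 < γ)
    (hγL : γ * L ≤ 1 / 2) (θ ϑ : E) (h : ℕ) (z : Fin h → Z) :
    ‖sgdIter g γ θ h z - ϑ‖ ≤ ‖θ - ϑ‖ + gradNormSum g γ ϑ h z := by
  induction h with
  | zero => simp [sgdIter, gradNormSum]
  | succ h ih =>
    rw [gradNormSum_succ]
    set y := sgdIter g γ θ h (fun i => z i.castSucc) with hy
    have h1 : sgdIter g γ θ (h + 1) z - ϑ = ((y - γ • g (z (Fin.last h)) y) -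
        (ϑ - γ • g (z (Fin.last h)) ϑ)) - γ • g (z (Fin.last h)) ϑ := by
      rw [sgdIter]; abel
    rw [h1]
    refine (norm_sub_le _ _).trans ?_
    rw [norm_smul, Real.norm_of_nonneg hγ.le]
    linarith [o.norm_step_le hL hγ hγL (z (Fin.last h)) y ϑ, ih (fun i => z i.castSucc)]

/-- Freezing every gradient at `ϑ` costs `γL` times the distance of the iterate to `ϑ` at each step,
which `norm_sgdIter_sub_le` controls. -/
lemma norm_sgdIter_sub_add_gradSum_le (o : Oracle ξ g G μ L) (hL : 0 < L) (hγ : 0 < γ)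
    (hγL : γ * L ≤ 1 / 2) (θ ϑ : E) (h : ℕ) (z : Fin h → Z) :
    ‖sgdIter g γ θ h z - θ + gradSum g γ ϑ h z‖ ≤
      γ * h * L * (‖θ - ϑ‖ + gradNormSum g γ ϑ h z) := by
  induction h with
  | zero => simp [sgdIter, gradSum]
  | succ h ih =>
    rw [gradNormSum_succ, gradSum_succ]
    have ih' := ih (fun i => z i.castSucc)
    have h2 := o.norm_sgdIter_sub_le hL hγ hγL θ ϑ h (fun i => z i.castSucc)
    have hw := gradNormSum_nonneg g hγ.le ϑ h (fun i => z i.castSucc)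
    set y := sgdIter g γ θ h (fun i => z i.castSucc) with hy
    set W := gradNormSum g γ ϑ h (fun i => z i.castSucc)
    have h1 : sgdIter g γ θ (h + 1) z - θ + (gradSum g γ ϑ h (fun i => z i.castSucc) +
        γ • g (z (Fin.last h)) ϑ) = (y - θ + gradSum g γ ϑ h (fun i => z i.castSucc)) -
        γ • (g (z (Fin.last h)) y - g (z (Fin.last h)) ϑ) := by
      rw [sgdIter, smul_sub]; abel
    rw [h1]
    refine (norm_sub_le _ _).trans ?_
    rw [norm_smul, Real.norm_of_nonneg hγ.le]
    have h3 : γ * ‖g (z (Fin.last h)) y - g (z (Fin.last h)) ϑ‖ ≤ γ * (L * (‖θ - ϑ‖ + W)) := by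
      gcongr
      exact (o.lip _ _ _).trans (by gcongr)
    have h4 : 0 ≤ γ * (h + 1 : ℕ) * L * (γ * ‖g (z (Fin.last h)) ϑ‖) := by positivity
    push_cast at h4 ⊢
    linarith

lemma norm_sgdIter_sub_sub_le (o : Oracle ξ g G μ L) (hL : 0 < L) (hγ : 0 < γ)
    (hγL : γ * L ≤ 1 / 2) (θ ϑ : E) (h : ℕ) (z : Fin h → Z) :
    ‖sgdIter g γ θ h z - sgdIter g γ ϑ h z - (θ - ϑ)‖ ≤ γ * h * L * ‖θ - ϑ‖ := by
  induction h with
  | zero => simp [sgdIter]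
  | succ h ih =>
    have ih' := ih (fun i => z i.castSucc)
    have h2 := o.norm_sgdIter_sub_sgdIter_le hL hγ hγL θ ϑ h (fun i => z i.castSucc)
    rw [sgdIter, sgdIter]
    set y := sgdIter g γ θ h (fun i => z i.castSucc)
    set y' := sgdIter g γ ϑ h (fun i => z i.castSucc)
    have h1 : y - γ • g (z (Fin.last h)) y - (y' - γ • g (z (Fin.last h)) y') - (θ - ϑ) =
        (y - y' - (θ - ϑ)) - γ • (g (z (Fin.last h)) y - g (z (Fin.last h)) y') := by
      rw [smul_sub]; abel
    rw [h1]
    refine (norm_sub_le _ _).trans ?_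
    rw [norm_smul, Real.norm_of_nonneg hγ.le]
    have h3 : γ * ‖g (z (Fin.last h)) y - g (z (Fin.last h)) y'‖ ≤ γ * (L * ‖θ - ϑ‖) := by
      gcongr
      exact (o.lip _ _ _).trans (by gcongr)
    push_cast
    linarith

end Pointwise

variable [BorelSpace E] [SecondCountableTopology E]

lemma measurable_sgdIter (o : Oracle ξ g G μ L) (γ : ℝ) (h : ℕ) :
    Measurable fun p : E × (Fin h → Z) => sgdIter g γ p.1 h p.2 := by
  induction h with
  | zero => exact measurable_fst
  | succ h ih =>
    have h1 : Measurable fun p : E × (Fin (h + 1) → Z) =>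
        sgdIter g γ p.1 h (fun i => p.2 i.castSucc) :=
      ih.comp (measurable_fst.prodMk
        (measurable_pi_lambda _ fun i => (measurable_pi_apply _).comp measurable_snd))
    have h2 : Measurable fun p : E × (Fin (h + 1) → Z) => p.2 (Fin.last h) :=
      (measurable_pi_apply _).comp measurable_snd
    exact h1.sub ((o.meas.comp (h2.prodMk h1)).const_smul γ)

lemma measurable_sgdIter_right (o : Oracle ξ g G μ L) (γ : ℝ) (θ : E) (h : ℕ) :
    Measurable fun z : Fin h → Z => sgdIter g γ θ h z :=
  (o.measurable_sgdIter γ h).comp measurable_prodMk_left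

variable [IsProbabilityMeasure ξ]

lemma memLp_gradNormSum (o : Oracle ξ g G μ L) (γ : ℝ) (θ : E) (h : ℕ) :
    MemLp (gradNormSum g γ θ h) 4 (Measure.pi fun _ => ξ) := by
  have h1 : ∀ i : Fin h, MemLp (fun z : Fin h → Z => ‖g (z i) θ‖) 4 (Measure.pi fun _ => ξ) :=
    fun i => ((o.memLp θ).norm).comp_measurePreserving
      (measurePreserving_eval (fun _ : Fin h => ξ) i)
  exact (memLp_finsetSum Finset.univ fun i _ => h1 i).const_mul γ

lemma memLp_gradSum (o : Oracle ξ g G μ L) (γ : ℝ) (θ : E) (h : ℕ) :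
    MemLp (gradSum g γ θ h) 4 (Measure.pi fun _ => ξ) := by
  have h1 : ∀ i : Fin h, MemLp (fun z : Fin h → Z => g (z i) θ) 4 (Measure.pi fun _ => ξ) :=
    fun i => (o.memLp θ).comp_measurePreserving
      (measurePreserving_eval (fun _ : Fin h => ξ) i)
  exact (memLp_finsetSum Finset.univ fun i _ => h1 i).const_smul γ

lemma integrable_gradNormSum_pow (o : Oracle ξ g G μ L) (hγ : 0 ≤ γ) (θ : E) (h : ℕ) {p : ℕ}
    (hp : p ≤ 4) : Integrable (fun z => gradNormSum g γ θ h z ^ p) (Measure.pi fun _ => ξ) := by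
  have h1 : MemLp (gradNormSum g γ θ h) p (Measure.pi fun _ => ξ) :=
    (o.memLp_gradNormSum γ θ h).mono_exponent (by exact_mod_cast hp)
  refine h1.integrable_norm_pow'.congr (ae_of_all _ fun z => ?_)
  simp only [Real.norm_of_nonneg (gradNormSum_nonneg g hγ θ h z)]

/-- Convexity alone, without independence: the order `(γh)^(q+1)` suffices wherever this sum of
norms enters. Where cancellation between samples matters, `gradSum` is used instead. -/
lemma integral_gradNormSum_pow_le (o : Oracle ξ g G μ L) (hγ : 0 ≤ γ) (θ : E) (h : ℕ) {q : ℕ}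
    (hq : q < 4) : ∫ z, gradNormSum g γ θ h z ^ (q + 1) ∂(Measure.pi fun _ => ξ) ≤
      (γ * h) ^ (q + 1) * ∫ z, ‖g z θ‖ ^ (q + 1) ∂ξ := by
  have hint : Integrable (fun z => ‖g z θ‖ ^ (q + 1)) ξ :=
    MemLp.integrable_norm_pow' ((o.memLp θ).mono_exponent (by exact_mod_cast hq))
  have hint' : ∀ i : Fin h, Integrable (fun z : Fin h → Z => ‖g (z i) θ‖ ^ (q + 1))
      (Measure.pi fun _ => ξ) := fun i =>
    (measurePreserving_eval (fun _ : Fin h => ξ) i).integrable_comp_of_integrable hint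
  have hval : ∀ i : Fin h, ∫ z : Fin h → Z, ‖g (z i) θ‖ ^ (q + 1) ∂(Measure.pi fun _ => ξ) =
      ∫ z, ‖g z θ‖ ^ (q + 1) ∂ξ := fun i =>
    integral_comp_eval (μ := fun _ : Fin h => ξ) hint.1
  have hsum : Integrable (fun z : Fin h → Z => ∑ i : Fin h, ‖g (z i) θ‖ ^ (q + 1))
      (Measure.pi fun _ => ξ) := integrable_finsetSum Finset.univ fun i _ => hint' i
  calc ∫ z, gradNormSum g γ θ h z ^ (q + 1) ∂(Measure.pi fun _ => ξ)
      ≤ ∫ z : Fin h → Z, γ ^ (q + 1) * ((h : ℝ) ^ q * ∑ i : Fin h, ‖g (z i) θ‖ ^ (q + 1))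
          ∂(Measure.pi fun _ => ξ) := by
        refine integral_mono (o.integrable_gradNormSum_pow hγ θ h hq)
          ((hsum.const_mul _).const_mul _) fun z => ?_
        simp only [gradNormSum]
        rw [mul_pow]
        refine mul_le_mul_of_nonneg_left ?_ (by positivity)
        have h1 := pow_sum_le_card_mul_sum_pow (s := Finset.univ)
          (f := fun i => ‖g (z i) θ‖) (fun i _ => norm_nonneg _) q
        rwa [Finset.card_univ, Fintype.card_fin] at h1
    _ = _ := by
        rw [integral_const_mul, integral_const_mul, integral_finsetSum _ fun i _ => hint' i]
        simp only [hval, Finset.sum_const, Finset.card_univ, Fintype.card_fin, nsmul_eq_mul]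
        ring

lemma integrable_norm_sgdIter_sub_pow (o : Oracle ξ g G μ L) (hL : 0 < L) (hγ : 0 < γ)
    (hγL : γ * L ≤ 1 / 2) (θ ϑ : E) (h p : ℕ) :
    Integrable (fun z => ‖sgdIter g γ θ h z - sgdIter g γ ϑ h z‖ ^ p) (Measure.pi fun _ => ξ) := by
  refine Integrable.of_bound (((o.measurable_sgdIter_right γ θ h).sub
    (o.measurable_sgdIter_right γ ϑ h)).norm.pow_const p).aestronglyMeasurable (‖θ - ϑ‖ ^ p)
    (ae_of_all _ fun z => ?_)
  rw [norm_pow, norm_norm]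
  exact pow_le_pow_left₀ (norm_nonneg _) (o.norm_sgdIter_sub_sgdIter_le hL hγ hγL θ ϑ h z) p

variable [CompleteSpace E]

lemma integrable_sample (o : Oracle ξ g G μ L) (θ : E) : Integrable (fun z => g z θ) ξ :=
  (o.memLp θ).integrable (by norm_num)

/-- One squared factor is expanded and averaged; the other `m` are bounded pathwise by
nonexpansiveness. The rate `1 - γμ` is thus the same for all `m`. -/
lemma integral_norm_step_pow_le (o : Oracle ξ g G μ L) (hL : 0 < L) (hγ : 0 < γ)
    (hγL : γ * L ≤ 1 / 2) (θ ϑ : E) (m : ℕ) :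
    ∫ z, ‖(θ - γ • g z θ) - (ϑ - γ • g z ϑ)‖ ^ (2 * (m + 1)) ∂ξ ≤
      (1 - γ * μ) * ‖θ - ϑ‖ ^ (2 * (m + 1)) := by
  have hi : Integrable (fun z => inner ℝ (θ - ϑ) (g z θ - g z ϑ)) ξ :=
    ((o.integrable_sample θ).sub (o.integrable_sample ϑ)).const_inner _
  have hmean : ∫ z, inner ℝ (θ - ϑ) (g z θ - g z ϑ) ∂ξ = inner ℝ (θ - ϑ) (G θ - G ϑ) := by
    have h1 := integral_inner (𝕜 := ℝ) ((o.integrable_sample θ).sub (o.integrable_sample ϑ)) (θ - ϑ)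
    simp only [Pi.sub_apply] at h1
    rw [h1, integral_sub (o.integrable_sample θ) (o.integrable_sample ϑ), o.mean, o.mean]
  calc ∫ z, ‖(θ - γ • g z θ) - (ϑ - γ • g z ϑ)‖ ^ (2 * (m + 1)) ∂ξ
      ≤ ∫ z, (‖θ - ϑ‖ ^ 2) ^ m * (‖θ - ϑ‖ ^ 2 - γ * inner ℝ (θ - ϑ) (g z θ - g z ϑ)) ∂ξ := by
        refine integral_mono_of_nonneg (ae_of_all _ fun z => by positivity)
          (((integrable_const _).sub (hi.const_mul γ)).const_mul _) (ae_of_all _ fun z => ?_)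
        simp only
        rw [pow_mul, pow_succ]
        have h1 := o.norm_step_le hL hγ hγL z θ ϑ
        have h2 := o.norm_step_sq_le hL hγ hγL z θ ϑ
        gcongr
    _ = (‖θ - ϑ‖ ^ 2) ^ m * (‖θ - ϑ‖ ^ 2 - γ * inner ℝ (θ - ϑ) (G θ - G ϑ)) := by
        rw [integral_const_mul, integral_sub (integrable_const _) (hi.const_mul γ),
          integral_const_mul, hmean]
        simp
    _ ≤ (‖θ - ϑ‖ ^ 2) ^ m * (‖θ - ϑ‖ ^ 2 - γ * (μ * ‖θ - ϑ‖ ^ 2)) := by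
        gcongr
        exact o.mono θ ϑ
    _ = _ := by ring

lemma integral_norm_sgdIter_sub_pow_le (o : Oracle ξ g G μ L) (hL : 0 < L) (hγ : 0 < γ)
    (hγL : γ * L ≤ 1 / 2) (hμ : γ * μ ≤ 1) (θ ϑ : E) (h m : ℕ) :
    ∫ z, ‖sgdIter g γ θ h z - sgdIter g γ ϑ h z‖ ^ (2 * (m + 1)) ∂(Measure.pi fun _ => ξ) ≤
      (1 - γ * μ) ^ h * ‖θ - ϑ‖ ^ (2 * (m + 1)) := by
  induction h with
  | zero => simp [sgdIter]
  | succ h ih =>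
    have hint := o.integrable_norm_sgdIter_sub_pow hL hγ hγL θ ϑ (h + 1) (2 * (m + 1))
    obtain ⟨h1, h2⟩ := integral_pi_succ ξ h
      (fun z w => ‖(sgdIter g γ θ h z - γ • g w (sgdIter g γ θ h z)) -
        (sgdIter g γ ϑ h z - γ • g w (sgdIter g γ ϑ h z))‖ ^ (2 * (m + 1))) hint
    have h3 := o.integrable_norm_sgdIter_sub_pow hL hγ hγL θ ϑ h (2 * (m + 1))
    calc _ = _ := h2
      _ ≤ ∫ z, (1 - γ * μ) * ‖sgdIter g γ θ h z - sgdIter g γ ϑ h z‖ ^ (2 * (m + 1))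
          ∂(Measure.pi fun _ => ξ) :=
          integral_mono h1 (h3.const_mul _) fun z => o.integral_norm_step_pow_le hL hγ hγL _ _ m
      _ ≤ (1 - γ * μ) * ((1 - γ * μ) ^ h * ‖θ - ϑ‖ ^ (2 * (m + 1))) := by
          rw [integral_const_mul]
          exact mul_le_mul_of_nonneg_left ih (by linarith)
      _ = _ := by ring

lemma norm_mean_sub_le (o : Oracle ξ g G μ L) (θ ϑ : E) : ‖G θ - G ϑ‖ ≤ L * ‖θ - ϑ‖ := by
  rw [← o.mean, ← o.mean, ← integral_sub (o.integrable_sample θ) (o.integrable_sample ϑ)]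
  refine (norm_integral_le_of_norm_le_const (ae_of_all _ fun z => o.lip z θ ϑ)).trans ?_
  simp

lemma continuous_mean (o : Oracle ξ g G μ L) : Continuous G :=
  (LipschitzWith.of_dist_le_mul (K := L.toNNReal) fun x y => by
    rw [dist_eq_norm, dist_eq_norm]
    exact (o.norm_mean_sub_le x y).trans (by gcongr; exact Real.le_coe_toNNReal L)).continuous

lemma memLp_sgdIter (o : Oracle ξ g G μ L) (hL : 0 < L) (hγ : 0 < γ)
    (hγL : γ * L ≤ 1 / 2) (θ : E) (h : ℕ) :
    MemLp (sgdIter g γ θ h) 4 (Measure.pi fun _ => ξ) := by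
  have h1 : MemLp (fun z => sgdIter g γ θ h z - θ) 4 (Measure.pi fun _ => ξ) := by
    refine (o.memLp_gradNormSum γ θ h).mono'
      ((o.measurable_sgdIter_right γ θ h).sub_const θ).aestronglyMeasurable (ae_of_all _ fun z => ?_)
    simpa using o.norm_sgdIter_sub_le hL hγ hγL θ θ h z
  exact (h1.add (memLp_const θ)).ae_eq (ae_of_all _ fun z => by simp)

lemma integrable_sgdIter (o : Oracle ξ g G μ L) (hL : 0 < L) (hγ : 0 < γ)
    (hγL : γ * L ≤ 1 / 2) (θ : E) (h : ℕ) :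
    Integrable (sgdIter g γ θ h) (Measure.pi fun _ => ξ) :=
  (o.memLp_sgdIter hL hγ hγL θ h).integrable (by norm_num)

lemma integrable_mean_sgdIter (o : Oracle ξ g G μ L) (hL : 0 < L) (hγ : 0 < γ)
    (hγL : γ * L ≤ 1 / 2) (θ : E) (h : ℕ) :
    Integrable (fun z => G (sgdIter g γ θ h z)) (Measure.pi fun _ => ξ) := by
  have h1 : Integrable (fun z => G (sgdIter g γ θ h z) - G 0) (Measure.pi fun _ => ξ) := by
    refine ((o.integrable_sgdIter hL hγ hγL θ h).norm.const_mul L).mono'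
      ((o.continuous_mean.measurable.comp
        (o.measurable_sgdIter_right γ θ h)).sub_const _).aestronglyMeasurable
      (ae_of_all _ fun z => ?_)
    simpa using o.norm_mean_sub_le (sgdIter g γ θ h z) 0
  exact (h1.add (integrable_const (G 0))).congr (ae_of_all _ fun z => by simp)

lemma integral_sgdIter (o : Oracle ξ g G μ L) (hL : 0 < L) (hγ : 0 < γ)
    (hγL : γ * L ≤ 1 / 2) (θ : E) (h : ℕ) :
    ∫ z, sgdIter g γ θ h z ∂(Measure.pi fun _ => ξ) =
      θ - γ • ∑ l ∈ Finset.range h, ∫ z, G (sgdIter g γ θ l z) ∂(Measure.pi fun _ => ξ) := by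
  induction h with
  | zero => simp [sgdIter]
  | succ h ih =>
    obtain ⟨-, h2⟩ := integral_pi_succ ξ h
      (fun z w => sgdIter g γ θ h z - γ • g w (sgdIter g γ θ h z))
      (o.integrable_sgdIter hL hγ hγL θ (h + 1))
    have h3 : ∀ z, ∫ w, (sgdIter g γ θ h z - γ • g w (sgdIter g γ θ h z)) ∂ξ =
        sgdIter g γ θ h z - γ • G (sgdIter g γ θ h z) := fun z => by
      have hs : Integrable (fun w => γ • g w (sgdIter g γ θ h z)) ξ :=
        (o.integrable_sample _).smul γ
      rw [integral_sub (integrable_const _) hs, integral_smul, o.mean]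
      simp
    simp_rw [h3] at h2
    have hs : Integrable (fun z => γ • G (sgdIter g γ θ h z)) (Measure.pi fun _ => ξ) :=
      (o.integrable_mean_sgdIter hL hγ hγL θ h).smul γ
    rw [integral_sub (o.integrable_sgdIter hL hγ hγL θ h) hs, integral_smul, ih] at h2
    rw [Finset.sum_range_succ, smul_add, ← sub_sub]
    exact h2

end Oracle

end SingleClient

/-! ### Second-order expansion of the mean displacement of one client. -/

section Expansion

variable {Z : Type*} [MeasurableSpace Z] {E : Type*} [NormedAddCommGroup E] [InnerProductSpace ℝ E]
  [MeasurableSpace E] [BorelSpace E] [SecondCountableTopology E] [CompleteSpace E]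
  {ξ : Measure Z} [IsProbabilityMeasure ξ] {g : Z → E → E} {G : E → E} {μ L γ : ℝ}

/-- Moment bounds for a random variable bound the mean of a polynomial with nonnegative
coefficients. -/
lemma integral_quartic_le {Ω : Type*} [MeasurableSpace Ω] {P : Measure Ω} [IsProbabilityMeasure P]
    {f : Ω → ℝ} {w₁ w₂ w₃ w₄ : ℝ} (i₁ : Integrable f P) (i₂ : Integrable (fun ω => f ω ^ 2) P)
    (i₃ : Integrable (fun ω => f ω ^ 3) P) (i₄ : Integrable (fun ω => f ω ^ 4) P)
    (h₁ : ∫ ω, f ω ∂P ≤ w₁) (h₂ : ∫ ω, f ω ^ 2 ∂P ≤ w₂) (h₃ : ∫ ω, f ω ^ 3 ∂P ≤ w₃)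
    (h₄ : ∫ ω, f ω ^ 4 ∂P ≤ w₄) (a : ℝ) {b c d e : ℝ} (hb : 0 ≤ b) (hc : 0 ≤ c) (hd : 0 ≤ d)
    (he : 0 ≤ e) :
    Integrable (fun ω => a + b * f ω + c * f ω ^ 2 + d * f ω ^ 3 + e * f ω ^ 4) P ∧
    ∫ ω, (a + b * f ω + c * f ω ^ 2 + d * f ω ^ 3 + e * f ω ^ 4) ∂P ≤
      a + b * w₁ + c * w₂ + d * w₃ + e * w₄ := by
  have j₁ := i₁.const_mul b
  have j₂ := i₂.const_mul c
  have j₃ := i₃.const_mul d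
  have j₄ := i₄.const_mul e
  have k₁ : Integrable (fun ω => a + b * f ω) P := (integrable_const a).add j₁
  have k₂ : Integrable (fun ω => a + b * f ω + c * f ω ^ 2) P := k₁.add j₂
  have k₃ : Integrable (fun ω => a + b * f ω + c * f ω ^ 2 + d * f ω ^ 3) P := k₂.add j₃
  refine ⟨k₃.add j₄, ?_⟩
  rw [integral_add k₃ j₄, integral_add k₂ j₃, integral_add k₁ j₂, integral_add (integrable_const a) j₁,
    integral_const_mul, integral_const_mul, integral_const_mul, integral_const_mul]
  simp only [integral_const, probReal_univ, one_smul]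
  gcongr

namespace Oracle

lemma integral_gradNormSum_pow_le_of_le (o : Oracle ξ g G μ L) (hγ : 0 ≤ γ) {θ : E} {M η : ℝ}
    (hM : ∀ q < 4, ∫ z, ‖g z θ‖ ^ (q + 1) ∂ξ ≤ M) {h : ℕ} (hη : γ * h ≤ η) {q : ℕ}
    (hq : q < 4) : ∫ z, gradNormSum g γ θ h z ^ (q + 1) ∂(Measure.pi fun _ => ξ) ≤
      M * η ^ (q + 1) := by
  refine (o.integral_gradNormSum_pow_le hγ θ h hq).trans ?_
  rw [mul_comm]
  have h0 : 0 ≤ γ * h := by positivity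
  exact mul_le_mul (hM q hq) (pow_le_pow_left₀ h0 hη _) (by positivity)
    ((integral_nonneg fun z => by positivity).trans (hM q hq))

/-- The mean displacement after `h` steps is that of gradient descent at the reference point. -/
lemma norm_integral_sgdIter_sub_add_le (o : Oracle ξ g G μ L) (hL : 0 < L) (hγ : 0 < γ)
    (hγL : γ * L ≤ 1 / 2) {θs : E} {M η : ℝ} (hM : ∀ q < 4, ∫ z, ‖g z θs‖ ^ (q + 1) ∂ξ ≤ M)
    {h : ℕ} (hη : γ * h ≤ η) (θ : E) :
    ‖∫ z, sgdIter g γ θ h z ∂(Measure.pi fun _ => ξ) - θ + (γ * h) • G θs‖ ≤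
      η * (L * (‖θ - θs‖ + M * η)) := by
  rw [o.integral_sgdIter hL hγ hγL]
  have hconst : (γ * h) • G θs = γ • ∑ _l ∈ Finset.range h, G θs := by
    rw [Finset.sum_const, Finset.card_range, mul_smul, Nat.cast_smul_eq_nsmul]
  have hre : θ - γ • ∑ l ∈ Finset.range h, ∫ z, G (sgdIter g γ θ l z) ∂(Measure.pi fun _ => ξ) - θ +
      (γ * h) • G θs = -(γ • ∑ l ∈ Finset.range h,
        (∫ z, G (sgdIter g γ θ l z) ∂(Measure.pi fun _ => ξ) - G θs)) := by
    rw [Finset.sum_sub_distrib, smul_sub, ← hconst]; abel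
  have hη0 : 0 ≤ η := le_trans (by positivity) hη
  have hl : ∀ l ∈ Finset.range h, ‖∫ z, G (sgdIter g γ θ l z) ∂(Measure.pi fun _ => ξ) - G θs‖ ≤
      L * (‖θ - θs‖ + M * η) := by
    intro l hl
    have hlh : γ * l ≤ η := le_trans (by gcongr; exact (Finset.mem_range.1 hl).le) hη
    have h1 : ∫ z, G (sgdIter g γ θ l z) ∂(Measure.pi fun _ => ξ) - G θs =
        ∫ z, (G (sgdIter g γ θ l z) - G θs) ∂(Measure.pi fun _ => ξ) := by
      rw [integral_sub (o.integrable_mean_sgdIter hL hγ hγL θ l) (integrable_const _)]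
      simp
    have hW : Integrable (gradNormSum g γ θs l) (Measure.pi fun _ => ξ) := by
      simpa using o.integrable_gradNormSum_pow hγ.le θs l (p := 1) (by norm_num)
    have hW1 : ∫ z, gradNormSum g γ θs l z ∂(Measure.pi fun _ => ξ) ≤ M * η := by
      simpa using o.integral_gradNormSum_pow_le_of_le hγ.le hM hlh (q := 0) (by norm_num)
    rw [h1]
    calc ‖∫ z, (G (sgdIter g γ θ l z) - G θs) ∂(Measure.pi fun _ => ξ)‖
        ≤ ∫ z, L * (‖θ - θs‖ + gradNormSum g γ θs l z) ∂(Measure.pi fun _ => ξ) := by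
          refine norm_integral_le_of_norm_le (((integrable_const _).add hW).const_mul L)
            (ae_of_all _ fun z => (o.norm_mean_sub_le _ _).trans ?_)
          exact mul_le_mul_of_nonneg_left (o.norm_sgdIter_sub_le hL hγ hγL θ θs l z) hL.le
      _ = L * (‖θ - θs‖ + ∫ z, gradNormSum g γ θs l z ∂(Measure.pi fun _ => ξ)) := by
          rw [integral_const_mul, integral_add (integrable_const _) hW]
          simp
      _ ≤ _ := by gcongr
  rw [hre, norm_neg, norm_smul, Real.norm_of_nonneg hγ.le]
  have hb : 0 ≤ L * (‖θ - θs‖ + M * η) ∨ h = 0 := by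
    rcases Nat.eq_zero_or_pos h with h0 | h0
    · exact Or.inr h0
    · exact Or.inl ((norm_nonneg _).trans (hl 0 (Finset.mem_range.2 h0)))
  rcases hb with hb | rfl
  · calc _ ≤ γ * (h * (L * (‖θ - θs‖ + M * η))) := by
          gcongr
          simpa using norm_sum_le_of_le _ hl
      _ = γ * h * (L * (‖θ - θs‖ + M * η)) := by ring
      _ ≤ _ := by gcongr
  · have hM0 : 0 ≤ M := (integral_nonneg fun z => by positivity).trans (hM 0 (by norm_num))
    simp only [Finset.range_zero, Finset.sum_empty, norm_zero, mul_zero]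
    positivity

/-- Second-order expansion of the expected gradient after `h` local steps. -/
lemma norm_integral_mean_sgdIter_sub_le (o : Oracle ξ g G μ L) (hL : 0 < L) (hγ : 0 < γ)
    (hγL : γ * L ≤ 1 / 2) {θs : E} {M η : ℝ} (hM : ∀ q < 4, ∫ z, ‖g z θs‖ ^ (q + 1) ∂ξ ≤ M)
    {S : E →L[ℝ] E} {T : E →L[ℝ] E →L[ℝ] E} {R : ℝ} (hR : 0 ≤ R)
    (hT : ∀ θ, ‖G θ - (G θs + S (θ - θs) + (1 / 2 : ℝ) • T (θ - θs) (θ - θs))‖ ≤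
      R * ‖θ - θs‖ ^ 3)
    {h : ℕ} (hη : γ * h ≤ η) (hη1 : η ≤ 1) (θ : E) :
    ‖∫ z, G (sgdIter g γ θ h z) ∂(Measure.pi fun _ => ξ) -
        (G θs + S (θ - θs) + (1 / 2 : ℝ) • T (θ - θs) (θ - θs) - (γ * h) • S (G θs))‖ ≤
      (4 * R * (1 + M) + ‖T‖ * (1 + L) * (3 * M + 2) + ‖S‖ * L * (1 + M)) *
        (η ^ 2 + η * ‖θ - θs‖ + η * ‖θ - θs‖ ^ 2 + ‖θ - θs‖ ^ 3) := by
  have hM0 : 0 ≤ M := (integral_nonneg fun z => by positivity).trans (hM 0 (by norm_num))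
  have hη0 : 0 ≤ η := le_trans (by positivity) hη
  set x := θ - θs with hx
  set r := ‖x‖ with hr
  have hr0 : 0 ≤ r := norm_nonneg _
  set W := gradNormSum g γ θs h with hWdef
  have hW0 : ∀ z, 0 ≤ W z := gradNormSum_nonneg g hγ.le θs h
  have i1 : Integrable W (Measure.pi fun _ => ξ) := by
    simpa using o.integrable_gradNormSum_pow hγ.le θs h (p := 1) (by norm_num)
  have i2 : Integrable (fun z => W z ^ 2) (Measure.pi fun _ => ξ) :=
    o.integrable_gradNormSum_pow hγ.le θs h (by norm_num)
  have i3 : Integrable (fun z => W z ^ 3) (Measure.pi fun _ => ξ) :=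
    o.integrable_gradNormSum_pow hγ.le θs h (by norm_num)
  have i4 : Integrable (fun z => W z ^ 4) (Measure.pi fun _ => ξ) :=
    o.integrable_gradNormSum_pow hγ.le θs h (by norm_num)
  have w1 : ∫ z, W z ∂(Measure.pi fun _ => ξ) ≤ M * η := by
    simpa using o.integral_gradNormSum_pow_le_of_le hγ.le hM hη (q := 0) (by norm_num)
  have w2 : ∫ z, W z ^ 2 ∂(Measure.pi fun _ => ξ) ≤ M * η ^ 2 :=
    o.integral_gradNormSum_pow_le_of_le hγ.le hM hη (q := 1) (by norm_num)
  have w3 : ∫ z, W z ^ 3 ∂(Measure.pi fun _ => ξ) ≤ M * η ^ 3 :=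
    o.integral_gradNormSum_pow_le_of_le hγ.le hM hη (q := 2) (by norm_num)
  have w4 : ∫ z, W z ^ 4 ∂(Measure.pi fun _ => ξ) ≤ M * η ^ 4 :=
    o.integral_gradNormSum_pow_le_of_le hγ.le hM hη (q := 3) (by norm_num)
  -- The linear term `S (y - θ)` is set aside because only its mean counts, and that mean is known
  -- to second order. What remains is small enough to be bounded pathwise.
  let rem : (Fin h → Z) → E := fun z => G (sgdIter g γ θ h z) -
    (G θs + S x + (1 / 2 : ℝ) • T x x) - S (sgdIter g γ θ h z - θ)
  have iG := o.integrable_mean_sgdIter hL hγ hγL θ h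
  have iy := o.integrable_sgdIter hL hγ hγL θ h
  have iS : Integrable (fun z => S (sgdIter g γ θ h z - θ)) (Measure.pi fun _ => ξ) :=
    S.integrable_comp (iy.sub (integrable_const θ))
  have hbound : ∀ z, ‖rem z‖ ≤ R * (4 * (r ^ 3 + W z ^ 3)) +
      ‖T‖ * (1 + L) * (2 * r * W z + W z ^ 2 + (2 * η * r ^ 2 + η * r * W z)) := by
    intro z
    set y := sgdIter g γ θ h z with hy
    have hW0z := hW0 z
    have hy1 : ‖y - θs‖ ≤ r + W z := o.norm_sgdIter_sub_le hL hγ hγL θ θs h z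
    have hu : ‖y - θ‖ ≤ (1 + L) * (W z + η * r) := by
      have h1 : y - θ = (y - θ + gradSum g γ θs h z) - gradSum g γ θs h z := by abel
      rw [h1]
      refine (norm_sub_le _ _).trans ?_
      have h2 := o.norm_sgdIter_sub_add_gradSum_le hL hγ hγL θ θs h z
      have h3 : γ * h * L * (r + W z) ≤ η * L * (r + W z) := by gcongr
      have h4 : η * L * W z ≤ 1 * L * W z := by gcongr
      have h5 := norm_gradSum_le g hγ.le θs h z
      have h6 : 0 ≤ η * r := by positivity
      linarith
    -- Taylor remainder at the iterate plus the change of the quadratic term, expanded one slot at a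
    -- time so that symmetry of `T` is not needed.
    have hdec : rem z = (G y - (G θs + S (y - θs) + (1 / 2 : ℝ) • T (y - θs) (y - θs))) +
        (1 / 2 : ℝ) • (T (y - θ) (y - θs) + T x (y - θ)) := by
      have e1 : y - θs = (y - θ) + x := by rw [hx]; abel
      have e2 : T (y - θs) (y - θs) = T (y - θ) (y - θs) + T x (y - θ) + T x x := by
        have e4 : T (y - θs) = T (y - θ) + T x := by rw [e1, map_add]
        rw [e4, add_apply]
        conv_lhs => rw [e1, map_add (T x), ← e1]
        rw [← add_assoc]
      have e3 : S (y - θs) = S (y - θ) + S x := by rw [e1, map_add]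
      simp only [rem]
      rw [e2, e3, smul_add]
      abel
    rw [hdec]
    refine (norm_add_le _ _).trans (add_le_add ?_ ?_)
    · refine (hT y).trans ?_
      refine mul_le_mul_of_nonneg_left ?_ hR
      refine (pow_le_pow_left₀ (norm_nonneg _) hy1 3).trans ?_
      have := add_pow_le hr0 hW0z 3
      norm_num at this
      exact this
    · rw [norm_smul]
      have t1 : ‖T (y - θ) (y - θs)‖ ≤ ‖T‖ * ((1 + L) * (W z + η * r)) * (r + W z) :=
        (T.le_opNorm₂ _ _).trans (by gcongr)
      have t2 : ‖T x (y - θ)‖ ≤ ‖T‖ * r * ((1 + L) * (W z + η * r)) :=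
        (T.le_opNorm₂ _ _).trans (by gcongr)
      have t3 := norm_add_le (T (y - θ) (y - θs)) (T x (y - θ))
      have t4 : 0 ≤ ‖T‖ * (1 + L) * (2 * r * W z + W z ^ 2 + (2 * η * r ^ 2 + η * r * W z)) := by
        positivity
      have t5 : ‖T‖ * ((1 + L) * (W z + η * r)) * (r + W z) +
          ‖T‖ * r * ((1 + L) * (W z + η * r)) =
          ‖T‖ * (1 + L) * (2 * r * W z + W z ^ 2 + (2 * η * r ^ 2 + η * r * W z)) := by ring
      rw [Real.norm_of_nonneg (by norm_num : (0 : ℝ) ≤ 1 / 2)]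
      linarith
  have hdec : ∫ z, G (sgdIter g γ θ h z) ∂(Measure.pi fun _ => ξ) -
        (G θs + S x + (1 / 2 : ℝ) • T x x - (γ * h) • S (G θs)) =
      ∫ z, rem z ∂(Measure.pi fun _ => ξ) +
        S (∫ z, sgdIter g γ θ h z ∂(Measure.pi fun _ => ξ) - θ + (γ * h) • G θs) := by
    have e1 : ∫ z, S (sgdIter g γ θ h z - θ) ∂(Measure.pi fun _ => ξ) =
        S (∫ z, sgdIter g γ θ h z ∂(Measure.pi fun _ => ξ) - θ) := by
      have := S.integral_comp_comm (iy.sub (integrable_const θ))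
      simp only [Pi.sub_apply] at this
      rw [this, integral_sub iy (integrable_const θ)]
      simp
    have e2 : ∫ z, rem z ∂(Measure.pi fun _ => ξ) =
        ∫ z, G (sgdIter g γ θ h z) ∂(Measure.pi fun _ => ξ) -
          (G θs + S x + (1 / 2 : ℝ) • T x x) -
          S (∫ z, sgdIter g γ θ h z ∂(Measure.pi fun _ => ξ) - θ) := by
      rw [← e1]
      simp only [rem]
      have i4 : Integrable (fun z => G (sgdIter g γ θ h z) - (G θs + S x + (1 / 2 : ℝ) • T x x))
          (Measure.pi fun _ => ξ) := iG.sub (integrable_const _)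
      rw [integral_sub i4 iS, integral_sub iG (integrable_const _)]
      simp
    rw [e2, map_add, map_smul]
    abel
  rw [hdec]
  refine (norm_add_le _ _).trans ?_
  have hA : ‖∫ z, rem z ∂(Measure.pi fun _ => ξ)‖ ≤ R * (4 * (r ^ 3 + M * η ^ 3)) +
      ‖T‖ * (1 + L) * (2 * r * (M * η) + M * η ^ 2 + (2 * η * r ^ 2 + η * r * (M * η))) := by
    obtain ⟨irem, hrem⟩ := integral_quartic_le i1 i2 i3 i4 w1 w2 w3 w4
      (R * (4 * r ^ 3) + ‖T‖ * (1 + L) * (2 * η * r ^ 2))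
      (b := ‖T‖ * (1 + L) * (2 * r + η * r)) (c := ‖T‖ * (1 + L)) (d := R * 4) (e := 0)
      (by positivity) (by positivity) (by positivity) le_rfl
    refine (norm_integral_le_of_norm_le irem (ae_of_all _ fun z => ?_)).trans (hrem.trans_eq ?_)
    · exact (hbound z).trans_eq (by ring)
    · ring
  have hB : ‖S (∫ z, sgdIter g γ θ h z ∂(Measure.pi fun _ => ξ) - θ + (γ * h) • G θs)‖ ≤
      ‖S‖ * (η * (L * (r + M * η))) :=
    (S.le_opNorm _).trans (by
      gcongr
      exact o.norm_integral_sgdIter_sub_add_le hL hγ hγL hM hη θ)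
  have q1 : η ^ 3 ≤ η ^ 2 := pow_le_pow_of_le_one hη0 hη1 (by norm_num)
  have q2 : η ^ 2 * r ≤ η * r := by
    have : η ^ 2 ≤ η := by nlinarith
    gcongr
  have p1 : 0 ≤ η * r := by positivity
  have p2 : 0 ≤ η * r ^ 2 := by positivity
  have p3 : 0 ≤ r ^ 3 := by positivity
  have p4 : 0 ≤ η ^ 2 := by positivity
  have c1 : 4 * (r ^ 3 + M * η ^ 3) ≤ 4 * (1 + M) * (η ^ 2 + η * r + η * r ^ 2 + r ^ 3) := by
    have : M * η ^ 3 ≤ M * η ^ 2 := by gcongr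
    have := mul_nonneg hM0 p1; have := mul_nonneg hM0 p2; have := mul_nonneg hM0 p3
    linarith
  have c2 : 2 * r * (M * η) + M * η ^ 2 + (2 * η * r ^ 2 + η * r * (M * η)) ≤
      (3 * M + 2) * (η ^ 2 + η * r + η * r ^ 2 + r ^ 3) := by
    have : M * (η ^ 2 * r) ≤ M * (η * r) := by gcongr
    have := mul_nonneg hM0 p1; have := mul_nonneg hM0 p2; have := mul_nonneg hM0 p3
    have := mul_nonneg hM0 p4
    linarith
  have c3 : η * (r + M * η) ≤ (1 + M) * (η ^ 2 + η * r + η * r ^ 2 + r ^ 3) := by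
    have := mul_nonneg hM0 p1; have := mul_nonneg hM0 p2; have := mul_nonneg hM0 p3
    linarith
  have d1 := mul_le_mul_of_nonneg_left c1 hR
  have d2 := mul_le_mul_of_nonneg_left c2 (show 0 ≤ ‖T‖ * (1 + L) by positivity)
  have d3 := mul_le_mul_of_nonneg_left c3 (show 0 ≤ ‖S‖ * L by positivity)
  linarith

/-- Second-order expansion of the expected displacement of one client in one round. -/
lemma norm_integral_sgdIter_sub_expansion_le (o : Oracle ξ g G μ L) (hL : 0 < L) (hγ : 0 < γ)
    (hγL : γ * L ≤ 1 / 2) {θs : E} {M : ℝ} (hM : ∀ q < 4, ∫ z, ‖g z θs‖ ^ (q + 1) ∂ξ ≤ M)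
    {S : E →L[ℝ] E} {T : E →L[ℝ] E →L[ℝ] E} {R : ℝ} (hR : 0 ≤ R)
    (hT : ∀ θ, ‖G θ - (G θs + S (θ - θs) + (1 / 2 : ℝ) • T (θ - θs) (θ - θs))‖ ≤
      R * ‖θ - θs‖ ^ 3)
    {H : ℕ} (hη1 : γ * H ≤ 1) (θ : E) :
    ‖∫ z, sgdIter g γ θ H z ∂(Measure.pi fun _ => ξ) - θ +
        (γ * H) • (G θs + S (θ - θs) + (1 / 2 : ℝ) • T (θ - θs) (θ - θs)) -
        (γ * H * (γ * ((H : ℝ) - 1) / 2)) • S (G θs)‖ ≤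
      (γ * H) * ((4 * R * (1 + M) + ‖T‖ * (1 + L) * (3 * M + 2) + ‖S‖ * L * (1 + M)) *
        ((γ * H) ^ 2 + (γ * H) * ‖θ - θs‖ + (γ * H) * ‖θ - θs‖ ^ 2 + ‖θ - θs‖ ^ 3)) := by
  rw [o.integral_sgdIter hL hγ hγL]
  set A := G θs + S (θ - θs) + (1 / 2 : ℝ) • T (θ - θs) (θ - θs) with hA
  -- Gradients are evaluated at the iterates `0, …, H - 1`, the first of which has not drifted;
  -- hence the factor `H - 1` in the heterogeneity bias.
  have hsum : (∑ l ∈ Finset.range H, (l : ℝ)) = H * ((H : ℝ) - 1) / 2 := by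
    clear hη1
    induction H with
    | zero => simp
    | succ n ih => rw [Finset.sum_range_succ, ih]; push_cast; ring
  have hre : θ - γ • ∑ l ∈ Finset.range H, ∫ z, G (sgdIter g γ θ l z) ∂(Measure.pi fun _ => ξ) - θ +
      (γ * H) • A - (γ * H * (γ * ((H : ℝ) - 1) / 2)) • S (G θs) =
      -(γ • ∑ l ∈ Finset.range H, (∫ z, G (sgdIter g γ θ l z) ∂(Measure.pi fun _ => ξ) -
        (A - (γ * l) • S (G θs)))) := by
    rw [Finset.sum_sub_distrib, Finset.sum_sub_distrib, ← Finset.sum_smul, ← Finset.mul_sum, hsum,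
      Finset.sum_const, Finset.card_range, ← Nat.cast_smul_eq_nsmul ℝ, smul_sub, smul_sub,
      smul_smul, smul_smul]
    have : γ * (γ * (H * ((H : ℝ) - 1) / 2)) = γ * H * (γ * ((H : ℝ) - 1) / 2) := by ring
    rw [this]
    abel
  rw [hre, norm_neg, norm_smul, Real.norm_of_nonneg hγ.le, mul_assoc]
  refine mul_le_mul_of_nonneg_left ?_ hγ.le
  refine (norm_sum_le_of_le _ fun l hl => o.norm_integral_mean_sgdIter_sub_le hL hγ hγL hM hR hT
    (h := l) (η := γ * H) (by gcongr; exact (Finset.mem_range.1 hl).le) hη1 θ).trans ?_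
  rw [Finset.sum_const, Finset.card_range, nsmul_eq_mul]

end Oracle
end Expansion

/-! ### Tensor products and quadratic functionals of independent sums. -/

section Bilinear

variable {E : Type*} [NormedAddCommGroup E] [InnerProductSpace ℝ E]

/-- The tensor product `x ⊗ y`, i.e. the matrix `x yᵀ`, as a continuous bilinear map. -/
noncomputable def tensor (E : Type*) [NormedAddCommGroup E] [InnerProductSpace ℝ E] :
    E →L[ℝ] E →L[ℝ] (E →L[ℝ] E) :=
  ((ContinuousLinearMap.smulRightL ℝ E E).comp
    (isBoundedBilinearMap_inner (𝕜 := ℝ) (E := E)).toContinuousLinearMap).flip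

lemma tensor_apply_apply (x y v : E) : tensor E x y v = inner ℝ y v • x := rfl

lemma tensor_eq_rankOne (x y : E) : tensor E x y = InnerProductSpace.rankOne ℝ x y := rfl

lemma norm_tensor_apply (x y : E) : ‖tensor E x y‖ = ‖x‖ * ‖y‖ := by
  rw [tensor_eq_rankOne, InnerProductSpace.norm_rankOne]

variable [MeasurableSpace E] [BorelSpace E] [SecondCountableTopology E] [CompleteSpace E]
  {F : Type*} [NormedAddCommGroup F] [NormedSpace ℝ F] [CompleteSpace F]

lemma integrable_bilin_self {Ω : Type*} [MeasurableSpace Ω] {P : Measure Ω} {X : Ω → E}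
    (hX : MemLp X 2 P) (B : E →L[ℝ] E →L[ℝ] F) : Integrable (fun ω => B (X ω) (X ω)) P := by
  have h2 : Integrable (fun ω => ‖X ω‖ ^ 2) P := hX.integrable_norm_pow (by norm_num)
  refine (h2.const_mul ‖B‖).mono' ?_ (ae_of_all _ fun ω => ?_)
  · exact B.aestronglyMeasurable_comp₂ hX.1 hX.1
  · refine (B.le_opNorm₂ _ _).trans_eq (by ring)

/-- For independent centred vectors, quadratic functionals of the sum are additive in mean. -/
lemma integral_bilin_sum_pi {ι : Type*} [Fintype ι] {Ω : ι → Type*} [∀ i, MeasurableSpace (Ω i)]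
    {P : ∀ i, Measure (Ω i)} [∀ i, IsProbabilityMeasure (P i)] {X : ∀ i, Ω i → E}
    (hX : ∀ i, MemLp (X i) 2 (P i)) (h0 : ∀ i, ∫ ω, X i ω ∂(P i) = 0)
    (B : E →L[ℝ] E →L[ℝ] F) :
    ∫ ω, B (∑ i, X i (ω i)) (∑ i, X i (ω i)) ∂(Measure.pi P) =
      ∑ i, ∫ ω, B (X i ω) (X i ω) ∂(P i) := by
  classical
  have hmp := fun i => measurePreserving_eval P i
  have hint : ∀ i, MemLp (fun ω : ∀ i, Ω i => X i (ω i)) 2 (Measure.pi P) := fun i =>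
    (hX i).comp_measurePreserving (hmp i)
  have hind := iIndepFun_pi (μ := P) fun i => (hX i).1.aemeasurable
  have hcross : ∀ i j, Integrable (fun ω : ∀ i, Ω i => B (X i (ω i)) (X j (ω j))) (Measure.pi P) := by
    intro i j
    by_cases hij : i = j
    · subst hij
      exact integrable_bilin_self (hint i) B
    · exact (hind.indepFun hij).integrable_bilin ((hint i).integrable (by norm_num))
        ((hint j).integrable (by norm_num)) B
  have hzero : ∀ i j, i ≠ j →
      ∫ ω : ∀ i, Ω i, B (X i (ω i)) (X j (ω j)) ∂(Measure.pi P) = 0 := by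
    intro i j hij
    rw [(hind.indepFun hij).integral_bilin ((hint i).integrable (by norm_num))
        ((hint j).integrable (by norm_num)) B, integral_comp_eval (hX i).1, h0]
    simp
  simp only [map_sum, sum_apply]
  rw [integral_finsetSum _ fun j _ => integrable_finsetSum _ fun i _ => hcross i j]
  refine Finset.sum_congr rfl fun j _ => ?_
  rw [integral_finsetSum _ fun i _ => hcross i j, Finset.sum_eq_single j]
  · exact integral_comp_eval (integrable_bilin_self (hX j) B).1
  · exact fun i _ hij => hzero i j hij
  · simp

end Bilinear

/-! ### One round of the server: averaging the clients. -/

section Server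

variable {N : ℕ} {Z : Type*} [MeasurableSpace Z] {E : Type*} [NormedAddCommGroup E]
  [InnerProductSpace ℝ E]

lemma average_const (hN : 0 < N) (a : ℝ) : (N : ℝ)⁻¹ * ∑ _c : Fin N, a = a := by
  have : (N : ℝ) ≠ 0 := by positivity
  simp [this]

lemma average_smul_const (hN : 0 < N) (v : E) : (N : ℝ)⁻¹ • ∑ _c : Fin N, v = v := by
  have : (N : ℝ) ≠ 0 := by positivity
  rw [Finset.sum_const, Finset.card_univ, Fintype.card_fin, ← Nat.cast_smul_eq_nsmul ℝ, smul_smul,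
    inv_mul_cancel₀ this, one_smul]

lemma norm_average_le {v : Fin N → E} {a : Fin N → ℝ} (h : ∀ c, ‖v c‖ ≤ a c) :
    ‖(N : ℝ)⁻¹ • ∑ c, v c‖ ≤ (N : ℝ)⁻¹ * ∑ c, a c := by
  rw [norm_smul, Real.norm_of_nonneg (by positivity)]
  gcongr
  exact norm_sum_le_of_le _ fun c _ => h c

lemma average_pow_le (hN : 0 < N) {a : Fin N → ℝ} (ha : ∀ c, 0 ≤ a c) (q : ℕ) :
    ((N : ℝ)⁻¹ * ∑ c, a c) ^ (q + 1) ≤ (N : ℝ)⁻¹ * ∑ c, a c ^ (q + 1) := by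
  have h1 := pow_sum_le_card_mul_sum_pow (s := Finset.univ) (f := a) (fun i _ => ha i) q
  rw [Finset.card_univ, Fintype.card_fin] at h1
  have hN' : (0 : ℝ) < N := by positivity
  rw [mul_pow]
  calc ((N : ℝ)⁻¹) ^ (q + 1) * (∑ c, a c) ^ (q + 1)
      ≤ ((N : ℝ)⁻¹) ^ (q + 1) * ((N : ℝ) ^ q * ∑ c, a c ^ (q + 1)) := by gcongr
    _ = ((N : ℝ)⁻¹ * N) ^ q * ((N : ℝ)⁻¹ * ∑ c, a c ^ (q + 1)) := by ring
    _ = _ := by rw [inv_mul_cancel₀ hN'.ne', one_pow, one_mul]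

/-- One round: the average of the last local iterates of the clients. -/
noncomputable def serverStep (g : Fin N → Z → E → E) (γ : ℝ) (H : ℕ) (θ : E)
    (z : Fin N → Fin H → Z) : E :=
  (N : ℝ)⁻¹ • ∑ c, sgdIter (g c) γ θ H (z c)

/-- The average over the clients of `gradNormSum`. -/
noncomputable def serverNormSum (g : Fin N → Z → E → E) (γ : ℝ) (θ : E) (H : ℕ)
    (z : Fin N → Fin H → Z) : ℝ :=
  (N : ℝ)⁻¹ * ∑ c, gradNormSum (g c) γ θ H (z c)

/-- The average over the clients of `gradSum`. -/
noncomputable def serverSum (g : Fin N → Z → E → E) (γ : ℝ) (θ : E) (H : ℕ)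
    (z : Fin N → Fin H → Z) : E :=
  (N : ℝ)⁻¹ • ∑ c, gradSum (g c) γ θ H (z c)

variable [MeasurableSpace E] {ξ : Fin N → Measure Z} {g : Fin N → Z → E → E}
  {G : Fin N → E → E} {μ L γ : ℝ}

section Pointwise

variable (hN : 0 < N) (o : ∀ c, Oracle (ξ c) (g c) (G c) μ L) (hL : 0 < L) (hγ : 0 < γ)
  (hγL : γ * L ≤ 1 / 2) (θ ϑ : E) (H : ℕ) (z : Fin N → Fin H → Z)
include hN o hL hγ hγL

lemma norm_serverStep_sub_serverStep_le :
    ‖serverStep g γ H θ z - serverStep g γ H ϑ z‖ ≤ ‖θ - ϑ‖ := by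
  rw [serverStep, serverStep, ← smul_sub, ← Finset.sum_sub_distrib]
  refine (norm_average_le fun c => (o c).norm_sgdIter_sub_sgdIter_le hL hγ hγL θ ϑ H (z c)).trans_eq ?_
  exact average_const hN _

lemma norm_serverStep_sub_le :
    ‖serverStep g γ H θ z - ϑ‖ ≤ ‖θ - ϑ‖ + serverNormSum g γ ϑ H z := by
  have h1 : serverStep g γ H θ z - ϑ = (N : ℝ)⁻¹ • ∑ c, (sgdIter (g c) γ θ H (z c) - ϑ) := by
    rw [Finset.sum_sub_distrib, smul_sub, average_smul_const hN, serverStep]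
  rw [h1]
  refine (norm_average_le fun c => (o c).norm_sgdIter_sub_le hL hγ hγL θ ϑ H (z c)).trans_eq ?_
  rw [Finset.sum_add_distrib, mul_add, average_const hN, serverNormSum]

lemma norm_serverStep_sub_sub_le :
    ‖serverStep g γ H θ z - serverStep g γ H ϑ z - (θ - ϑ)‖ ≤ γ * H * L * ‖θ - ϑ‖ := by
  have h1 : serverStep g γ H θ z - serverStep g γ H ϑ z - (θ - ϑ) = (N : ℝ)⁻¹ • ∑ c,
      (sgdIter (g c) γ θ H (z c) - sgdIter (g c) γ ϑ H (z c) - (θ - ϑ)) := by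
    rw [Finset.sum_sub_distrib, Finset.sum_sub_distrib, smul_sub, smul_sub, average_smul_const hN,
      serverStep, serverStep]
  rw [h1]
  refine (norm_average_le fun c => (o c).norm_sgdIter_sub_sub_le hL hγ hγL θ ϑ H (z c)).trans_eq ?_
  exact average_const hN _

lemma norm_serverStep_sub_add_le :
    ‖serverStep g γ H θ z - θ + serverSum g γ ϑ H z‖ ≤
      γ * H * L * (‖θ - ϑ‖ + serverNormSum g γ ϑ H z) := by
  have h1 : serverStep g γ H θ z - θ + serverSum g γ ϑ H z = (N : ℝ)⁻¹ • ∑ c,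
      (sgdIter (g c) γ θ H (z c) - θ + gradSum (g c) γ ϑ H (z c)) := by
    rw [Finset.sum_add_distrib, Finset.sum_sub_distrib, smul_add, smul_sub, average_smul_const hN,
      serverStep, serverSum]
  rw [h1]
  refine (norm_average_le fun c =>
    (o c).norm_sgdIter_sub_add_gradSum_le hL hγ hγL θ ϑ H (z c)).trans_eq ?_
  rw [← Finset.mul_sum, Finset.sum_add_distrib, serverNormSum, mul_left_comm, mul_add,
    average_const hN]

end Pointwise

lemma serverNormSum_nonneg (g : Fin N → Z → E → E) (hγ : 0 ≤ γ) (θ : E) (H : ℕ)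
    (z : Fin N → Fin H → Z) : 0 ≤ serverNormSum g γ θ H z :=
  mul_nonneg (by positivity) (Finset.sum_nonneg fun c _ => gradNormSum_nonneg (g c) hγ θ H (z c))

variable [hξ : ∀ c, IsProbabilityMeasure (ξ c)]

instance isProbabilityMeasure_sampleLaw (H : ℕ) : IsProbabilityMeasure (sampleLaw ξ H) := by
  unfold sampleLaw; infer_instance

lemma measurePreserving_eval_sampleLaw (ξ : Fin N → Measure Z)
    [∀ c, IsProbabilityMeasure (ξ c)] (H : ℕ) (c : Fin N) :
    MeasurePreserving (fun z : Fin N → Fin H → Z => z c) (sampleLaw ξ H)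
      (Measure.pi fun _ => ξ c) :=
  measurePreserving_eval (fun c => Measure.pi fun _ : Fin H => ξ c) c

lemma integral_eval_sampleLaw {F : Type*} [NormedAddCommGroup F] [NormedSpace ℝ F] {H : ℕ}
    {c : Fin N} {f : (Fin H → Z) → F} (hf : AEStronglyMeasurable f (Measure.pi fun _ => ξ c)) :
    ∫ z, f (z c) ∂(sampleLaw ξ H) = ∫ z, f z ∂(Measure.pi fun _ => ξ c) :=
  integral_comp_eval hf

lemma integral_average_sampleLaw {H : ℕ} {f : Fin N → (Fin H → Z) → ℝ}
    (hf : ∀ c, Integrable (f c) (Measure.pi fun _ => ξ c)) :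
    Integrable (fun z => (N : ℝ)⁻¹ * ∑ c, f c (z c)) (sampleLaw ξ H) ∧
    ∫ z, (N : ℝ)⁻¹ * ∑ c, f c (z c) ∂(sampleLaw ξ H) =
      (N : ℝ)⁻¹ * ∑ c, ∫ z, f c z ∂(Measure.pi fun _ => ξ c) := by
  have h1 : ∀ c, Integrable (fun z : Fin N → Fin H → Z => f c (z c)) (sampleLaw ξ H) := fun c =>
    (measurePreserving_eval_sampleLaw ξ H c).integrable_comp_of_integrable (hf c)
  refine ⟨(integrable_finsetSum _ fun c _ => h1 c).const_mul _, ?_⟩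
  rw [integral_const_mul, integral_finsetSum _ fun c _ => h1 c]
  simp_rw [fun c => integral_eval_sampleLaw (hf c).1]

variable [BorelSpace E] [SecondCountableTopology E] [CompleteSpace E]

lemma measurable_serverStep (o : ∀ c, Oracle (ξ c) (g c) (G c) μ L) (γ : ℝ) (H : ℕ) :
    Measurable (Function.uncurry (serverStep g γ H)) := by
  refine Measurable.const_smul (Finset.measurable_sum _ fun c _ => ?_) _
  exact ((o c).measurable_sgdIter γ H).comp
    (measurable_fst.prodMk ((measurable_pi_apply c).comp measurable_snd))

lemma memLp_serverNormSum (o : ∀ c, Oracle (ξ c) (g c) (G c) μ L) (γ : ℝ) (θ : E) (H : ℕ) :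
    MemLp (serverNormSum g γ θ H) 4 (sampleLaw ξ H) :=
  (memLp_finsetSum Finset.univ fun c _ => ((o c).memLp_gradNormSum γ θ H).comp_measurePreserving
    (measurePreserving_eval_sampleLaw ξ H c)).const_mul _

lemma memLp_serverSum (o : ∀ c, Oracle (ξ c) (g c) (G c) μ L) (γ : ℝ) (θ : E) (H : ℕ) :
    MemLp (serverSum g γ θ H) 4 (sampleLaw ξ H) :=
  (memLp_finsetSum Finset.univ fun c _ => ((o c).memLp_gradSum γ θ H).comp_measurePreserving
    (measurePreserving_eval_sampleLaw ξ H c)).const_smul _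

lemma integral_serverNormSum_pow_le (hN : 0 < N) (o : ∀ c, Oracle (ξ c) (g c) (G c) μ L)
    (hγ : 0 ≤ γ) {θ : E} {M : ℝ} (hM : ∀ c, ∀ q < 4, ∫ z, ‖g c z θ‖ ^ (q + 1) ∂(ξ c) ≤ M)
    (H : ℕ) {q : ℕ} (hq : q < 4) :
    ∫ z, serverNormSum g γ θ H z ^ (q + 1) ∂(sampleLaw ξ H) ≤ M * (γ * H) ^ (q + 1) := by
  obtain ⟨h1, h2⟩ := integral_average_sampleLaw (ξ := ξ) (H := H)
    (f := fun c z => gradNormSum (g c) γ θ H z ^ (q + 1))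
    fun c => (o c).integrable_gradNormSum_pow hγ θ H hq
  refine (integral_mono_of_nonneg (ae_of_all _ fun z =>
    pow_nonneg (serverNormSum_nonneg g hγ θ H z) _) h1 (ae_of_all _ fun z =>
    average_pow_le hN (fun c => gradNormSum_nonneg (g c) hγ θ H (z c)) q)).trans ?_
  rw [h2]
  refine le_trans ?_ (average_const hN (M * (γ * H) ^ (q + 1))).le
  gcongr with c
  exact (o c).integral_gradNormSum_pow_le_of_le hγ (hM c) le_rfl hq

/-- Jensen over the clients transfers the contraction of each client to the average; independence
between clients plays no role here. -/
lemma integral_norm_serverStep_sub_pow_le (hN : 0 < N) (o : ∀ c, Oracle (ξ c) (g c) (G c) μ L)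
    (hL : 0 < L) (hγ : 0 < γ) (hγL : γ * L ≤ 1 / 2) (hμ : γ * μ ≤ 1) (θ ϑ : E) (H m : ℕ) :
    ∫ z, ‖serverStep g γ H θ z - serverStep g γ H ϑ z‖ ^ (2 * (m + 1)) ∂(sampleLaw ξ H) ≤
      (1 - γ * μ) ^ H * ‖θ - ϑ‖ ^ (2 * (m + 1)) := by
  obtain ⟨h1, h2⟩ := integral_average_sampleLaw (ξ := ξ) (H := H)
    (f := fun c z => ‖sgdIter (g c) γ θ H z - sgdIter (g c) γ ϑ H z‖ ^ (2 * (m + 1)))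
    fun c => (o c).integrable_norm_sgdIter_sub_pow hL hγ hγL θ ϑ H _
  refine (integral_mono_of_nonneg (ae_of_all _ fun z => by positivity) h1
    (ae_of_all _ fun z => ?_)).trans ?_
  · simp only
    rw [serverStep, serverStep, ← smul_sub, ← Finset.sum_sub_distrib]
    refine (pow_le_pow_left₀ (norm_nonneg _) (norm_average_le fun c => le_rfl) _).trans ?_
    exact average_pow_le hN (fun c => norm_nonneg _) (2 * m + 1)
  · rw [h2]
    refine le_trans ?_ (average_const hN ((1 - γ * μ) ^ H * ‖θ - ϑ‖ ^ (2 * (m + 1)))).le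
    gcongr with c
    exact (o c).integral_norm_sgdIter_sub_pow_le hL hγ hγL hμ θ ϑ H m

lemma integral_serverStep (o : ∀ c, Oracle (ξ c) (g c) (G c) μ L)
    (hL : 0 < L) (hγ : 0 < γ) (hγL : γ * L ≤ 1 / 2) (θ : E) (H : ℕ) :
    ∫ z, serverStep g γ H θ z ∂(sampleLaw ξ H) =
      (N : ℝ)⁻¹ • ∑ c, ∫ z, sgdIter (g c) γ θ H z ∂(Measure.pi fun _ => ξ c) := by
  have h1 : ∀ c, Integrable (fun z : Fin N → Fin H → Z => sgdIter (g c) γ θ H (z c))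
      (sampleLaw ξ H) := fun c =>
    (measurePreserving_eval_sampleLaw ξ H c).integrable_comp_of_integrable
      ((o c).integrable_sgdIter hL hγ hγL θ H)
  simp only [serverStep]
  rw [integral_smul, integral_finsetSum _ fun c _ => h1 c]
  simp_rw [fun c => integral_eval_sampleLaw ((o c).integrable_sgdIter hL hγ hγL θ H).1]

/-- The constant terms `G c θs` cancel in the average by `hzero`. Their products `S c (G c θs)` need
not cancel, and they are all that is left of heterogeneity at this order. -/
lemma norm_integral_serverStep_sub_expansion_le (hN : 0 < N)
    (o : ∀ c, Oracle (ξ c) (g c) (G c) μ L)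
    (hL : 0 < L) (hγ : 0 < γ) (hγL : γ * L ≤ 1 / 2) {θs : E} (hzero : ∑ c, G c θs = 0) {M : ℝ}
    (hM : ∀ c, ∀ q < 4, ∫ z, ‖g c z θs‖ ^ (q + 1) ∂(ξ c) ≤ M)
    {S : Fin N → E →L[ℝ] E} {T : Fin N → E →L[ℝ] E →L[ℝ] E} {R s t : ℝ} (hR : 0 ≤ R)
    (hs : ∀ c, ‖S c‖ ≤ s) (ht : ∀ c, ‖T c‖ ≤ t)
    (hT : ∀ c θ, ‖G c θ - (G c θs + S c (θ - θs) + (1 / 2 : ℝ) • T c (θ - θs) (θ - θs))‖ ≤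
      R * ‖θ - θs‖ ^ 3) {H : ℕ} (hη1 : γ * H ≤ 1) (θ : E) :
    ‖∫ z, serverStep g γ H θ z ∂(sampleLaw ξ H) - θ +
        (γ * H) • (((N : ℝ)⁻¹ • ∑ c, S c) (θ - θs) +
          (1 / 2 : ℝ) • ((N : ℝ)⁻¹ • ∑ c, T c) (θ - θs) (θ - θs)) -
        (γ * H) • ((γ * ((H : ℝ) - 1) / 2) • ((N : ℝ)⁻¹ • ∑ c, S c (G c θs)))‖ ≤
      (4 * R * (1 + M) + t * (1 + L) * (3 * M + 2) + s * L * (1 + M)) * ((γ * H) *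
        ((γ * H) ^ 2 + (γ * H) * ‖θ - θs‖ + (γ * H) * ‖θ - θs‖ ^ 2 + ‖θ - θs‖ ^ 3)) := by
  have hM0 : 0 ≤ M := (integral_nonneg fun z => by positivity).trans (hM ⟨0, hN⟩ 0 (by norm_num))
  have h1 : ∫ z, serverStep g γ H θ z ∂(sampleLaw ξ H) - θ +
        (γ * H) • (((N : ℝ)⁻¹ • ∑ c, S c) (θ - θs) +
          (1 / 2 : ℝ) • ((N : ℝ)⁻¹ • ∑ c, T c) (θ - θs) (θ - θs)) -
        (γ * H) • ((γ * ((H : ℝ) - 1) / 2) • ((N : ℝ)⁻¹ • ∑ c, S c (G c θs))) =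
      (N : ℝ)⁻¹ • ∑ c, (∫ z, sgdIter (g c) γ θ H z ∂(Measure.pi fun _ => ξ c) - θ +
        (γ * H) • (G c θs + S c (θ - θs) + (1 / 2 : ℝ) • T c (θ - θs) (θ - θs)) -
        (γ * H * (γ * ((H : ℝ) - 1) / 2)) • S c (G c θs)) := by
    rw [Finset.sum_sub_distrib, Finset.sum_add_distrib, Finset.sum_sub_distrib, ← Finset.smul_sum,
      ← Finset.smul_sum, Finset.sum_add_distrib, Finset.sum_add_distrib, hzero, zero_add,
      ← Finset.smul_sum, integral_serverStep o hL hγ hγL]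
    simp only [smul_apply, sum_apply, smul_add, smul_sub, average_smul_const hN]
    simp only [smul_smul]
    simp only [mul_comm, mul_left_comm]
  rw [h1]
  refine (norm_average_le fun c => ((o c).norm_integral_sgdIter_sub_expansion_le hL hγ hγL (hM c) hR
    (hT c) hη1 θ).trans (?_ : _ ≤ (4 * R * (1 + M) + t * (1 + L) * (3 * M + 2) + s * L * (1 + M)) *
      ((γ * H) * ((γ * H) ^ 2 + (γ * H) * ‖θ - θs‖ + (γ * H) * ‖θ - θs‖ ^ 2 +
        ‖θ - θs‖ ^ 3)))).trans_eq (average_const hN _)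
  rw [mul_left_comm]
  have := hs c
  have := ht c
  gcongr

/-- Quadratic functionals of the averaged gradient noise of one round. -/
lemma integral_bilin_serverSum {F : Type*} [NormedAddCommGroup F] [NormedSpace ℝ F]
    [CompleteSpace F] (o : ∀ c, Oracle (ξ c) (g c) (G c) μ L) {θs : E}
    (hzero : ∑ c, G c θs = 0) (γ : ℝ) (H : ℕ) (B : E →L[ℝ] E →L[ℝ] F) :
    ∫ z, B (serverSum g γ θs H z) (serverSum g γ θs H z) ∂(sampleLaw ξ H) =
      (γ * (γ * H) * ((N : ℝ)⁻¹ * (N : ℝ)⁻¹)) •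
        ∑ c, ∫ z, B (g c z θs - G c θs) (g c z θs - G c θs) ∂(ξ c) := by
  let ε : Fin N → Z → E := fun c z => g c z θs - G c θs
  have hε : ∀ c, MemLp (ε c) 2 (ξ c) := fun c =>
    (((o c).memLp θs).mono_exponent (by norm_num)).sub (memLp_const _)
  have hε0 : ∀ c, ∫ z, ε c z ∂(ξ c) = 0 := fun c => by
    simp only [ε]
    rw [integral_sub ((o c).integrable_sample θs) (integrable_const _), (o c).mean]
    simp
  let X : Fin N → (Fin H → Z) → E := fun c z => ∑ h, ε c (z h)
  have hXe : ∀ c (h : Fin H), MemLp (fun z : Fin H → Z => ε c (z h)) 2 (Measure.pi fun _ => ξ c) :=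
    fun c h => (hε c).comp_measurePreserving (measurePreserving_eval (fun _ : Fin H => ξ c) h)
  have hX : ∀ c, MemLp (X c) 2 (Measure.pi fun _ => ξ c) := fun c =>
    memLp_finsetSum Finset.univ fun h _ => hXe c h
  have hX0 : ∀ c, ∫ z, X c z ∂(Measure.pi fun _ => ξ c) = 0 := by
    intro c
    simp only [X]
    rw [integral_finsetSum _ fun h _ => (hXe c h).integrable (by norm_num)]
    refine Finset.sum_eq_zero fun h _ => ?_
    exact (integral_comp_eval (hε c).1).trans (hε0 c)
  -- The client means add up to zero, so centring each client separately leaves the total unchanged.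
  have hV : ∀ z, serverSum g γ θs H z = ((N : ℝ)⁻¹ * γ) • ∑ c, X c (z c) := by
    intro z
    simp only [serverSum, gradSum, X, ε, Finset.sum_sub_distrib, Finset.sum_const, ← Finset.smul_sum,
      hzero, smul_zero, sub_zero, mul_smul]
  have hB : ∀ z, B (serverSum g γ θs H z) (serverSum g γ θs H z) =
      ((N : ℝ)⁻¹ * γ) • ((N : ℝ)⁻¹ * γ) • B (∑ c, X c (z c)) (∑ c, X c (z c)) := fun z => by
    rw [hV, map_smul, map_smul, smul_apply]
  simp_rw [hB]
  rw [integral_smul, integral_smul]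
  have h1 := integral_bilin_sum_pi hX hX0 B
  have h2 : ∀ c, ∫ z, B (X c z) (X c z) ∂(Measure.pi fun _ => ξ c) =
      (H : ℝ) • ∫ z, B (ε c z) (ε c z) ∂(ξ c) := by
    intro c
    have := integral_bilin_sum_pi (ι := Fin H) (fun _ => hε c) (fun _ => hε0 c) B
    rw [this, Finset.sum_const, Finset.card_univ, Fintype.card_fin, Nat.cast_smul_eq_nsmul]
  rw [sampleLaw, h1]
  simp_rw [h2]
  rw [← Finset.smul_sum, smul_smul, smul_smul]
  congr 1
  ring

end Server

/-! ### Elementary inequalities behind the drift estimates. -/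

section Elementary

/-- The weight `c / 8` lets up to four cross terms be absorbed while half of the drift `cη`
survives. -/
lemma mul_le_young (a b : ℝ) {c : ℝ} (hc : 0 < c) : a * b ≤ c / 8 * a ^ 2 + 2 / c * b ^ 2 := by
  have h : c / 8 * a ^ 2 + 2 / c * b ^ 2 - a * b = (c * a - 4 * b) ^ 2 / (8 * c) := by
    field_simp; ring
  have : 0 ≤ (c * a - 4 * b) ^ 2 / (8 * c) := by positivity
  linarith

variable {E : Type*} [NormedAddCommGroup E] [InnerProductSpace ℝ E]

/-- Meant for `a = Φ θ s - Φ θs s`, `b = Φ θs s - θs`, `x = θ - θs`. Trading the random `a` for the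
deterministic `x` in the cross term means that, after integration, only the mean of `b` is seen,
which is much smaller than `b` itself. -/
lemma norm_add_sq_le_of_near {a b x : E} {κ : ℝ} (h : ‖a - x‖ ≤ κ * ‖x‖) :
    ‖a + b‖ ^ 2 ≤ ‖a‖ ^ 2 + 2 * inner ℝ x b + 2 * κ * ‖x‖ * ‖b‖ + ‖b‖ ^ 2 := by
  rw [norm_add_sq_real]
  have h1 : inner ℝ a b = inner ℝ x b + inner ℝ (a - x) b := by rw [inner_sub_left]; ring
  have h2 : inner ℝ (a - x) b ≤ κ * ‖x‖ * ‖b‖ :=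
    (real_inner_le_norm _ _).trans (by gcongr)
  linarith

lemma norm_add_pow_four_le_of_near {a b x : E} {κ : ℝ} (ha : ‖a‖ ≤ ‖x‖) (h : ‖a - x‖ ≤ κ * ‖x‖) :
    ‖a + b‖ ^ 4 ≤ ‖a‖ ^ 4 + 4 * ‖x‖ ^ 2 * inner ℝ x b + 12 * κ * ‖x‖ ^ 3 * ‖b‖ +
      8 * ‖x‖ ^ 2 * ‖b‖ ^ 2 + 3 * ‖b‖ ^ 4 := by
  have e0 : ‖a + b‖ ^ 4 = (‖a‖ ^ 2 + 2 * inner ℝ a b + ‖b‖ ^ 2) ^ 2 := by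
    rw [← norm_add_sq_real]; ring
  rw [e0]
  set p := inner ℝ a b
  set q := inner ℝ x b
  set α := ‖a‖
  set β := ‖b‖
  set r := ‖x‖
  have hα : 0 ≤ α := norm_nonneg _
  have hβ : 0 ≤ β := norm_nonneg _
  have hr : 0 ≤ r := norm_nonneg _
  have hp : |p| ≤ α * β := abs_real_inner_le_norm _ _
  have hq : |q| ≤ r * β := abs_real_inner_le_norm _ _
  have hpq : |p - q| ≤ κ * r * β := by
    have : p - q = inner ℝ (a - x) b := by simp only [p, q, inner_sub_left]
    rw [this]
    exact (abs_real_inner_le_norm _ _).trans (by gcongr)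
  have hαr : r - α ≤ κ * r := by
    have := norm_sub_norm_le x a
    rw [norm_sub_rev] at this
    linarith
  have hα2 : α ^ 2 ≤ r ^ 2 := by gcongr
  -- Split `α² p - r² q = α² (p - q) + (r² - α²)(-q)`; both differences carry a factor `κ`.
  have s1 : α ^ 2 * p ≤ r ^ 2 * q + 3 * κ * r ^ 3 * β := by
    have t1 : α ^ 2 * (p - q) ≤ r ^ 2 * (κ * r * β) :=
      (mul_le_mul_of_nonneg_left (le_abs_self _) (by positivity)).trans (by gcongr)
    have t2 : (r ^ 2 - α ^ 2) * (-q) ≤ (κ * r * (2 * r)) * (r * β) := by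
      have u1 : (r ^ 2 - α ^ 2) * (-q) ≤ (r ^ 2 - α ^ 2) * (r * β) :=
        mul_le_mul_of_nonneg_left ((neg_le_abs q).trans hq) (by linarith)
      have u2 : r ^ 2 - α ^ 2 ≤ κ * r * (2 * r) := by
        have : (r - α) * (r + α) ≤ κ * r * (2 * r) :=
          mul_le_mul hαr (by linarith) (by positivity) (by linarith)
        linarith [this]
      exact u1.trans (by gcongr)
    linarith
  have s2 : p ^ 2 ≤ r ^ 2 * β ^ 2 := by
    rw [← mul_pow, ← sq_abs p]
    have : |p| ≤ r * β := hp.trans (by gcongr)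
    gcongr
  have s3 : p * β ^ 2 ≤ (r ^ 2 * β ^ 2 + β ^ 4) / 2 := by
    have : p * β ^ 2 ≤ (r * β) * β ^ 2 := by
      gcongr; exact (le_abs_self _).trans (hp.trans (by gcongr))
    nlinarith [sq_nonneg (r * β - β ^ 2)]
  have s4 : α ^ 2 * β ^ 2 ≤ r ^ 2 * β ^ 2 := by gcongr
  linarith

end Elementary

/-! ### The abstract round: drift inequalities and one-round expansions. -/

section Stationary

variable {E : Type*} [NormedAddCommGroup E] [InnerProductSpace ℝ E] [MeasurableSpace E]
  {S : Type*} [MeasurableSpace S]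

/-- Quantitative description of one round `Φ` of a stochastic algorithm around a reference point
`θs`: the round is a contraction in mean, the displacement is `-V` up to a small error, its mean
has a second-order expansion, and the moments of the noise are controlled. Here `γ` is the size of
a single step and `η` the size of the round. -/
structure RoundModel (ν : Measure S) (Φ : E → S → E) (W : S → ℝ) (V : S → E) (θs : E)
    (A : E →L[ℝ] E) (T : E →L[ℝ] E →L[ℝ] E) (b : E) (Q : E →L[ℝ] E) (C c γ η : ℝ) : Prop where
  one_le : 1 ≤ C
  c_pos : 0 < c
  γ_pos : 0 < γ
  γ_le : γ ≤ η
  η_le : η ≤ 1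
  norm_T_le : ‖T‖ ≤ C
  norm_b_le : ‖b‖ ≤ C * η
  meas : Measurable (Function.uncurry Φ)
  W_nonneg : ∀ s, 0 ≤ W s
  memLp_W : MemLp W 4 ν
  memLp_V : MemLp V 4 ν
  moment_W : ∀ q < 4, ∫ s, W s ^ (q + 1) ∂ν ≤ C * η ^ (q + 1)
  norm_sub_ref_le : ∀ θ s, ‖Φ θ s - θs‖ ≤ ‖θ - θs‖ + W s
  norm_sub_le : ∀ θ ϑ s, ‖Φ θ s - Φ ϑ s‖ ≤ ‖θ - ϑ‖
  norm_sub_sub_le : ∀ θ ϑ s, ‖Φ θ s - Φ ϑ s - (θ - ϑ)‖ ≤ C * η * ‖θ - ϑ‖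
  norm_add_le : ∀ θ s, ‖Φ θ s - θ + V s‖ ≤ C * η * (‖θ - θs‖ + W s)
  contraction : ∀ θ ϑ, ∀ m < 2, ∫ s, ‖Φ θ s - Φ ϑ s‖ ^ (2 * (m + 1)) ∂ν ≤
    (1 - c * η) * ‖θ - ϑ‖ ^ (2 * (m + 1))
  covariance : ∫ s, tensor E (V s) (V s) ∂ν = (γ * η) • Q
  variance : ∫ s, ‖V s‖ ^ 2 ∂ν ≤ C * (γ * η)
  mean : ∀ θ, ‖∫ s, Φ θ s ∂ν - θ + η • (A (θ - θs) + (1 / 2 : ℝ) • T (θ - θs) (θ - θs)) - η • b‖ ≤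
    C * (η * (η ^ 2 + η * ‖θ - θs‖ + η * ‖θ - θs‖ ^ 2 + ‖θ - θs‖ ^ 3))

variable [BorelSpace E] [SecondCountableTopology E] [CompleteSpace E]
  {ν : Measure S} [IsProbabilityMeasure ν] {Φ : E → S → E} {W : S → ℝ} {V : S → E} {θs : E}
  {A : E →L[ℝ] E} {T : E →L[ℝ] E →L[ℝ] E} {b : E} {Q : E →L[ℝ] E} {C c γ η : ℝ}

namespace RoundModel

variable (m : RoundModel ν Φ W V θs A T b Q C c γ η)
include m

lemma η_pos : 0 < η := m.γ_pos.trans_le m.γ_le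

lemma C_pos : 0 < C := one_pos.trans_le m.one_le

lemma measurable_right (θ : E) : Measurable (Φ θ) := m.meas.comp measurable_prodMk_left

lemma memLp_sub_ref (θ : E) : MemLp (fun s => Φ θ s - θs) 4 ν :=
  ((memLp_const ‖θ - θs‖).add m.memLp_W).mono'
    ((m.measurable_right θ).sub_const θs).aestronglyMeasurable
    (ae_of_all _ fun s => m.norm_sub_ref_le θ s)

lemma integrable_sub_ref (θ : E) : Integrable (fun s => Φ θ s - θs) ν :=
  (m.memLp_sub_ref θ).integrable (by norm_num)

lemma integrable_round (θ : E) : Integrable (Φ θ) ν :=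
  ((m.integrable_sub_ref θ).add (integrable_const θs)).congr (ae_of_all _ fun s => by simp)

lemma integrable_norm_sub_ref_pow (θ : E) {p : ℕ} (hp : p ≤ 4) :
    Integrable (fun s => ‖Φ θ s - θs‖ ^ p) ν :=
  MemLp.integrable_norm_pow' ((m.memLp_sub_ref θ).mono_exponent (by exact_mod_cast hp))

lemma integrable_W_pow {p : ℕ} (hp : p ≤ 4) : Integrable (fun s => W s ^ p) ν := by
  refine (MemLp.integrable_norm_pow' (m.memLp_W.mono_exponent
    (by exact_mod_cast hp : (p : ℝ≥0∞) ≤ 4))).congr (ae_of_all _ fun s => ?_)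
  simp only [Real.norm_of_nonneg (m.W_nonneg s)]

lemma integrable_norm_V_sq : Integrable (fun s => ‖V s‖ ^ 2) ν :=
  MemLp.integrable_norm_pow' (m.memLp_V.mono_exponent (by norm_num))

lemma integrable_norm_sub_pow (θ ϑ : E) (p : ℕ) :
    Integrable (fun s => ‖Φ θ s - Φ ϑ s‖ ^ p) ν := by
  refine Integrable.of_bound (((m.measurable_right θ).sub
    (m.measurable_right ϑ)).norm.pow_const p).aestronglyMeasurable (‖θ - ϑ‖ ^ p)
    (ae_of_all _ fun s => ?_)
  rw [norm_pow, norm_norm]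
  exact pow_le_pow_left₀ (norm_nonneg _) (m.norm_sub_le θ ϑ s) p

lemma norm_ref_le (s : S) : ‖Φ θs s - θs‖ ≤ W s := by
  simpa using m.norm_sub_ref_le θs s

/-- The displacement from `θs` is `-V` up to `C η W`. The variance of `V` is `O(γη)` and the error
contributes `O(η⁴)`; bounding by `W` alone would give `η²` and lose the gain from averaging
independent noise. -/
lemma integral_norm_ref_sq_le : ∫ s, ‖Φ θs s - θs‖ ^ 2 ∂ν ≤ 4 * C ^ 3 * (η * (γ + η ^ 2)) := by
  have hC := m.one_le
  have hC0 := m.C_pos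
  have hη := m.η_pos
  have hη1 := m.η_le
  have hγ := m.γ_pos
  calc ∫ s, ‖Φ θs s - θs‖ ^ 2 ∂ν ≤ ∫ s, (2 * ‖V s‖ ^ 2 + 2 * (C * η) ^ 2 * W s ^ 2) ∂ν := by
        refine integral_mono (m.integrable_norm_sub_ref_pow θs (by norm_num))
          ((m.integrable_norm_V_sq.const_mul _).add
            ((m.integrable_W_pow (p := 2) (by norm_num)).const_mul _)) fun s => ?_
        have h1 := m.norm_add_le θs s
        rw [sub_self, norm_zero, zero_add] at h1
        have h2 : ‖Φ θs s - θs‖ ≤ ‖Φ θs s - θs + V s‖ + ‖V s‖ := by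
          simpa using _root_.norm_sub_le (Φ θs s - θs + V s) (V s)
        have h3 : ‖Φ θs s - θs‖ ^ 2 ≤ (C * η * W s + ‖V s‖) ^ 2 := by gcongr; linarith
        have h4 := sq_nonneg (C * η * W s - ‖V s‖)
        simp only
        linarith
    _ ≤ 2 * (C * (γ * η)) + 2 * (C * η) ^ 2 * (C * η ^ 2) := by
        rw [integral_add (m.integrable_norm_V_sq.const_mul _)
            ((m.integrable_W_pow (p := 2) (by norm_num)).const_mul _), integral_const_mul,
          integral_const_mul]
        have h1 := m.variance
        have h2 := m.moment_W 1 (by norm_num)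
        gcongr
    _ ≤ _ := by
        have e1 : C ≤ C ^ 3 := le_self_pow₀ hC (by norm_num)
        have e2 : η ^ 4 ≤ η ^ 3 := pow_le_pow_of_le_one hη.le hη1 (by norm_num)
        have e3 : C * (γ * η) ≤ C ^ 3 * (γ * η) := by gcongr
        have e4 : C ^ 3 * η ^ 4 ≤ C ^ 3 * η ^ 3 := by gcongr
        have e5 : 0 ≤ C ^ 3 * (γ * η) := by positivity
        have e6 : 0 ≤ C ^ 3 * η ^ 3 := by positivity
        linarith

/-- At `θ = θs` the linear and quadratic terms of the mean expansion vanish, leaving `η • b = O(η²)`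
and an error `O(η³)`. -/
lemma norm_integral_ref_le : ‖∫ s, (Φ θs s - θs) ∂ν‖ ≤ 2 * C * η ^ 2 := by
  have h1 := m.mean θs
  rw [sub_self, map_zero, map_zero, smul_zero, add_zero, smul_zero, add_zero, norm_zero] at h1
  have h2 : ∫ s, (Φ θs s - θs) ∂ν = ∫ s, Φ θs s ∂ν - θs := by
    rw [integral_sub (m.integrable_round θs) (integrable_const _)]; simp
  rw [h2]
  have h3 : ‖∫ s, Φ θs s ∂ν - θs‖ ≤ ‖∫ s, Φ θs s ∂ν - θs - η • b‖ + ‖η • b‖ := by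
    simpa using _root_.norm_add_le (∫ s, Φ θs s ∂ν - θs - η • b) (η • b)
  have hη := m.η_pos
  have hη1 := m.η_le
  have hC0 := m.C_pos
  rw [norm_smul, Real.norm_of_nonneg hη.le] at h3
  have h4 : η * ‖b‖ ≤ η * (C * η) := by gcongr; exact m.norm_b_le
  have h5 : C * η ^ 3 ≤ C * η ^ 2 := by
    have : η ^ 3 ≤ η ^ 2 := pow_le_pow_of_le_one hη.le hη1 (by norm_num)
    gcongr
  have h6 : C * (η * (η ^ 2 + η * 0 + η * 0 ^ 2 + 0 ^ 3)) = C * η ^ 3 := by ring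
  linarith

/-- The crude comparison with `W` is enough, since the stationary fourth moment is needed only to
order `η²`. -/
lemma integral_norm_ref_pow_four_le : ∫ s, ‖Φ θs s - θs‖ ^ 4 ∂ν ≤ C * η ^ 4 := by
  refine (integral_mono (m.integrable_norm_sub_ref_pow θs le_rfl) (m.integrable_W_pow le_rfl)
    fun s => ?_).trans (m.moment_W 3 (by norm_num))
  exact pow_le_pow_left₀ (norm_nonneg _) (m.norm_ref_le s) 4

lemma integral_inner_ref_le (x : E) :
    ∫ s, inner ℝ x (Φ θs s - θs) ∂ν ≤ ‖x‖ * (2 * C * η ^ 2) := by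
  rw [integral_inner (m.integrable_sub_ref θs)]
  exact (real_inner_le_norm _ _).trans (by gcongr; exact m.norm_integral_ref_le)

/-- Drift inequality for the second moment. -/
lemma integral_norm_sub_ref_sq_le (θ : E) :
    ∫ s, ‖Φ θ s - θs‖ ^ 2 ∂ν ≤ (1 - c * η / 2) * ‖θ - θs‖ ^ 2 +
      (32 * C ^ 2 / c + 32 * C ^ 5 / c + 4 * C ^ 3) * (η * (γ + η ^ 2)) := by
  have hC := m.one_le
  have hC0 := m.C_pos
  have hη := m.η_pos
  have hη1 := m.η_le
  have hγ := m.γ_pos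
  have hc := m.c_pos
  set x := θ - θs with hx
  set r := ‖x‖ with hr
  have i1 : Integrable (fun s => ‖Φ θ s - Φ θs s‖ ^ 2) ν := m.integrable_norm_sub_pow θ θs 2
  have i2 : Integrable (fun s => 2 * inner ℝ x (Φ θs s - θs)) ν :=
    ((m.integrable_sub_ref θs).const_inner x).const_mul 2
  have i3 : Integrable (fun s => (8 * C ^ 2 / c * η + 1) * ‖Φ θs s - θs‖ ^ 2) ν :=
    (m.integrable_norm_sub_ref_pow θs (by norm_num)).const_mul _
  -- Decompose into the contracting part and the displacement of `θs`. The inner product is kept for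
  -- its small mean; the product of norms is absorbed by Young at the cost of a share `c / 8` of the
  -- drift.
  have hpt : ∀ s, ‖Φ θ s - θs‖ ^ 2 ≤ ‖Φ θ s - Φ θs s‖ ^ 2 + 2 * inner ℝ x (Φ θs s - θs) +
      (8 * C ^ 2 / c * η + 1) * ‖Φ θs s - θs‖ ^ 2 + c / 8 * η * r ^ 2 := by
    intro s
    have h1 : Φ θ s - θs = (Φ θ s - Φ θs s) + (Φ θs s - θs) := by abel
    have h2 := norm_add_sq_le_of_near (b := Φ θs s - θs) (m.norm_sub_sub_le θ θs s)
    rw [← h1, ← hx, ← hr] at h2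
    have h3 := mul_le_young r (2 * C * ‖Φ θs s - θs‖) hc
    have h4 := mul_le_mul_of_nonneg_left h3 hη.le
    have h5 : η * (c / 8 * r ^ 2 + 2 / c * (2 * C * ‖Φ θs s - θs‖) ^ 2) =
      c / 8 * η * r ^ 2 + 8 * C ^ 2 / c * η * ‖Φ θs s - θs‖ ^ 2 := by ring
    linarith
  calc ∫ s, ‖Φ θ s - θs‖ ^ 2 ∂ν
      ≤ ∫ s, (‖Φ θ s - Φ θs s‖ ^ 2 + 2 * inner ℝ x (Φ θs s - θs) +
        (8 * C ^ 2 / c * η + 1) * ‖Φ θs s - θs‖ ^ 2 + c / 8 * η * r ^ 2) ∂ν :=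
        integral_mono (m.integrable_norm_sub_ref_pow θ (by norm_num))
          (((i1.add i2).add i3).add (integrable_const _)) hpt
    _ = ∫ s, ‖Φ θ s - Φ θs s‖ ^ 2 ∂ν + 2 * ∫ s, inner ℝ x (Φ θs s - θs) ∂ν +
        (8 * C ^ 2 / c * η + 1) * ∫ s, ‖Φ θs s - θs‖ ^ 2 ∂ν + c / 8 * η * r ^ 2 := by
        rw [integral_add ((i1.fun_add i2).fun_add i3) (integrable_const _),
          integral_add (i1.fun_add i2) i3, integral_add i1 i2, integral_const_mul,
          integral_const_mul]
        simp
    _ ≤ (1 - c * η) * r ^ 2 + 2 * (r * (2 * C * η ^ 2)) +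
        (8 * C ^ 2 / c * η + 1) * (4 * C ^ 3 * (η * (γ + η ^ 2))) + c / 8 * η * r ^ 2 := by
        gcongr
        · simpa using m.contraction θ θs 0 (by norm_num)
        · exact m.integral_inner_ref_le x
        · exact m.integral_norm_ref_sq_le
    _ ≤ _ := by
        have h3 := mul_le_mul_of_nonneg_left (mul_le_young r (4 * C * η) hc) hη.le
        have h4 : η * (c / 8 * r ^ 2 + 2 / c * (4 * C * η) ^ 2) =
          c / 8 * η * r ^ 2 + 32 * C ^ 2 / c * (η * η ^ 2) := by ring
        have h5 : 32 * C ^ 2 / c * (η * η ^ 2) ≤ 32 * C ^ 2 / c * (η * (γ + η ^ 2)) := by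
          gcongr; linarith
        have h6 : 8 * C ^ 2 / c * η * (4 * C ^ 3 * (η * (γ + η ^ 2))) ≤
            8 * C ^ 2 / c * 1 * (4 * C ^ 3 * (η * (γ + η ^ 2))) := by gcongr
        have h7 : 8 * C ^ 2 / c * 1 * (4 * C ^ 3 * (η * (γ + η ^ 2))) =
          32 * C ^ 5 / c * (η * (γ + η ^ 2)) := by ring
        have h8 : 0 ≤ c * η * r ^ 2 := by positivity
        linarith

/-- Drift inequality for the fourth moment. -/
lemma integral_norm_sub_ref_pow_four_le (θ : E) :
    ∫ s, ‖Φ θ s - θs‖ ^ 4 ∂ν ≤ (1 - c * η / 2) * ‖θ - θs‖ ^ 4 +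
      (2 / c * (128 * C ^ 2 / c) ^ 2 + 2 / c * (8 * C ^ 3 * (288 * C ^ 2 / c + 8)) ^ 2 + 3 * C) *
        η ^ 3 := by
  have hC := m.one_le
  have hC0 := m.C_pos
  have hη := m.η_pos
  have hη1 := m.η_le
  have hγ := m.γ_pos
  have hγη := m.γ_le
  have hc := m.c_pos
  set x := θ - θs with hx
  set r := ‖x‖ with hr
  have hr0 : 0 ≤ r := norm_nonneg _
  set K := 288 * C ^ 2 / c + 8 with hK
  have hK0 : 0 ≤ K := by positivity
  have i1 : Integrable (fun s => ‖Φ θ s - Φ θs s‖ ^ 4) ν := m.integrable_norm_sub_pow θ θs 4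
  have i2 : Integrable (fun s => 4 * r ^ 2 * inner ℝ x (Φ θs s - θs)) ν :=
    ((m.integrable_sub_ref θs).const_inner x).const_mul _
  have i3 : Integrable (fun s => K * r ^ 2 * ‖Φ θs s - θs‖ ^ 2) ν :=
    (m.integrable_norm_sub_ref_pow θs (by norm_num)).const_mul _
  have i4 : Integrable (fun s => 3 * ‖Φ θs s - θs‖ ^ 4) ν :=
    (m.integrable_norm_sub_ref_pow θs (by norm_num)).const_mul _
  have hpt : ∀ s, ‖Φ θ s - θs‖ ^ 4 ≤ ‖Φ θ s - Φ θs s‖ ^ 4 + 4 * r ^ 2 * inner ℝ x (Φ θs s - θs) +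
      K * r ^ 2 * ‖Φ θs s - θs‖ ^ 2 + 3 * ‖Φ θs s - θs‖ ^ 4 + c / 8 * η * r ^ 4 := by
    intro s
    have h1 : Φ θ s - θs = (Φ θ s - Φ θs s) + (Φ θs s - θs) := by abel
    have h2 := norm_add_pow_four_le_of_near (b := Φ θs s - θs) (m.norm_sub_le θ θs s)
      (m.norm_sub_sub_le θ θs s)
    rw [← h1, ← hx, ← hr] at h2
    have h3 := mul_le_young r (12 * C * ‖Φ θs s - θs‖) hc
    have h4 := mul_le_mul_of_nonneg_left h3 (show 0 ≤ η * r ^ 2 by positivity)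
    have h5 : η * r ^ 2 * (c / 8 * r ^ 2 + 2 / c * (12 * C * ‖Φ θs s - θs‖) ^ 2) =
      c / 8 * η * r ^ 4 + η * (288 * C ^ 2 / c * r ^ 2 * ‖Φ θs s - θs‖ ^ 2) := by ring
    have h6 : η * (288 * C ^ 2 / c * r ^ 2 * ‖Φ θs s - θs‖ ^ 2) ≤
      288 * C ^ 2 / c * r ^ 2 * ‖Φ θs s - θs‖ ^ 2 := mul_le_of_le_one_left (by positivity) hη1
    simp only [hK]
    linarith
  calc ∫ s, ‖Φ θ s - θs‖ ^ 4 ∂ν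
      ≤ ∫ s, (‖Φ θ s - Φ θs s‖ ^ 4 + 4 * r ^ 2 * inner ℝ x (Φ θs s - θs) +
        K * r ^ 2 * ‖Φ θs s - θs‖ ^ 2 + 3 * ‖Φ θs s - θs‖ ^ 4 + c / 8 * η * r ^ 4) ∂ν :=
        integral_mono (m.integrable_norm_sub_ref_pow θ le_rfl)
          ((((i1.add i2).add i3).add i4).add (integrable_const _)) hpt
    _ = ∫ s, ‖Φ θ s - Φ θs s‖ ^ 4 ∂ν + 4 * r ^ 2 * ∫ s, inner ℝ x (Φ θs s - θs) ∂ν +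
        K * r ^ 2 * ∫ s, ‖Φ θs s - θs‖ ^ 2 ∂ν + 3 * ∫ s, ‖Φ θs s - θs‖ ^ 4 ∂ν +
        c / 8 * η * r ^ 4 := by
        rw [integral_add (((i1.fun_add i2).fun_add i3).fun_add i4) (integrable_const _),
          integral_add ((i1.fun_add i2).fun_add i3) i4,
          integral_add (i1.fun_add i2) i3, integral_add i1 i2, integral_const_mul,
          integral_const_mul, integral_const_mul]
        simp
    _ ≤ (1 - c * η) * r ^ 4 + 4 * r ^ 2 * (r * (2 * C * η ^ 2)) +
        K * r ^ 2 * (4 * C ^ 3 * (η * (2 * η))) + 3 * (C * η ^ 4) + c / 8 * η * r ^ 4 := by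
        gcongr
        · simpa using m.contraction θ θs 1 (by norm_num)
        · exact m.integral_inner_ref_le x
        · refine m.integral_norm_ref_sq_le.trans ?_
          have : η ^ 2 ≤ η := by nlinarith
          gcongr
          linarith
        · exact m.integral_norm_ref_pow_four_le
    -- Three further Young shares of `cη / 8`, with the one in `hpt`, use up exactly half of the
    -- drift `cη`. `a2` treats the leftover `r²` term that `a1` produces.
    _ ≤ _ := by
        have a1 := mul_le_mul_of_nonneg_left (mul_le_young r (8 * C * η) hc)
          (show 0 ≤ η * r ^ 2 by positivity)
        have a2 := mul_le_mul_of_nonneg_left (mul_le_young (r ^ 2) (128 * C ^ 2 / c * η ^ 2) hc) hη.le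
        have a3 := mul_le_mul_of_nonneg_left (mul_le_young (r ^ 2) (8 * C ^ 3 * K * η) hc) hη.le
        have a4 : 3 * (C * η ^ 4) ≤ 3 * (C * η ^ 3) := by
          have : η ^ 4 ≤ η ^ 3 := pow_le_pow_of_le_one hη.le hη1 (by norm_num)
          gcongr
        have a5 : 2 / c * (128 * C ^ 2 / c) ^ 2 * η ^ 5 ≤ 2 / c * (128 * C ^ 2 / c) ^ 2 * η ^ 3 := by
          have : η ^ 5 ≤ η ^ 3 := pow_le_pow_of_le_one hη.le hη1 (by norm_num)
          gcongr
        have b1 : η * r ^ 2 * (c / 8 * r ^ 2 + 2 / c * (8 * C * η) ^ 2) =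
          c / 8 * η * r ^ 4 + η * (r ^ 2 * (128 * C ^ 2 / c * η ^ 2)) := by ring
        have b2 : η * (c / 8 * (r ^ 2) ^ 2 + 2 / c * (128 * C ^ 2 / c * η ^ 2) ^ 2) =
          c / 8 * η * r ^ 4 + 2 / c * (128 * C ^ 2 / c) ^ 2 * η ^ 5 := by ring
        have b3 : η * (c / 8 * (r ^ 2) ^ 2 + 2 / c * (8 * C ^ 3 * K * η) ^ 2) =
          c / 8 * η * r ^ 4 + 2 / c * (8 * C ^ 3 * K) ^ 2 * η ^ 3 := by ring
        linarith

/-- The second moment of the displacement in one round is the noise covariance up to a small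
error. -/
lemma norm_integral_tensor_displacement_sub_le (θ : E) {δ : ℝ} (hδ : 0 < δ) :
    Integrable (fun s => tensor E (Φ θ s - θ) (Φ θ s - θ)) ν ∧
    ‖∫ s, tensor E (Φ θ s - θ) (Φ θ s - θ) ∂ν - (γ * η) • Q‖ ≤
      (1 + 1 / δ) * (2 * C ^ 2 * η ^ 2 * (‖θ - θs‖ ^ 2 + C * η ^ 2)) + δ * (C * (γ * η)) := by
  have hη := m.η_pos
  have hC0 := m.C_pos
  have mU : MemLp (fun s => Φ θ s - θ) 2 ν := by
    have := ((m.memLp_sub_ref θ).sub (memLp_const (θ - θs))).mono_exponent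
      (by norm_num : (2 : ℝ≥0∞) ≤ 4)
    exact this.ae_eq (ae_of_all _ fun s => by simp)
  have iU := integrable_bilin_self mU (tensor E)
  have iV := integrable_bilin_self (m.memLp_V.mono_exponent (by norm_num : (2 : ℝ≥0∞) ≤ 4)) (tensor E)
  refine ⟨iU, ?_⟩
  rw [← m.covariance, ← integral_sub iU iV]
  have iW2 := m.integrable_W_pow (p := 2) (by norm_num)
  have iV2 := m.integrable_norm_V_sq
  have hW2 : ∫ s, W s ^ 2 ∂ν ≤ C * η ^ 2 := m.moment_W 1 (by norm_num)
  have hpt : ∀ s, ‖tensor E (Φ θ s - θ) (Φ θ s - θ) - tensor E (V s) (V s)‖ ≤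
      (1 + 1 / δ) * (2 * C ^ 2 * η ^ 2 * (‖θ - θs‖ ^ 2 + W s ^ 2)) + δ * ‖V s‖ ^ 2 := by
    intro s
    set u := Φ θ s - θ
    set v := V s
    -- Since `u` is close to `-v` and a tensor square does not see the sign, the small quantity is
    -- `u + v`.
    have e1 : tensor E u u - tensor E v v =
        tensor E (u + v) (u + v) - (tensor E (u + v) v + tensor E v (u + v)) := by
      simp only [map_add, add_apply]; abel
    have h1 : ‖u + v‖ ≤ C * η * (‖θ - θs‖ + W s) := m.norm_add_le θ s
    have h2 : ‖u + v‖ ^ 2 ≤ 2 * C ^ 2 * η ^ 2 * (‖θ - θs‖ ^ 2 + W s ^ 2) := by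
      calc ‖u + v‖ ^ 2 ≤ (C * η * (‖θ - θs‖ + W s)) ^ 2 := by gcongr
        _ ≤ _ := by
          have := mul_nonneg (sq_nonneg (C * η)) (sq_nonneg (‖θ - θs‖ - W s))
          linarith
    -- The weight `δ` stays free here; it is set to `√γ + η` once the stationary moments are
    -- available.
    have h3 : 2 * (‖u + v‖ * ‖v‖) ≤ 1 / δ * ‖u + v‖ ^ 2 + δ * ‖v‖ ^ 2 := by
      have e : 1 / δ * ‖u + v‖ ^ 2 + δ * ‖v‖ ^ 2 - 2 * (‖u + v‖ * ‖v‖) =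
          (‖u + v‖ - δ * ‖v‖) ^ 2 / δ := by field_simp; ring
      have : 0 ≤ (‖u + v‖ - δ * ‖v‖) ^ 2 / δ := by positivity
      linarith
    have h4 : ‖tensor E u u - tensor E v v‖ ≤ ‖u + v‖ ^ 2 + 2 * (‖u + v‖ * ‖v‖) := by
      rw [e1]
      refine (_root_.norm_sub_le _ _).trans ?_
      have := _root_.norm_add_le (tensor E (u + v) v) (tensor E v (u + v))
      simp only [norm_tensor_apply] at this ⊢
      linarith
    have h5 : (1 + 1 / δ) * ‖u + v‖ ^ 2 ≤
        (1 + 1 / δ) * (2 * C ^ 2 * η ^ 2 * (‖θ - θs‖ ^ 2 + W s ^ 2)) := by gcongr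
    linarith
  have k1 : Integrable (fun s => (1 + 1 / δ) * (2 * C ^ 2 * η ^ 2 * (‖θ - θs‖ ^ 2 + W s ^ 2))) ν :=
    (((integrable_const _).fun_add iW2).const_mul _).const_mul _
  have k2 : Integrable (fun s => δ * ‖V s‖ ^ 2) ν := iV2.const_mul _
  refine (norm_integral_le_of_norm_le (k1.fun_add k2) (ae_of_all _ hpt)).trans ?_
  rw [integral_add k1 k2, integral_const_mul, integral_const_mul, integral_const_mul,
    integral_add (integrable_const _) iW2]
  simp only [integral_const, probReal_univ, one_smul]
  have hv := m.variance
  gcongr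

/-- One-step expansion of the second moment around the reference point. -/
lemma norm_integral_tensor_sub_ref_sub_le (θ : E) {δ : ℝ} (hδ : 0 < δ) :
    ‖∫ s, tensor E (Φ θ s - θs) (Φ θ s - θs) ∂ν - tensor E (θ - θs) (θ - θs) +
        η • (tensor E (θ - θs) (A (θ - θs)) + tensor E (A (θ - θs)) (θ - θs)) - (γ * η) • Q‖ ≤
      2 * C * η * (2 * η * ‖θ - θs‖ + η * ‖θ - θs‖ ^ 2 + 2 * ‖θ - θs‖ ^ 3 + ‖θ - θs‖ ^ 4) +
      ((1 + 1 / δ) * (2 * C ^ 2 * η ^ 2 * (‖θ - θs‖ ^ 2 + C * η ^ 2)) + δ * (C * (γ * η))) := by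
  have hη := m.η_pos
  have hη1 := m.η_le
  have hC0 := m.C_pos
  obtain ⟨iUU, hUU⟩ := m.norm_integral_tensor_displacement_sub_le θ hδ
  set x := θ - θs with hx
  set r := ‖x‖ with hr
  have hr0 : 0 ≤ r := norm_nonneg _
  -- `ρ` is the mean displacement beyond the linear drift. The quadratic term and `b` may stay
  -- inside it: paired with `x` they give `η r³` and `η² r`, both of error size.
  set ρ := ∫ s, Φ θ s ∂ν - θ + η • A x with hρ
  have iU : Integrable (fun s => Φ θ s - θ) ν := (m.integrable_round θ).sub (integrable_const θ)
  have hU : ∫ s, (Φ θ s - θ) ∂ν = ρ - η • A x := by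
    rw [integral_sub (m.integrable_round θ) (integrable_const θ), hρ]; simp
  have ixU : Integrable (fun s => tensor E x (Φ θ s - θ)) ν := (tensor E x).integrable_comp iU
  have iUx : Integrable (fun s => tensor E (Φ θ s - θ) x) ν :=
    ((tensor E).flip x).integrable_comp iU
  have hxU : ∫ s, tensor E x (Φ θ s - θ) ∂ν = tensor E x (ρ - η • A x) := by
    rw [← hU]; exact (tensor E x).integral_comp_comm iU
  have hUx : ∫ s, tensor E (Φ θ s - θ) x ∂ν = tensor E (ρ - η • A x) x := by
    rw [← hU]; exact ((tensor E).flip x).integral_comp_comm iU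
  have hsplit : ∫ s, tensor E (Φ θ s - θs) (Φ θ s - θs) ∂ν = tensor E x x +
      tensor E x (ρ - η • A x) + tensor E (ρ - η • A x) x +
      ∫ s, tensor E (Φ θ s - θ) (Φ θ s - θ) ∂ν := by
    have h1 : ∀ s, tensor E (Φ θ s - θs) (Φ θ s - θs) = tensor E x x + tensor E x (Φ θ s - θ) +
        tensor E (Φ θ s - θ) x + tensor E (Φ θ s - θ) (Φ θ s - θ) := by
      intro s
      have : Φ θ s - θs = x + (Φ θ s - θ) := by rw [hx]; abel
      rw [this]
      simp only [map_add, add_apply]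
      abel
    simp_rw [h1]
    rw [integral_add (((integrable_const _).fun_add ixU).fun_add iUx) iUU,
      integral_add ((integrable_const _).fun_add ixU) iUx,
      integral_add (integrable_const _) ixU, hxU, hUx]
    simp
  have hre : ∫ s, tensor E (Φ θ s - θs) (Φ θ s - θs) ∂ν - tensor E x x +
        η • (tensor E x (A x) + tensor E (A x) x) - (γ * η) • Q =
      (tensor E x ρ + tensor E ρ x) +
        (∫ s, tensor E (Φ θ s - θ) (Φ θ s - θ) ∂ν - (γ * η) • Q) := by
    rw [hsplit]
    simp only [map_sub, map_smul, sub_apply, smul_apply, smul_add]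
    abel
  rw [hre]
  refine (_root_.norm_add_le _ _).trans (add_le_add ?_ hUU)
  have hρn : ‖ρ‖ ≤ C * (η * (η ^ 2 + η * r + η * r ^ 2 + r ^ 3)) + η * (1 / 2 * (C * r * r)) +
      η * (C * η) := by
    have h1 := m.mean θ
    rw [← hx, ← hr] at h1
    have h2 : ρ = (∫ s, Φ θ s ∂ν - θ + η • (A x + (1 / 2 : ℝ) • T x x) - η • b) -
        η • ((1 / 2 : ℝ) • T x x) + η • b := by
      rw [hρ, smul_add]; abel
    rw [h2]
    refine (_root_.norm_add_le _ _).trans (add_le_add ((_root_.norm_sub_le _ _).trans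
      (add_le_add h1 ?_)) ?_)
    · rw [norm_smul, norm_smul, Real.norm_of_nonneg hη.le,
        Real.norm_of_nonneg (by norm_num : (0 : ℝ) ≤ 1 / 2)]
      gcongr
      exact (T.le_opNorm₂ x x).trans (by gcongr; exact m.norm_T_le)
    · rw [norm_smul, Real.norm_of_nonneg hη.le]
      gcongr
      exact m.norm_b_le
  have hsum : ‖tensor E x ρ + tensor E ρ x‖ ≤ 2 * r * ‖ρ‖ := by
    refine (_root_.norm_add_le _ _).trans_eq ?_
    rw [norm_tensor_apply, norm_tensor_apply]; ring
  refine hsum.trans ?_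
  calc 2 * r * ‖ρ‖ ≤ 2 * r * (C * (η * (η ^ 2 + η * r + η * r ^ 2 + r ^ 3)) +
        η * (1 / 2 * (C * r * r)) + η * (C * η)) := by gcongr
    _ = 2 * C * η * (η ^ 2 * r + η * r ^ 2 + η * r ^ 3 + r ^ 4 + 1 / 2 * r ^ 3 + η * r) := by ring
    _ ≤ _ := by
        have h1 : η ^ 2 * r ≤ η * r := by
          have : η ^ 2 ≤ η := by nlinarith
          gcongr
        have h2 : η * r ^ 3 ≤ 1 * r ^ 3 := by gcongr
        have h3 : 0 ≤ r ^ 3 := by positivity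
        refine mul_le_mul_of_nonneg_left ?_ (by positivity)
        linarith

end RoundModel
end Stationary

/-! ### Moments, mean and covariance under a stationary law. -/

section StationaryExpansion

variable {E : Type*} [NormedAddCommGroup E] [InnerProductSpace ℝ E] [MeasurableSpace E]
  {S : Type*} [MeasurableSpace S]
  [BorelSpace E] [SecondCountableTopology E] [CompleteSpace E]
  {ν : Measure S} [IsProbabilityMeasure ν] {Φ : E → S → E} {W : S → ℝ} {V : S → E} {θs : E}
  {A : E →L[ℝ] E} {T : E →L[ℝ] E →L[ℝ] E} {b : E} {Q : E →L[ℝ] E} {C c γ η : ℝ}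
  {π : Measure E} [IsProbabilityMeasure π]

lemma integrable_norm_sub_pow_of_memLp (hπ : MemLp id 4 π) (θs : E) {p : ℕ} (hp : p ≤ 4) :
    Integrable (fun θ => ‖θ - θs‖ ^ p) π := by
  have h : MemLp (fun θ => θ - θs) 4 π := hπ.sub (memLp_const θs)
  exact MemLp.integrable_norm_pow' (h.mono_exponent (by exact_mod_cast hp))

namespace RoundModel

variable (m : RoundModel ν Φ W V θs A T b Q C c γ η) (hπ : MemLp id 4 π)
  (hs : π = (π.prod ν).map (Function.uncurry Φ))
include m hπ hs

/-- Stationarity makes the moment before and after a round equal. Being finite, it can be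
subtracted, and the factor `η` common to drift and noise cancels. -/
lemma le_of_drift {K D : ℝ} {p : ℕ} (hp : p ≤ 4)
    (h : ∀ θ, ∫ s, ‖Φ θ s - θs‖ ^ p ∂ν ≤ (1 - c * η / 2) * ‖θ - θs‖ ^ p + K * (η * D)) :
    ∫ θ, ‖θ - θs‖ ^ p ∂π ≤ 2 / c * K * D := by
  have hi := integrable_norm_sub_pow_of_memLp hπ θs hp
  obtain ⟨h1, h2⟩ := integral_stationary m.meas hs hi
  have hη := m.η_pos
  have hc := m.c_pos
  have h3 : ∫ θ, ∫ s, ‖Φ θ s - θs‖ ^ p ∂ν ∂π ≤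
      ∫ θ, ((1 - c * η / 2) * ‖θ - θs‖ ^ p + K * (η * D)) ∂π :=
    integral_mono h1.integral_prod_left ((hi.const_mul _).add (integrable_const _)) h
  rw [← h2, integral_add (hi.const_mul _) (integrable_const _), integral_const_mul] at h3
  simp only [integral_const, probReal_univ, one_smul] at h3
  have h4 : (c * η / 2) * ∫ θ, ‖θ - θs‖ ^ p ∂π ≤ (c * η / 2) * (2 / c * K * D) := by
    have : (c * η / 2) * (2 / c * K * D) = K * (η * D) := by field_simp
    linarith
  exact le_of_mul_le_mul_left h4 (by positivity)

/-- Moments of a stationary law: the second moment is of order `δ²`, the fourth of order `η²`, and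
consequently the third of order `ηδ`, where `δ = √γ + η`. -/
lemma moments_stationary {K : ℝ} (hK1 : 1 ≤ K)
    (hK2 : 2 / c * (32 * C ^ 2 / c + 32 * C ^ 5 / c + 4 * C ^ 3) ≤ K)
    (hK4 : 2 / c * (2 / c * (128 * C ^ 2 / c) ^ 2 +
      2 / c * (8 * C ^ 3 * (288 * C ^ 2 / c + 8)) ^ 2 + 3 * C) ≤ K) :
    ∫ θ, ‖θ - θs‖ ∂π ≤ K * (√γ + η) ∧ ∫ θ, ‖θ - θs‖ ^ 2 ∂π ≤ K * (√γ + η) ^ 2 ∧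
      ∫ θ, ‖θ - θs‖ ^ 3 ∂π ≤ K * (η * (√γ + η)) ∧ ∫ θ, ‖θ - θs‖ ^ 4 ∂π ≤ K * η ^ 2 := by
  have hη := m.η_pos
  have hγ := m.γ_pos
  set δ := √γ + η with hδ
  have hδ0 : 0 < δ := by positivity
  have hD : γ + η ^ 2 ≤ δ ^ 2 := by
    have := Real.sq_sqrt hγ.le
    have : 0 ≤ √γ * η := by positivity
    nlinarith
  have i1 : Integrable (fun θ => ‖θ - θs‖) π := by
    simpa using integrable_norm_sub_pow_of_memLp hπ θs (p := 1) (by norm_num)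
  have i2 := integrable_norm_sub_pow_of_memLp hπ θs (p := 2) (by norm_num)
  have i3 := integrable_norm_sub_pow_of_memLp hπ θs (p := 3) (by norm_num)
  have i4 := integrable_norm_sub_pow_of_memLp hπ θs (p := 4) (by norm_num)
  have m2 : ∫ θ, ‖θ - θs‖ ^ 2 ∂π ≤ K * δ ^ 2 := by
    refine (m.le_of_drift hπ hs (by norm_num) m.integral_norm_sub_ref_sq_le).trans ?_
    have : 0 ≤ γ + η ^ 2 := by positivity
    gcongr
  have m4 : ∫ θ, ‖θ - θs‖ ^ 4 ∂π ≤ K * η ^ 2 := by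
    refine (m.le_of_drift hπ hs (D := η ^ 2) (by norm_num) fun θ => ?_).trans
      (mul_le_mul_of_nonneg_right hK4 (by positivity))
    refine (m.integral_norm_sub_ref_pow_four_le θ).trans_eq ?_
    ring
  refine ⟨?_, m2, ?_, m4⟩
  · have h1 : ∀ θ, ‖θ - θs‖ ≤ δ / 2 + 1 / (2 * δ) * ‖θ - θs‖ ^ 2 := by
      intro θ
      have : δ / 2 + 1 / (2 * δ) * ‖θ - θs‖ ^ 2 - ‖θ - θs‖ = (‖θ - θs‖ - δ) ^ 2 / (2 * δ) := by
        field_simp; ring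
      have : 0 ≤ (‖θ - θs‖ - δ) ^ 2 / (2 * δ) := by positivity
      linarith
    refine (integral_mono i1 ((integrable_const _).fun_add (i2.const_mul _)) h1).trans ?_
    rw [integral_add (integrable_const _) (i2.const_mul _), integral_const_mul]
    simp only [integral_const, probReal_univ, one_smul]
    calc δ / 2 + 1 / (2 * δ) * ∫ θ, ‖θ - θs‖ ^ 2 ∂π ≤ δ / 2 + 1 / (2 * δ) * (K * δ ^ 2) := by gcongr
      _ = (1 + K) / 2 * δ := by field_simp
      _ ≤ K * δ := by gcongr; linarith
  -- The weights balance the second moment `δ²` against the fourth `η²`: each piece contributes `K η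
  -- δ / 2`.
  · have h1 : ∀ θ, ‖θ - θs‖ ^ 3 ≤ η / (2 * δ) * ‖θ - θs‖ ^ 2 + δ / (2 * η) * ‖θ - θs‖ ^ 4 := by
      intro θ
      have : η / (2 * δ) * ‖θ - θs‖ ^ 2 + δ / (2 * η) * ‖θ - θs‖ ^ 4 - ‖θ - θs‖ ^ 3 =
          ‖θ - θs‖ ^ 2 * (η - δ * ‖θ - θs‖) ^ 2 / (2 * δ * η) := by
        field_simp; ring
      have : 0 ≤ ‖θ - θs‖ ^ 2 * (η - δ * ‖θ - θs‖) ^ 2 / (2 * δ * η) := by positivity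
      linarith
    refine (integral_mono i3 ((i2.const_mul _).fun_add (i4.const_mul _)) h1).trans ?_
    rw [integral_add (i2.const_mul _) (i4.const_mul _), integral_const_mul, integral_const_mul]
    calc _ ≤ η / (2 * δ) * (K * δ ^ 2) + δ / (2 * η) * (K * η ^ 2) := by gcongr
      _ = K * (η * δ) := by field_simp; ring

lemma step_size_bounds : η ≤ √γ + η ∧ (√γ + η) ≤ 2 ∧ γ ≤ (√γ + η) ^ 2 ∧ γ * η ≤ η ^ 2 := by
  have hη := m.η_pos
  have hγ := m.γ_pos
  have hη1 := m.η_le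
  have hγη := m.γ_le
  have h1 : √γ ≤ 1 := Real.sqrt_le_one.2 (hγη.trans hη1)
  have h0 := Real.sqrt_nonneg γ
  have h2 := Real.sq_sqrt hγ.le
  refine ⟨by linarith, by linarith, by nlinarith, by nlinarith⟩

/-- First-order expansion of the stationary mean. -/
lemma mean_stationary {K : ℝ} (hK0 : 0 ≤ K)
    (hm : ∫ θ, ‖θ - θs‖ ∂π ≤ K * (√γ + η) ∧ ∫ θ, ‖θ - θs‖ ^ 2 ∂π ≤ K * (√γ + η) ^ 2 ∧
      ∫ θ, ‖θ - θs‖ ^ 3 ∂π ≤ K * (η * (√γ + η)) ∧ ∫ θ, ‖θ - θs‖ ^ 4 ∂π ≤ K * η ^ 2)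
    (Ct : (E →L[ℝ] E) →L[ℝ] E) (hCt : ∀ x, Ct (tensor E x x) = T x x) :
    ‖A (∫ θ, θ ∂π - θs) + (1 / 2 : ℝ) • Ct (∫ θ, tensor E (θ - θs) (θ - θs) ∂π) - b‖ ≤
      C * (1 + 4 * K) * (η * (√γ + η)) := by
  obtain ⟨hδ1, hδ2, -, -⟩ := m.step_size_bounds hπ hs
  have hη := m.η_pos
  have hη1 := m.η_le
  have hC0 := m.C_pos
  set δ := √γ + η with hδ
  have hδ0 : 0 < δ := by linarith
  obtain ⟨m1, m2, m3, m4⟩ := hm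
  have i1 : Integrable (fun θ => ‖θ - θs‖) π := by
    simpa using integrable_norm_sub_pow_of_memLp hπ θs (p := 1) (by norm_num)
  have i2 := integrable_norm_sub_pow_of_memLp hπ θs (p := 2) (by norm_num)
  have i3 := integrable_norm_sub_pow_of_memLp hπ θs (p := 3) (by norm_num)
  have i4 := integrable_norm_sub_pow_of_memLp hπ θs (p := 4) (by norm_num)
  have iid : Integrable (fun θ : E => θ) π := hπ.integrable (by norm_num)
  have ix : Integrable (fun θ : E => θ - θs) π := iid.sub (integrable_const θs)
  have ixx : Integrable (fun θ : E => tensor E (θ - θs) (θ - θs)) π :=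
    integrable_bilin_self ((hπ.mono_exponent (by norm_num)).sub (memLp_const θs)) (tensor E)
  have iT : Integrable (fun θ : E => T (θ - θs) (θ - θs)) π := by
    have := Ct.integrable_comp ixx
    simpa only [hCt] using this
  obtain ⟨h1, h2⟩ := integral_stationary m.meas hs iid
  have iΦ : Integrable (fun θ => ∫ s, Φ θ s ∂ν) π := h1.integral_prod_left
  have iU : Integrable (fun θ => ∫ s, Φ θ s ∂ν - θ) π := iΦ.sub iid
  have iAT : Integrable (fun θ => A (θ - θs) + (1 / 2 : ℝ) • T (θ - θs) (θ - θs)) π :=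
    (A.integrable_comp ix).add (iT.smul (1 / 2 : ℝ))
  have hx : ∫ θ, A (θ - θs) ∂π = A (∫ θ, θ ∂π - θs) := by
    rw [A.integral_comp_comm ix, integral_sub iid (integrable_const θs)]; simp
  have hTT : ∫ θ, T (θ - θs) (θ - θs) ∂π = Ct (∫ θ, tensor E (θ - θs) (θ - θs) ∂π) := by
    rw [← Ct.integral_comp_comm ixx]; simp only [hCt]
  -- The mean increment integrates to zero under `π`, so everything left carries a factor `η`, which
  -- is divided out at the end.
  have hkey : ∫ θ, (∫ s, Φ θ s ∂ν - θ +
      η • (A (θ - θs) + (1 / 2 : ℝ) • T (θ - θs) (θ - θs)) - η • b) ∂π =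
      η • (A (∫ θ, θ ∂π - θs) + (1 / 2 : ℝ) • Ct (∫ θ, tensor E (θ - θs) (θ - θs) ∂π) - b) := by
    have iAT' : Integrable (fun θ => η • (A (θ - θs) + (1 / 2 : ℝ) • T (θ - θs) (θ - θs))) π :=
      iAT.smul η
    rw [integral_sub (iU.fun_add iAT') (integrable_const _), integral_add iU iAT',
      integral_sub iΦ iid, ← h2, integral_smul,
      integral_add (A.integrable_comp ix) (iT.fun_smul (1 / 2 : ℝ)), integral_smul, hx, hTT]
    simp [smul_sub]
  obtain ⟨j1, j2⟩ := integral_quartic_le i1 i2 i3 i4 m1 m2 m3 m4 (C * η * η ^ 2)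
    (b := C * η * η) (c := C * η * η) (d := C * η) (e := 0) (by positivity) (by positivity)
    (by positivity) le_rfl
  have hnorm := norm_integral_le_of_norm_le j1 (ae_of_all _ fun θ => (m.mean θ).trans_eq (by ring))
  rw [hkey, norm_smul, Real.norm_of_nonneg hη.le] at hnorm
  refine le_of_mul_le_mul_left ((hnorm.trans j2).trans ?_) hη
  have e1 : δ ^ 2 ≤ 2 * δ := by nlinarith
  have e2 : η * (C * η * (K * δ ^ 2)) ≤ η * (C * η * (K * (2 * δ))) := by gcongr
  have e3 : η * (C * η * η) ≤ η * (C * η * δ) := by gcongr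
  linarith

/-- First-order expansion of the stationary covariance. -/
lemma covariance_stationary {K : ℝ} (hK0 : 0 ≤ K)
    (hm : ∫ θ, ‖θ - θs‖ ∂π ≤ K * (√γ + η) ∧ ∫ θ, ‖θ - θs‖ ^ 2 ∂π ≤ K * (√γ + η) ^ 2 ∧
      ∫ θ, ‖θ - θs‖ ^ 3 ∂π ≤ K * (η * (√γ + η)) ∧ ∫ θ, ‖θ - θs‖ ^ 4 ∂π ≤ K * η ^ 2)
    (Ly : (E →L[ℝ] E) →L[ℝ] (E →L[ℝ] E))
    (hLy : ∀ x, Ly (tensor E x x) = tensor E x (A x) + tensor E (A x) x) :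
    ‖Ly (∫ θ, tensor E (θ - θs) (θ - θs) ∂π) - γ • Q‖ ≤
      (14 * C * K + 6 * C ^ 2 * (K + C) + C) * (η * (√γ + η)) := by
  obtain ⟨hδ1, hδ2, -, hγη⟩ := m.step_size_bounds hπ hs
  have hη := m.η_pos
  have hη1 := m.η_le
  have hC0 := m.C_pos
  set δ := √γ + η with hδ
  have hδ0 : 0 < δ := by linarith
  obtain ⟨m1, m2, m3, m4⟩ := hm
  have i1 : Integrable (fun θ => ‖θ - θs‖) π := by
    simpa using integrable_norm_sub_pow_of_memLp hπ θs (p := 1) (by norm_num)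
  have i2 := integrable_norm_sub_pow_of_memLp hπ θs (p := 2) (by norm_num)
  have i3 := integrable_norm_sub_pow_of_memLp hπ θs (p := 3) (by norm_num)
  have i4 := integrable_norm_sub_pow_of_memLp hπ θs (p := 4) (by norm_num)
  have ixx : Integrable (fun θ : E => tensor E (θ - θs) (θ - θs)) π :=
    integrable_bilin_self ((hπ.mono_exponent (by norm_num)).sub (memLp_const θs)) (tensor E)
  obtain ⟨h1, h2⟩ := integral_stationary m.meas hs ixx
  have iΦ : Integrable (fun θ => ∫ s, tensor E (Φ θ s - θs) (Φ θ s - θs) ∂ν) π :=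
    h1.integral_prod_left
  have iL : Integrable (fun θ => tensor E (θ - θs) (A (θ - θs)) + tensor E (A (θ - θs)) (θ - θs))
      π := by
    have := Ly.integrable_comp ixx
    simpa only [hLy] using this
  have hL : ∫ θ, (tensor E (θ - θs) (A (θ - θs)) + tensor E (A (θ - θs)) (θ - θs)) ∂π =
      Ly (∫ θ, tensor E (θ - θs) (θ - θs) ∂π) := by
    rw [← Ly.integral_comp_comm ixx]; simp only [hLy]
  have hkey : ∫ θ, (∫ s, tensor E (Φ θ s - θs) (Φ θ s - θs) ∂ν - tensor E (θ - θs) (θ - θs) +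
        η • (tensor E (θ - θs) (A (θ - θs)) + tensor E (A (θ - θs)) (θ - θs)) - (γ * η) • Q) ∂π =
      η • (Ly (∫ θ, tensor E (θ - θs) (θ - θs) ∂π) - γ • Q) := by
    have iD : Integrable (fun θ => ∫ s, tensor E (Φ θ s - θs) (Φ θ s - θs) ∂ν -
        tensor E (θ - θs) (θ - θs)) π := iΦ.sub ixx
    rw [integral_sub (iD.fun_add (iL.fun_smul η)) (integrable_const _),
      integral_add iD (iL.fun_smul η), integral_sub iΦ ixx, ← h2, integral_smul, hL]
    simp [smul_sub, smul_smul, mul_comm]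
  -- With weight `δ = √γ + η` the second moment `δ²` pays for the factor `1 / δ`, and `δ γ η ≤ η² δ`
  -- has the same size.
  obtain ⟨j1, j2⟩ := integral_quartic_le i1 i2 i3 i4 m1 m2 m3 m4
    ((1 + 1 / δ) * (2 * C ^ 2 * η ^ 2 * (C * η ^ 2)) + δ * (C * (γ * η)))
    (b := 4 * C * η * η) (c := 2 * C * η * η + (1 + 1 / δ) * (2 * C ^ 2 * η ^ 2))
    (d := 4 * C * η) (e := 2 * C * η) (by positivity) (by positivity)
    (by positivity) (by positivity)
  have hnorm := norm_integral_le_of_norm_le j1 (ae_of_all _ fun θ =>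
    (m.norm_integral_tensor_sub_ref_sub_le θ hδ0).trans_eq (by ring))
  rw [hkey, norm_smul, Real.norm_of_nonneg hη.le] at hnorm
  refine le_of_mul_le_mul_left ((hnorm.trans j2).trans ?_) hη
  have e1 : δ ^ 2 ≤ 2 * δ := by nlinarith
  have e2 : (1 + 1 / δ) * δ ^ 2 ≤ 3 * δ := by
    have : (1 + 1 / δ) * δ ^ 2 = δ ^ 2 + δ := by field_simp
    linarith
  have e3 : (1 + 1 / δ) * (2 * C ^ 2 * η ^ 2 * (C * η ^ 2)) ≤ 6 * C ^ 3 * (η ^ 2 * δ) := by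
    calc (1 + 1 / δ) * (2 * C ^ 2 * η ^ 2 * (C * η ^ 2))
        ≤ (1 + 1 / δ) * (2 * C ^ 2 * η ^ 2 * (C * δ ^ 2)) := by gcongr
      _ = 2 * C ^ 3 * η ^ 2 * ((1 + 1 / δ) * δ ^ 2) := by ring
      _ ≤ 2 * C ^ 3 * η ^ 2 * (3 * δ) := by gcongr
      _ = _ := by ring
  have e4 : (1 + 1 / δ) * (2 * C ^ 2 * η ^ 2) * (K * δ ^ 2) ≤ 6 * C ^ 2 * K * (η ^ 2 * δ) := by
    calc (1 + 1 / δ) * (2 * C ^ 2 * η ^ 2) * (K * δ ^ 2)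
        = 2 * C ^ 2 * K * η ^ 2 * ((1 + 1 / δ) * δ ^ 2) := by ring
      _ ≤ 2 * C ^ 2 * K * η ^ 2 * (3 * δ) := by gcongr
      _ = _ := by ring
  have e5 : δ * (C * (γ * η)) ≤ δ * (C * η ^ 2) := by gcongr
  have e6 : 2 * C * η * η * (K * δ ^ 2) ≤ 2 * C * η * η * (K * (2 * δ)) := by gcongr
  have e7 : 2 * C * η * (K * η ^ 2) ≤ 2 * C * η * (K * (η * δ)) := by
    rw [sq]; gcongr
  linarith

end RoundModel

end StationaryExpansion

/-! ### Calculus of gradients: sums, symmetric Hessians, strong monotonicity. -/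

section Gradient

variable {E : Type*} [NormedAddCommGroup E] [InnerProductSpace ℝ E] [CompleteSpace E]

lemma gradient_const_mul_sum {ι : Type*} [Fintype ι] {f : ι → E → ℝ}
    (hf : ∀ i, Differentiable ℝ (f i)) (a : ℝ) :
    gradient (fun θ => a * ∑ i, f i θ) = fun θ => a • ∑ i, gradient (f i) θ := by
  funext θ
  have h : HasFDerivAt (fun θ => a * ∑ i, f i θ) (a • ∑ i, fderiv ℝ (f i) θ) θ :=
    (HasFDerivAt.fun_sum fun i _ => (hf i θ).hasFDerivAt).const_mul a
  rw [gradient, h.fderiv]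
  simp [gradient]

lemma fderiv_const_smul_sum {ι : Type*} [Fintype ι] {F : Type*} [NormedAddCommGroup F]
    [NormedSpace ℝ F] {f : ι → E → F} (hf : ∀ i, Differentiable ℝ (f i)) (a : ℝ) :
    fderiv ℝ (fun θ => a • ∑ i, f i θ) = fun θ => a • ∑ i, fderiv ℝ (f i) θ := by
  funext θ
  exact ((HasFDerivAt.fun_sum fun i _ => (hf i θ).hasFDerivAt).const_smul a).fderiv

lemma inner_fderiv_gradient_comm {f : E → ℝ} (hf : Differentiable ℝ f)
    (hf' : Differentiable ℝ (gradient f)) (x v w : E) :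
    inner ℝ (fderiv ℝ (gradient f) x v) w = inner ℝ v (fderiv ℝ (gradient f) x w) := by
  set D : E →L[ℝ] (E →L[ℝ] ℝ) := innerSL ℝ
  have hD : ∀ y, HasFDerivAt f (D (gradient f y)) y := fun y => by
    have := (hf y).hasFDerivAt
    convert this using 1
    ext u
    exact inner_gradient_left (𝕜 := ℝ)
  have hD' : HasFDerivAt (fun y => D (gradient f y)) (D ∘L fderiv ℝ (gradient f) x) x :=
    D.hasFDerivAt.comp x (hf' x).hasFDerivAt
  have h := second_derivative_symmetric hD hD' v w
  rw [real_inner_comm _ v]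
  exact h

/-- Mean value inequality for `t ↦ ⟨θ - ϑ, G (ϑ + t (θ - ϑ))⟩` on the unit interval. -/
lemma mul_norm_sq_le_inner_of_fderiv {G : E → E} (hG : Differentiable ℝ G) {μ : ℝ}
    (hμ : ∀ θ v, μ * ‖v‖ ^ 2 ≤ inner ℝ (fderiv ℝ G θ v) v) (θ ϑ : E) :
    μ * ‖θ - ϑ‖ ^ 2 ≤ inner ℝ (θ - ϑ) (G θ - G ϑ) := by
  have hd : ∀ t : ℝ, HasDerivAt (fun t : ℝ => inner ℝ (θ - ϑ) (G (ϑ + t • (θ - ϑ))))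
      (inner ℝ (θ - ϑ) (fderiv ℝ G (ϑ + t • (θ - ϑ)) (θ - ϑ))) t := fun t => by
    have h1 : HasDerivAt (fun t : ℝ => ϑ + t • (θ - ϑ)) (θ - ϑ) t := by
      simpa using ((hasDerivAt_id t).smul_const (θ - ϑ)).const_add ϑ
    have h2 := (hG (ϑ + t • (θ - ϑ))).hasFDerivAt.comp_hasDerivAt t h1
    exact (innerSL ℝ (θ - ϑ)).hasFDerivAt.comp_hasDerivAt t h2
  have h := mul_sub_le_image_sub_of_le_deriv (C := μ * ‖θ - ϑ‖ ^ 2)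
    (fun t => (hd t).differentiableAt)
    (fun t => by rw [(hd t).deriv, real_inner_comm]; exact hμ _ _) zero_le_one
  simpa [inner_sub_right] using h

end Gradient

/-! ### Sample gradients: joint measurability and unbiasedness. -/

section SampleGradient

variable {E : Type*} [NormedAddCommGroup E] [InnerProductSpace ℝ E] [FiniteDimensional ℝ E]
  [MeasurableSpace E] [BorelSpace E] {Z : Type*} [MeasurableSpace Z]

/-- Each coordinate of the gradient is a pointwise limit of difference quotients with increments
`1/n`, which are jointly measurable. -/
lemma measurable_gradient_with_param {F : Z → E → ℝ}
    (hF : Measurable fun p : Z × E => F p.1 p.2) (hd : ∀ z, Differentiable ℝ (F z)) :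
    Measurable fun p : Z × E => gradient (F p.1) p.2 := by
  have hv : ∀ v : E, Measurable fun p : Z × E => inner ℝ v (gradient (F p.1) p.2) := fun v => by
    refine measurable_of_tendsto_metrizable
      (f := fun (n : ℕ) (p : Z × E) =>
        (n : ℝ) • (F p.1 (p.2 + (n : ℝ)⁻¹ • v) - F p.1 p.2)) (fun n => ?_) ?_
    · refine Measurable.const_smul (Measurable.sub ?_ hF) (n : ℝ)
      exact hF.comp (measurable_fst.prodMk (measurable_snd.add_const _))
    · rw [tendsto_pi_nhds]
      intro p
      have h := ((hd p.1 p.2).hasFDerivAt.lim_real v).comp tendsto_natCast_atTop_atTop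
      rw [real_inner_comm, inner_gradient_left]
      exact h
  set b := stdOrthonormalBasis ℝ E
  have hb : (fun p : Z × E => gradient (F p.1) p.2) =
      fun p => ∑ i, (inner ℝ (b i) (gradient (F p.1) p.2) : ℝ) • b i := by
    funext p
    exact (b.sum_repr' _).symm
  rw [hb]
  exact Finset.measurable_sum _ fun i _ => (hv (b i)).smul_const (b i)

/-- Differentiation under the integral: on the unit ball around `θ` the Lipschitz bound dominates
all sample gradients by `‖gradient (F z) θ‖ + L`. -/
lemma gradient_integral_eq {ξ : Measure Z} [IsProbabilityMeasure ξ] {F : Z → E → ℝ} {L : ℝ}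
    (hint : ∀ θ, Integrable (fun z => F z θ) ξ)
    (hd : ∀ z, Differentiable ℝ (F z)) (hL : 0 ≤ L)
    (hlip : ∀ z θ ϑ, ‖gradient (F z) θ - gradient (F z) ϑ‖ ≤ L * ‖θ - ϑ‖) {θ : E}
    (hg : Integrable (fun z => gradient (F z) θ) ξ) :
    gradient (fun θ => ∫ z, F z θ ∂ξ) θ = ∫ z, gradient (F z) θ ∂ξ := by
  set D := InnerProductSpace.toDual ℝ E
  have hD : ∀ z ϑ, fderiv ℝ (F z) ϑ = D (gradient (F z) ϑ) := fun z ϑ => by simp [gradient, D]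
  have h := hasFDerivAt_integral_of_dominated_of_fderiv_le (μ := ξ) (F := fun ϑ z => F z ϑ)
    (F' := fun ϑ z => fderiv ℝ (F z) ϑ) (bound := fun z => ‖gradient (F z) θ‖ + L)
    (Metric.ball_mem_nhds θ one_pos)
    (Filter.Eventually.of_forall fun ϑ => (hint ϑ).aestronglyMeasurable) (hint θ)
    (by
      simp_rw [hD]
      exact D.continuous.comp_aestronglyMeasurable hg.aestronglyMeasurable)
    (ae_of_all _ fun z ϑ hϑ => by
      rw [hD, D.norm_map]
      have h1 := norm_add_le (gradient (F z) θ) (gradient (F z) ϑ - gradient (F z) θ)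
      rw [add_sub_cancel] at h1
      have h2 := hlip z ϑ θ
      rw [Metric.mem_ball, dist_eq_norm] at hϑ
      nlinarith)
    (hg.norm.add (integrable_const L))
    (ae_of_all _ fun z ϑ _ => (hd z ϑ).hasFDerivAt)
  rw [gradient, h.fderiv]
  simp_rw [hD]
  rw [show (∫ z, D (gradient (F z) θ) ∂ξ) = D (∫ z, gradient (F z) θ ∂ξ) from
    (D.toContinuousLinearEquiv.toContinuousLinearMap).integral_comp_comm hg]
  exact D.symm_apply_apply _

end SampleGradient

/-! ### Global Taylor bound, and invertibility of the Hessian and Lyapunov operators. -/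

section LinearAlgebra

/-- The stationary law is not confined near `θs`, so the cubic bound must be global. Away from `θs`
the field grows linearly and its Taylor polynomial quadratically, which a multiple of the cube
dominates. -/
lemma exists_norm_taylor_remainder_le {E : Type*} [NormedAddCommGroup E] [NormedSpace ℝ E]
    {G : E → E} {θs : E} {S : E →L[ℝ] E} {T : E →L[ℝ] E →L[ℝ] E} {L : ℝ}
    (hlip : ∀ θ, ‖G θ - G θs‖ ≤ L * ‖θ - θs‖)
    (h : (fun θ => G θ - (G θs + S (θ - θs) + (1 / 2 : ℝ) • T (θ - θs) (θ - θs)))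
      =O[𝓝 θs] (fun θ => ‖θ - θs‖ ^ 3)) :
    ∃ R : ℝ, 0 ≤ R ∧ ∀ θ,
      ‖G θ - (G θs + S (θ - θs) + (1 / 2 : ℝ) • T (θ - θs) (θ - θs))‖ ≤ R * ‖θ - θs‖ ^ 3 := by
  obtain ⟨C, hC, hb⟩ := h.exists_nonneg
  obtain ⟨δ, hδ, hball⟩ := Metric.eventually_nhds_iff.1 hb.bound
  refine ⟨C + ((|L| + ‖S‖) / δ ^ 2 + ‖T‖ / δ), by positivity, fun θ => ?_⟩
  set r := ‖θ - θs‖ with hr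
  have hr0 : 0 ≤ r := norm_nonneg _
  rcases lt_or_ge r δ with hlt | hge
  · have h1 := hball (y := θ) (by rwa [dist_eq_norm])
    rw [Real.norm_of_nonneg (by positivity : (0 : ℝ) ≤ ‖θ - θs‖ ^ 3)] at h1
    refine h1.trans ?_
    rw [add_mul]
    exact le_add_of_nonneg_right (by positivity)
  · have hST : ‖G θ - (G θs + S (θ - θs) + (1 / 2 : ℝ) • T (θ - θs) (θ - θs))‖ ≤
        |L| * r + ‖S‖ * r + ‖T‖ * r * r := by
      have e : G θ - (G θs + S (θ - θs) + (1 / 2 : ℝ) • T (θ - θs) (θ - θs)) =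
          (G θ - G θs) - S (θ - θs) - (1 / 2 : ℝ) • T (θ - θs) (θ - θs) := by abel
      rw [e]
      refine (norm_sub_le _ _).trans (add_le_add ((norm_sub_le _ _).trans (add_le_add ?_ ?_)) ?_)
      · exact (hlip θ).trans (mul_le_mul_of_nonneg_right (le_abs_self L) hr0)
      · exact S.le_opNorm _
      · rw [norm_smul, Real.norm_of_nonneg (by norm_num)]
        have := T.le_opNorm₂ (θ - θs) (θ - θs)
        nlinarith [norm_nonneg (T (θ - θs) (θ - θs))]
    refine hST.trans ?_
    have hq : 1 ≤ r / δ := (one_le_div hδ).2 hge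
    have e1 : (|L| + ‖S‖) * r ≤ (|L| + ‖S‖) * r * (r / δ) ^ 2 :=
      le_mul_of_one_le_right (by positivity) (one_le_pow₀ hq)
    have e2 : ‖T‖ * r * r ≤ ‖T‖ * r * r * (r / δ) := le_mul_of_one_le_right (by positivity) hq
    have e3 : (C + ((|L| + ‖S‖) / δ ^ 2 + ‖T‖ / δ)) * r ^ 3 =
        C * r ^ 3 + ((|L| + ‖S‖) * r * (r / δ) ^ 2 + ‖T‖ * r * r * (r / δ)) := by
      field_simp
    rw [e3]
    have : 0 ≤ C * r ^ 3 := by positivity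
    linarith

lemma isInvertible_of_injective {E : Type*} [NormedAddCommGroup E] [NormedSpace ℝ E]
    [FiniteDimensional ℝ E] {S : E →L[ℝ] E} (h : Function.Injective S) : S.IsInvertible :=
  ⟨(LinearEquiv.ofInjectiveEndo (S : E →ₗ[ℝ] E) h).toContinuousLinearEquiv, by ext; rfl⟩

variable {d : ℕ}

/-- Exhibits the contraction as a continuous linear map of the matrix, so that it commutes with the
stationary expectation. -/
lemma contract_eq_sum_apply (T : Vec d →L[ℝ] Vec d →L[ℝ] Vec d) :
    contract T = (∑ i : Fin d, T (EuclideanSpace.basisFun (Fin d) ℝ i) ∘L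
      ContinuousLinearMap.apply ℝ (Vec d) (EuclideanSpace.basisFun (Fin d) ℝ i) :
      (Vec d →L[ℝ] Vec d) →L[ℝ] Vec d) := by
  ext M
  simp [contract]

lemma contract_tensor_self (T : Vec d →L[ℝ] Vec d →L[ℝ] Vec d) (x : Vec d) :
    contract T (tensor (Vec d) x x) = T x x := by
  set b := EuclideanSpace.basisFun (Fin d) ℝ with hb
  calc contract T (tensor (Vec d) x x)
      = T (∑ i, (inner ℝ x (b i) : ℝ) • b i) x := by
        simp [contract, tensor_apply_apply, ← hb]
    _ = T x x := by
        congr 2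
        simpa only [real_inner_comm] using b.sum_repr' x

lemma lyapunov_tensor_self {S : Vec d →L[ℝ] Vec d}
    (hS : ∀ v w, inner ℝ (S v) w = inner ℝ v (S w)) (x : Vec d) :
    lyapunov S (tensor (Vec d) x x) = tensor (Vec d) x (S x) + tensor (Vec d) (S x) x := by
  ext1 v
  simp [lyapunov, tensor_apply_apply, hS]

lemma injective_of_coercive {S : Vec d →L[ℝ] Vec d} {μ : ℝ} (hμ : 0 < μ)
    (hc : ∀ v, μ * ‖v‖ ^ 2 ≤ inner ℝ (S v) v) : Function.Injective S := by
  refine (injective_iff_map_eq_zero S).2 fun v hv => ?_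
  have h := hc v
  rw [hv, inner_zero_left] at h
  have : ‖v‖ ^ 2 ≤ 0 := by nlinarith
  exact norm_eq_zero.1 (pow_eq_zero_iff two_ne_zero |>.1 (le_antisymm this (sq_nonneg _)))

/-- On an eigenvector `b i` of `S` with eigenvalue `l > 0` the equation reads `(l + S)(M (b i)) =
0`, and `l + S` is coercive. -/
lemma lyapunov_injective {S : Vec d →L[ℝ] Vec d} {μ : ℝ} (hμ : 0 < μ)
    (hS : ∀ v w, inner ℝ (S v) w = inner ℝ v (S w))
    (hc : ∀ v, μ * ‖v‖ ^ 2 ≤ inner ℝ (S v) v) : Function.Injective (lyapunov S) := by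
  refine (injective_iff_map_eq_zero _).2 fun M hM => ?_
  have hsymm : (S : Vec d →ₗ[ℝ] Vec d).IsSymmetric := hS
  set b := hsymm.eigenvectorBasis (n := d) (by simp) with hb
  have key : ∀ i, M (b i) = 0 := fun i => by
    set l : ℝ := hsymm.eigenvalues (n := d) (by simp) i
    have hSb : S (b i) = l • b i := by
      exact hsymm.apply_eigenvectorBasis (n := d) (by simp) i
    have hl : 0 < l := by
      have h := hc (b i)
      rw [hSb, inner_smul_left, real_inner_self_eq_norm_sq, b.orthonormal.1 i] at h
      simp at h
      linarith
    have h0 : M (S (b i)) + S (M (b i)) = 0 := by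
      have := congrArg (fun K : Vec d →L[ℝ] Vec d => K (b i)) hM
      simpa [lyapunov] using this
    rw [hSb, map_smul] at h0
    have h1 := congrArg (fun v => (inner ℝ v (M (b i)) : ℝ)) h0
    simp only [inner_add_left, real_inner_smul_left, real_inner_self_eq_norm_sq,
      inner_zero_left] at h1
    have h2 := hc (M (b i))
    have : ‖M (b i)‖ ^ 2 ≤ 0 := by nlinarith [sq_nonneg ‖M (b i)‖]
    exact norm_eq_zero.1 (pow_eq_zero_iff two_ne_zero |>.1 (le_antisymm this (sq_nonneg _)))
  have h : (M : Vec d →ₗ[ℝ] Vec d) = 0 := b.toBasis.ext fun i => by simpa using key i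
  ext1 v
  exact congrArg (fun K : Vec d →ₗ[ℝ] Vec d => K v) h

end LinearAlgebra

/-! ### FedAvg rounds satisfy the abstract model. -/

section RoundModelExistence

variable {E : Type*} [NormedAddCommGroup E] [InnerProductSpace ℝ E] [MeasurableSpace E]
  [BorelSpace E] [SecondCountableTopology E] [CompleteSpace E]

lemma RoundModel.lintegral_contraction {S : Type*} [MeasurableSpace S] {ν : Measure S}
    [IsProbabilityMeasure ν] {Φ : E → S → E} {W : S → ℝ} {V : S → E} {θs : E} {A : E →L[ℝ] E}
    {T : E →L[ℝ] E →L[ℝ] E} {b : E} {Q : E →L[ℝ] E} {C c γ η : ℝ}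
    (m : RoundModel ν Φ W V θs A T b Q C c γ η) :
    ∃ K : ℝ≥0, K < 1 ∧ ∀ θ ϑ, ∫⁻ s, ‖Φ θ s - Φ ϑ s‖ₑ ^ 4 ∂ν ≤ (K : ℝ≥0∞) ^ 4 * ‖θ - ϑ‖ₑ ^ 4 := by
  set r : ℝ≥0 := Real.toNNReal (1 - c * η) with hr
  have hr1 : r < 1 := by
    rw [hr, Real.toNNReal_lt_one]
    have := mul_pos m.c_pos m.η_pos
    linarith
  have hK4 : (NNReal.sqrt (NNReal.sqrt r)) ^ 4 = r := by
    rw [show 4 = 2 * 2 from rfl, pow_mul, NNReal.sq_sqrt, NNReal.sq_sqrt]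
  refine ⟨NNReal.sqrt (NNReal.sqrt r), ?_, fun θ ϑ => ?_⟩
  · rw [← pow_lt_one_iff_of_nonneg zero_le (n := 4) (by norm_num), hK4]
    exact hr1
  · rw [← ENNReal.coe_pow, hK4]
    have hpt : ∀ x : E, ‖x‖ₑ ^ 4 = ENNReal.ofReal (‖x‖ ^ 4) := fun x => by
      rw [ENNReal.ofReal_pow (norm_nonneg _), ofReal_norm]
    simp_rw [hpt]
    rw [← ofReal_integral_eq_lintegral_ofReal (m.integrable_norm_sub_pow θ ϑ 4)
      (ae_of_all _ fun s => by positivity)]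
    calc ENNReal.ofReal (∫ s, ‖Φ θ s - Φ ϑ s‖ ^ 4 ∂ν)
        ≤ ENNReal.ofReal ((1 - c * η) * ‖θ - ϑ‖ ^ 4) :=
          ENNReal.ofReal_le_ofReal (m.contraction θ ϑ 1 one_lt_two)
      _ = (r : ℝ≥0∞) * ENNReal.ofReal (‖θ - ϑ‖ ^ 4) := by
          rw [ENNReal.ofReal_mul' (by positivity)]; rfl

lemma RoundModel.exists_unique_stationary {S : Type*} [MeasurableSpace S] {ν : Measure S}
    [IsProbabilityMeasure ν] {Φ : E → S → E} {W : S → ℝ} {V : S → E} {θs : E} {A : E →L[ℝ] E}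
    {T : E →L[ℝ] E →L[ℝ] E} {b : E} {Q : E →L[ℝ] E} {C c γ η : ℝ}
    (m : RoundModel ν Φ W V θs A T b Q C c γ η) :
    ∃ π : Measure E, IsProbabilityMeasure π ∧ MemLp id 4 π ∧
      π = (π.prod ν).map (Function.uncurry Φ) ∧
      ∀ π' : Measure E, IsProbabilityMeasure π' →
        π' = (π'.prod ν).map (Function.uncurry Φ) → π' = π := by
  obtain ⟨K, hK, hc⟩ := m.lintegral_contraction
  have h0 : MemLp (Φ θs) 4 ν := by
    convert (m.memLp_sub_ref θs).add (memLp_const θs) using 1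
    funext s
    simp
  obtain ⟨π, hp, hπ, hs⟩ := exists_stationary_of_contracting m.meas hK hc θs h0
  exact ⟨π, hp, hπ, hs, fun π' _ hs' => stationary_unique_of_contracting m.meas hK hc hs' hs⟩

/-- By Bernoulli and `(1 - γμ)(1 + γμ) ≤ 1` the left side is at most `1 / (1 + μη)`, `η = γH`. This
is convex in `η`, and the right side is its chord over `[0, 1]`. -/
lemma one_sub_pow_le {μ γ : ℝ} (hμ : 0 < μ) (hγ : 0 < γ) (hγμ : γ * μ ≤ 1) {H : ℕ}
    (hη : γ * H ≤ 1) : (1 - γ * μ) ^ H ≤ 1 - μ / (1 + μ) * (γ * H) := by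
  have h1 : 1 + H * (γ * μ) ≤ (1 + γ * μ) ^ H :=
    one_add_mul_le_pow (by nlinarith) H
  have h2 : (1 - γ * μ) ^ H * (1 + γ * μ) ^ H ≤ 1 := by
    rw [← mul_pow]
    exact pow_le_one₀ (by nlinarith [mul_pos hγ hμ]) (by nlinarith [mul_pos hγ hμ])
  have h3 : 0 ≤ (1 - γ * μ) ^ H := pow_nonneg (by linarith) H
  have h4 : (1 - γ * μ) ^ H * (1 + H * (γ * μ)) ≤ 1 :=
    (mul_le_mul_of_nonneg_left h1 h3).trans h2
  have hη0 : 0 ≤ γ * H := by positivity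
  have h5 : 1 ≤ (1 - μ / (1 + μ) * (γ * H)) * (1 + H * (γ * μ)) := by
    have e : (1 - μ / (1 + μ) * (γ * H)) * (1 + H * (γ * μ)) - 1 =
        μ ^ 2 / (1 + μ) * (γ * H) * (1 - γ * H) := by field_simp; ring
    have : 0 ≤ μ ^ 2 / (1 + μ) * (γ * H) * (1 - γ * H) :=
      mul_nonneg (by positivity) (by linarith)
    linarith
  exact le_of_mul_le_mul_right (h4.trans h5) (by positivity)

variable {N : ℕ} {Z : Type*} [MeasurableSpace Z] {ξ : Fin N → Measure Z}
  [hξ : ∀ c, IsProbabilityMeasure (ξ c)]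
  {g : Fin N → Z → E → E} {G : Fin N → E → E} {μ L : ℝ}

lemma exists_roundModel (hN : 0 < N) (o : ∀ c, Oracle (ξ c) (g c) (G c) μ L) (hμ : 0 < μ)
    (hL : 0 < L) (hμL : μ ≤ L) {θs : E} (hzero : ∑ c, G c θs = 0) {S : Fin N → E →L[ℝ] E}
    {T : Fin N → E →L[ℝ] E →L[ℝ] E} {R : ℝ} (hR : 0 ≤ R)
    (hT : ∀ c θ, ‖G c θ - (G c θs + S c (θ - θs) + (1 / 2 : ℝ) • T c (θ - θs) (θ - θs))‖ ≤
      R * ‖θ - θs‖ ^ 3) :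
    ∃ C : ℝ, ∀ (γ : ℝ) (H : ℕ), 0 < γ → 1 ≤ H → γ * L ≤ 1 / 2 → γ * H ≤ 1 →
      RoundModel (sampleLaw ξ H) (serverStep g γ H) (serverNormSum g γ θs H) (serverSum g γ θs H)
        θs ((N : ℝ)⁻¹ • ∑ c, S c) ((N : ℝ)⁻¹ • ∑ c, T c)
        ((γ * ((H : ℝ) - 1) / 2) • (N : ℝ)⁻¹ • ∑ c, S c (G c θs))
        (((N : ℝ)⁻¹ * (N : ℝ)⁻¹) •
          ∑ c, ∫ z, tensor E (g c z θs - G c θs) (g c z θs - G c θs) ∂ξ c)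
        C (μ / (1 + μ)) γ (γ * H) := by
  set M : ℝ := ∑ c, ∑ q ∈ Finset.range 4, ∫ z, ‖g c z θs‖ ^ (q + 1) ∂ξ c with hMdef
  have hnn : ∀ c (q : ℕ), 0 ≤ ∫ z, ‖g c z θs‖ ^ (q + 1) ∂ξ c := fun c q =>
    integral_nonneg fun z => by positivity
  have hM : ∀ c, ∀ q < 4, ∫ z, ‖g c z θs‖ ^ (q + 1) ∂ξ c ≤ M := fun c q hq =>
    (Finset.single_le_sum (f := fun q => ∫ z, ‖g c z θs‖ ^ (q + 1) ∂ξ c)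
      (fun q _ => hnn c q) (Finset.mem_range.2 hq)).trans
    (Finset.single_le_sum (f := fun c => ∑ q ∈ Finset.range 4, ∫ z, ‖g c z θs‖ ^ (q + 1) ∂ξ c)
      (fun c _ => Finset.sum_nonneg fun q _ => hnn c q) (Finset.mem_univ c))
  have hM0 : 0 ≤ M := Finset.sum_nonneg fun c _ => Finset.sum_nonneg fun q _ => hnn c q
  set s : ℝ := ∑ c, ‖S c‖
  set t : ℝ := ∑ c, ‖T c‖
  have hs : ∀ c, ‖S c‖ ≤ s := fun c =>
    Finset.single_le_sum (f := fun c => ‖S c‖) (fun c _ => norm_nonneg _) (Finset.mem_univ c)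
  have ht : ∀ c, ‖T c‖ ≤ t := fun c =>
    Finset.single_le_sum (f := fun c => ‖T c‖) (fun c _ => norm_nonneg (T c)) (Finset.mem_univ c)
  have hs0 : 0 ≤ s := Finset.sum_nonneg fun c _ => norm_nonneg _
  have ht0 : 0 ≤ t := Finset.sum_nonneg fun c _ => norm_nonneg (T c)
  set D : ℝ := 4 * R * (1 + M) + t * (1 + L) * (3 * M + 2) + s * L * (1 + M) with hD
  have hD0 : 0 ≤ D := by positivity
  set v : ℝ := ((N : ℝ)⁻¹ * (N : ℝ)⁻¹) *
    ∑ c, ∫ z, (inner ℝ (g c z θs - G c θs) (g c z θs - G c θs) : ℝ) ∂ξ c with hv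
  have hv0 : 0 ≤ v := mul_nonneg (by positivity)
    (Finset.sum_nonneg fun c _ => integral_nonneg fun z => real_inner_self_nonneg)
  set B : E := (N : ℝ)⁻¹ • ∑ c, S c (G c θs)
  set T' : E →L[ℝ] E →L[ℝ] E := (N : ℝ)⁻¹ • ∑ c, T c
  -- Chosen before `γ` and `H`. The sum of nonnegative terms dominates each constant needed below,
  -- and the summand 1 gives `one_le`.
  refine ⟨1 + M + L + D + v + ‖B‖ + ‖T'‖, fun γ H hγ hH hγL hη => ?_⟩
  set C : ℝ := 1 + M + L + D + v + ‖B‖ + ‖T'‖ with hC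
  have hB0 := norm_nonneg B
  have hT0 := norm_nonneg T'
  have hH1 : (1 : ℝ) ≤ H := by exact_mod_cast hH
  have hη0 : 0 < γ * H := by positivity
  have hγμ : γ * μ ≤ 1 := by nlinarith
  have hLη : ∀ x : ℝ, 0 ≤ x → γ * H * L * x ≤ C * (γ * H) * x := fun x hx => by
    have : L ≤ C := by rw [hC]; linarith
    rw [mul_comm (γ * (H : ℝ)) L]
    gcongr
  exact
    { one_le := by rw [hC]; linarith
      c_pos := by positivity
      γ_pos := hγ
      γ_le := le_mul_of_one_le_right hγ.le hH1
      η_le := hη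
      norm_T_le := by rw [hC]; linarith
      norm_b_le := by
        rw [norm_smul, Real.norm_of_nonneg (by have := sub_nonneg.2 hH1; positivity)]
        have h1 : γ * ((H : ℝ) - 1) / 2 ≤ γ * H := by nlinarith
        have h2 : ‖B‖ ≤ C := by rw [hC]; linarith
        rw [mul_comm C]
        exact mul_le_mul h1 h2 hB0 hη0.le
      meas := measurable_serverStep o γ H
      W_nonneg := serverNormSum_nonneg g hγ.le θs H
      memLp_W := memLp_serverNormSum o γ θs H
      memLp_V := memLp_serverSum o γ θs H
      moment_W := fun q hq => (integral_serverNormSum_pow_le hN o hγ.le hM H hq).trans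
        (mul_le_mul_of_nonneg_right (by rw [hC]; linarith) (by positivity))
      norm_sub_ref_le := fun θ z => norm_serverStep_sub_le hN o hL hγ hγL θ θs H z
      norm_sub_le := fun θ ϑ z => norm_serverStep_sub_serverStep_le hN o hL hγ hγL θ ϑ H z
      norm_sub_sub_le := fun θ ϑ z =>
        (norm_serverStep_sub_sub_le hN o hL hγ hγL θ ϑ H z).trans (hLη _ (norm_nonneg _))
      norm_add_le := fun θ z => (norm_serverStep_sub_add_le hN o hL hγ hγL θ θs H z).trans
        (hLη _ (add_nonneg (norm_nonneg _) (serverNormSum_nonneg g hγ.le θs H z)))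
      contraction := fun θ ϑ m _ =>
        (integral_norm_serverStep_sub_pow_le hN o hL hγ hγL hγμ θ ϑ H m).trans
          (mul_le_mul_of_nonneg_right (one_sub_pow_le hμ hγ hγμ hη) (by positivity))
      covariance := by
        rw [integral_bilin_serverSum o hzero γ H (tensor E), smul_smul]
      variance := by
        -- Same additivity as for `covariance`, with the inner product as bilinear map, so the
        -- variance needs no trace.
        have h : ∫ z, (inner ℝ (serverSum g γ θs H z) (serverSum g γ θs H z) : ℝ) ∂sampleLaw ξ H =
            (γ * (γ * H) * ((N : ℝ)⁻¹ * (N : ℝ)⁻¹)) •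
              ∑ c, ∫ z, (inner ℝ (g c z θs - G c θs) (g c z θs - G c θs) : ℝ) ∂ξ c :=
          integral_bilin_serverSum o hzero γ H (innerSL ℝ)
        simp only [real_inner_self_eq_norm_sq] at h
        rw [h, smul_eq_mul, mul_assoc (γ * (γ * (H : ℝ)))]
        have hvC : v ≤ C := by rw [hC]; linarith
        simp only [hv, real_inner_self_eq_norm_sq] at hvC
        rw [mul_comm C]
        exact mul_le_mul_of_nonneg_left hvC (by positivity)
      mean := fun θ =>
        (norm_integral_serverStep_sub_expansion_le hN o hL hγ hγL hzero hM hR hs ht hT hη θ).trans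
          (mul_le_mul_of_nonneg_right (by rw [hC]; linarith) (by positivity)) }

end RoundModelExistence

/-! ### From the assumptions on the clients to the oracle setting. -/

section FederatedProblem

variable {N d : ℕ} {Z : Type*} [MeasurableSpace Z] {ξ : Fin N → Measure Z}
  {F : Fin N → Z → Vec d → ℝ} {μ L : ℝ} {θs : Vec d}

lemma localIter_eq_sgdIter (F : Fin N → Z → Vec d → ℝ) (γ : ℝ) (c : Fin N) (θ : Vec d) (h : ℕ)
    (z : Fin h → Z) :
    localIter F γ c θ h z = sgdIter (fun z => gradient (F c z)) γ θ h z := by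
  induction h with
  | zero => rfl
  | succ h ih => simp only [localIter, sgdIter, ih]

lemma globalStep_eq_serverStep (F : Fin N → Z → Vec d → ℝ) (γ : ℝ) (H : ℕ) :
    globalStep F γ H = serverStep (fun c z => gradient (F c z)) γ H := by
  funext θ z
  simp only [globalStep, serverStep, localIter_eq_sgdIter]

lemma gradient_globalObj (hreg : Regular F ξ μ L) :
    gradient (globalObj F ξ) = fun θ => (N : ℝ)⁻¹ • ∑ c, gradient (localObj F ξ c) θ :=
  gradient_const_mul_sum hreg.diff_one _

lemma differentiable_gradient_globalObj (hreg : Regular F ξ μ L) :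
    Differentiable ℝ (gradient (globalObj F ξ)) := by
  rw [gradient_globalObj hreg]
  exact (Differentiable.fun_sum fun c _ => hreg.diff_two c).const_smul (N : ℝ)⁻¹

lemma fderiv_gradient_globalObj (hreg : Regular F ξ μ L) :
    fderiv ℝ (gradient (globalObj F ξ)) =
      fun θ => (N : ℝ)⁻¹ • ∑ c, fderiv ℝ (gradient (localObj F ξ c)) θ := by
  rw [gradient_globalObj hreg]
  exact fderiv_const_smul_sum hreg.diff_two _

lemma hessian_globalObj (hreg : Regular F ξ μ L) (θ : Vec d) :
    hessian (globalObj F ξ) θ = (N : ℝ)⁻¹ • ∑ c, hessian (localObj F ξ c) θ :=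
  congrFun (fderiv_gradient_globalObj hreg) θ

lemma third_globalObj (hreg : Regular F ξ μ L) (θ : Vec d) :
    third (globalObj F ξ) θ = (N : ℝ)⁻¹ • ∑ c, third (localObj F ξ c) θ := by
  rw [third, fderiv_gradient_globalObj hreg, fderiv_const_smul_sum hreg.diff_three]
  rfl

lemma differentiable_globalObj (hreg : Regular F ξ μ L) : Differentiable ℝ (globalObj F ξ) :=
  (Differentiable.fun_sum fun c _ => hreg.diff_one c).const_mul _

lemma sum_gradient_localObj_eq_zero (hN : 0 < N) (hreg : Regular F ξ μ L)
    (hθs : ∀ θ, globalObj F ξ θs ≤ globalObj F ξ θ) :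
    ∑ c, gradient (localObj F ξ c) θs = 0 := by
  have h : gradient (globalObj F ξ) θs = 0 := by
    have hmin : IsLocalMin (globalObj F ξ) θs := Filter.Eventually.of_forall hθs
    rw [gradient, hmin.fderiv_eq_zero, map_zero]
  rw [gradient_globalObj hreg] at h
  exact (smul_eq_zero.1 h).resolve_left (by positivity)

lemma hessian_globalObj_symm (hreg : Regular F ξ μ L) (θ v w : Vec d) :
    inner ℝ (hessian (globalObj F ξ) θ v) w = inner ℝ v (hessian (globalObj F ξ) θ w) :=
  inner_fderiv_gradient_comm (differentiable_globalObj hreg)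
    (differentiable_gradient_globalObj hreg) θ v w

lemma hessian_globalObj_coercive (hN : 0 < N) (hreg : Regular F ξ μ L) (θ v : Vec d) :
    μ * ‖v‖ ^ 2 ≤ inner ℝ (hessian (globalObj F ξ) θ v) v := by
  rw [hessian_globalObj hreg, smul_apply, sum_apply, real_inner_smul_left, sum_inner]
  have h := Finset.sum_le_sum fun (c : Fin N) (_ : c ∈ Finset.univ) => hreg.strongConvex c θ v
  rw [Finset.sum_const, Finset.card_univ, Fintype.card_fin, nsmul_eq_mul] at h
  have hN' : (0 : ℝ) < N := by exact_mod_cast hN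
  rwa [inv_mul_eq_div, le_div_iff₀ hN', mul_comm]

lemma NoiseGrowth.memLp_gradient {τ k : ℝ} [hξ : ∀ c, IsProbabilityMeasure (ξ c)]
    (hF : WellPosed F ξ) (hreg : Regular F ξ μ L) (hnoise : NoiseGrowth F ξ θs τ k) (c : Fin N)
    (θ : Vec d) : MemLp (fun z => gradient (F c z) θ) 4 (ξ c) := by
  have hmeas : Measurable fun z => gradient (F c z) θ :=
    (measurable_gradient_with_param (hF.measurable c) (hreg.sample_diff c)).comp
      measurable_prodMk_right
  have hint := (hnoise θ 2 (by simp) c).1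
  have h : MemLp (fun z => noise F ξ c z θ) 4 (ξ c) := by
    have hm : AEStronglyMeasurable (fun z => noise F ξ c z θ) (ξ c) :=
      (hmeas.sub_const _).aestronglyMeasurable
    rw [← integrable_norm_rpow_iff hm (by norm_num) (by norm_num)]
    refine hint.congr (ae_of_all _ fun z => ?_)
    norm_num
  convert h.add (memLp_const (gradient (localObj F ξ c) θ)) using 1
  funext z
  simp [noise]

lemma oracle_gradient {τ k : ℝ} [hξ : ∀ c, IsProbabilityMeasure (ξ c)] (hL : 0 < L)
    (hF : WellPosed F ξ) (hreg : Regular F ξ μ L) (hnoise : NoiseGrowth F ξ θs τ k) (c : Fin N) :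
    -- The modulus is `min μ L` because `μ ≤ L` can fail when `d = 0`, where the Hessian bounds are
    -- vacuous, and the contraction needs `γμ ≤ 1`.
    Oracle (ξ c) (fun z => gradient (F c z)) (gradient (localObj F ξ c)) (min μ L) L where
  meas := measurable_gradient_with_param (hF.measurable c) (hreg.sample_diff c)
  lip := hreg.sample_smooth c
  cocoercive := hreg.sample_cocoercive c
  mean := fun θ => (gradient_integral_eq (hF.integrable c) (hreg.sample_diff c) hL.le
    (hreg.sample_smooth c)
    ((hnoise.memLp_gradient hF hreg c θ).integrable (by norm_num))).symm
  mono := fun θ ϑ => mul_norm_sq_le_inner_of_fderiv (hreg.diff_two c)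
    (fun θ v => (mul_le_mul_of_nonneg_right (min_le_left μ L) (sq_nonneg _)).trans
      (hreg.strongConvex c θ v)) θ ϑ
  memLp := hnoise.memLp_gradient hF hreg c

/-- Rewrites the kernel identity as invariance under the random map with an independent sample, the
form used by the abstract results. -/
lemma isStationary_iff {γ : ℝ} {H : ℕ} {π : Measure (Vec d)}
    [hξ : ∀ c, IsProbabilityMeasure (ξ c)]
    (hΦ : Measurable (Function.uncurry (globalStep F γ H))) :
    IsStationary F ξ γ H π ↔ IsProbabilityMeasure π ∧
      π = (π.prod (sampleLaw ξ H)).map (Function.uncurry (globalStep F γ H)) := by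
  refine and_congr_right fun _ => ?_
  have h : ∀ B, MeasurableSet B →
      (π.prod (sampleLaw ξ H)).map (Function.uncurry (globalStep F γ H)) B =
        ∫⁻ θ, transition F ξ γ H θ B ∂π := fun B hB => by
    rw [Measure.map_apply hΦ hB, Measure.prod_apply (hΦ hB)]
    refine lintegral_congr fun θ => ?_
    exact (Measure.map_apply (hΦ.comp measurable_prodMk_left) hB).symm
  rw [Measure.ext_iff]
  exact forall₂_congr fun B hB => by rw [h B hB]

lemma exists_taylor_constant [hξ : ∀ c, IsProbabilityMeasure (ξ c)]
    (o : ∀ c, Oracle (ξ c) (fun z => gradient (F c z)) (gradient (localObj F ξ c)) (min μ L) L)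
    (htaylor : CubicRemainder F ξ θs) :
    ∃ R : ℝ, 0 ≤ R ∧ ∀ c θ, ‖gradient (localObj F ξ c) θ - (gradient (localObj F ξ c) θs
      + hessian (localObj F ξ c) θs (θ - θs)
      + (1 / 2 : ℝ) • third (localObj F ξ c) θs (θ - θs) (θ - θs))‖ ≤ R * ‖θ - θs‖ ^ 3 := by
  choose R hR0 hR using fun c => exists_norm_taylor_remainder_le
    (fun θ => (o c).norm_mean_sub_le θ θs) (htaylor c)
  refine ⟨∑ c, R c, Finset.sum_nonneg fun c _ => hR0 c, fun c θ => (hR c θ).trans ?_⟩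
  exact mul_le_mul_of_nonneg_right
    (Finset.single_le_sum (f := R) (fun c _ => hR0 c) (Finset.mem_univ c)) (by positivity)

/-- The subtracted `∇²f(θ⋆)` acts on the sum of the client gradients, which is zero. -/
lemma heterBias_eq (hsum : ∑ c, gradient (localObj F ξ c) θs = 0) :
    heterBias F ξ θs = (hessian (globalObj F ξ) θs).inverse
      ((N : ℝ)⁻¹ • ∑ c, hessian (localObj F ξ c) θs (gradient (localObj F ξ c) θs)) := by
  simp only [heterBias, sub_apply, map_sub, Finset.sum_sub_distrib, ← map_sum, hsum, map_zero,
    sub_zero, map_smul]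

end FederatedProblem

/-! ### Solving the two approximate linear equations. -/

section Inversion

variable {d : ℕ}

lemma norm_sub_inverse_apply_le {E : Type*} [NormedAddCommGroup E] [NormedSpace ℝ E]
    {S : E →L[ℝ] E} (hS : S.IsInvertible) (x y : E) :
    ‖x - S.inverse y‖ ≤ ‖S.inverse‖ * ‖S x - y‖ := by
  have h : x - S.inverse y = S.inverse (S x - y) := by
    rw [map_sub]
    congr 1
    obtain ⟨e, rfl⟩ := hS
    simp
  rw [h]
  exact S.inverse.le_opNorm _

/-- The system is triangular: the Lyapunov equation determines `M` up to its error, and that `M`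
enters the equation for `x` through `Ct`. -/
lemma norm_sub_leading_terms_le {S M Q : Vec d →L[ℝ] Vec d}
    {T : Vec d →L[ℝ] Vec d →L[ℝ] Vec d} (hS : S.IsInvertible) (hLy : (lyapunov S).IsInvertible)
    {Ct : (Vec d →L[ℝ] Vec d) →L[ℝ] Vec d} (hCt : ∀ K, contract T K = Ct K) {x b : Vec d}
    {q β K₁ K₂ ε : ℝ} (hmean : ‖S x + (1 / 2 : ℝ) • Ct M - β • b‖ ≤ K₁ * ε)
    (hcov : ‖lyapunov S M - q • Q‖ ≤ K₂ * ε) :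
    ‖x - (-(q / 2) • S.inverse (contract T ((lyapunov S).inverse Q)) + β • S.inverse b)‖ ≤
        ‖S.inverse‖ * (K₁ + ‖Ct‖ * (‖(lyapunov S).inverse‖ * K₂)) * ε ∧
      ‖M - q • (lyapunov S).inverse Q‖ ≤ ‖(lyapunov S).inverse‖ * K₂ * ε := by
  have hM : ‖M - q • (lyapunov S).inverse Q‖ ≤ ‖(lyapunov S).inverse‖ * K₂ * ε := by
    have h := norm_sub_inverse_apply_le hLy M (q • Q)
    rw [map_smul] at h
    rw [mul_assoc]
    exact h.trans (mul_le_mul_of_nonneg_left hcov (norm_nonneg _))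
  refine ⟨?_, hM⟩
  set A := (lyapunov S).inverse Q
  have h := norm_sub_inverse_apply_le hS x (-(q / 2) • Ct A + β • b)
  rw [map_add, map_smul, map_smul] at h
  rw [hCt, mul_assoc]
  refine h.trans (mul_le_mul_of_nonneg_left ?_ (norm_nonneg _))
  have e : S x - (-(q / 2) • Ct A + β • b) =
      (S x + (1 / 2 : ℝ) • Ct M - β • b) - (1 / 2 : ℝ) • Ct (M - q • A) := by
    rw [map_sub, map_smul]
    module
  have h2 : ‖(1 / 2 : ℝ) • Ct (M - q • A)‖ ≤ ‖Ct‖ * (‖(lyapunov S).inverse‖ * K₂ * ε) := by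
    rw [norm_smul, Real.norm_of_nonneg (by norm_num)]
    have := (Ct.le_opNorm (M - q • A)).trans (mul_le_mul_of_nonneg_left hM (norm_nonneg Ct))
    linarith [norm_nonneg (Ct (M - q • A))]
  rw [e]
  refine (norm_sub_le _ _).trans ((add_le_add hmean h2).trans (le_of_eq ?_))
  ring

end Inversion

end FedAvg

/-! ### Assembly of the theorem. -/

theorem mainTheorem1 {N d : ℕ} (hN : 0 < N) {Z : Type*} [MeasurableSpace Z]
    (ξ : Fin N → MeasureTheory.Measure Z) (hξ : ∀ c, MeasureTheory.IsProbabilityMeasure (ξ c))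
    (F : Fin N → Z → FedAvg.Vec d → ℝ) (hF : FedAvg.WellPosed F ξ)
    (μ L : ℝ) (hμ : 0 < μ) (hL : 0 < L) (hreg : FedAvg.Regular F ξ μ L)
    (θs : FedAvg.Vec d) (hθs : ∀ θ, FedAvg.globalObj F ξ θs ≤ FedAvg.globalObj F ξ θ)
    (htaylor : FedAvg.CubicRemainder F ξ θs)
    (ζ₁ ζ₂ : ℝ) (hζ₁ : 0 < ζ₁) (hζ₂ : 0 < ζ₂) (hhet : FedAvg.Heterogeneity F ξ θs ζ₁ ζ₂)
    (τ k : ℝ) (hτ : 0 ≤ τ) (hk : 0 ≤ k) (hnoise : FedAvg.NoiseGrowth F ξ θs τ k) :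
    ∃ C : ℝ, ∀ (γ : ℝ) (H : ℕ), 0 < γ → 1 ≤ H → γ ≤ min (1 / (25 * L)) (1 / (H : ℝ)) →
      ∃ π : MeasureTheory.Measure (FedAvg.Vec d),
        FedAvg.IsStationary F ξ γ H π ∧
        (∀ π', FedAvg.IsStationary F ξ γ H π' → π' = π) ∧
        MeasureTheory.MemLp id 2 π ∧
        ‖FedAvg.statMean π - θs
            - (-(γ / (2 * N)) • FedAvg.stochBias F ξ θs
              + (γ * ((H : ℝ) - 1) / 2) • FedAvg.heterBias F ξ θs)‖
          ≤ C * (γ ^ 2 * (H : ℝ) ^ 2 + γ ^ (3 / 2 : ℝ) * H) ∧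
        ‖FedAvg.statCov θs π - (γ / N) • FedAvg.ACov F ξ θs‖
          ≤ C * (γ ^ 2 * (H : ℝ) ^ 2 + γ ^ (3 / 2 : ℝ) * H) := by
  have hξ' : ∀ c, IsProbabilityMeasure (ξ c) := hξ
  have o := fun c => FedAvg.oracle_gradient hL hF hreg hnoise c
  have hsum := FedAvg.sum_gradient_localObj_eq_zero hN hreg hθs
  obtain ⟨R, hR0, hR⟩ := FedAvg.exists_taylor_constant o htaylor
  have hμ' : 0 < min μ L := lt_min hμ hL
  obtain ⟨C, hC⟩ := FedAvg.exists_roundModel hN o hμ' hL (min_le_right _ _) hsum hR0 hR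
  rw [← FedAvg.hessian_globalObj hreg, ← FedAvg.third_globalObj hreg] at hC
  set S := FedAvg.hessian (FedAvg.globalObj F ξ) θs with hSdef
  set T := FedAvg.third (FedAvg.globalObj F ξ) θs with hTdef
  set b := (N : ℝ)⁻¹ • ∑ c, FedAvg.hessian (FedAvg.localObj F ξ c) θs
    (gradient (FedAvg.localObj F ξ c) θs) with hb
  have hcoer := FedAvg.hessian_globalObj_coercive hN hreg θs
  have hsymm := FedAvg.hessian_globalObj_symm hreg θs
  have hS := FedAvg.isInvertible_of_injective (FedAvg.injective_of_coercive hμ hcoer)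
  have hLy := FedAvg.isInvertible_of_injective (FedAvg.lyapunov_injective hμ hsymm hcoer)
  obtain ⟨Ct, hCt⟩ : ∃ Ct : (FedAvg.Vec d →L[ℝ] FedAvg.Vec d) →L[ℝ] FedAvg.Vec d,
      ∀ K, FedAvg.contract T K = Ct K :=
    ⟨_, congrFun (FedAvg.contract_eq_sum_apply T)⟩
  set c := min μ L / (1 + min μ L)
  -- `k₂` and `k₄` are the constants that the second and fourth moment drifts demand in
  -- `moments_stationary`.
  set k₂ := 2 / c * (32 * C ^ 2 / c + 32 * C ^ 5 / c + 4 * C ^ 3)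
  set k₄ := 2 / c * (2 / c * (128 * C ^ 2 / c) ^ 2 +
    2 / c * (8 * C ^ 3 * (288 * C ^ 2 / c + 8)) ^ 2 + 3 * C)
  set K := max 1 (max k₂ k₄)
  have hK1 : 1 ≤ K := le_max_left _ _
  have hK2 : k₂ ≤ K := (le_max_left _ _).trans (le_max_right _ _)
  have hK4 : k₄ ≤ K := (le_max_right _ _).trans (le_max_right _ _)
  set K₁ := C * (1 + 4 * K)
  set K₂ := 14 * C * K + 6 * C ^ 2 * (K + C) + C
  set A₁ := ‖S.inverse‖ * (K₁ + ‖Ct‖ * (‖(FedAvg.lyapunov S).inverse‖ * K₂))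
  set A₂ := ‖(FedAvg.lyapunov S).inverse‖ * K₂
  refine ⟨max A₁ A₂, fun γ H hγ hH hle => ?_⟩
  have hγL : γ * L ≤ 1 / 2 := by
    have := (le_div_iff₀ (by positivity)).1 (hle.trans (min_le_left _ _))
    nlinarith
  have hH0 : (0 : ℝ) < H := by exact_mod_cast hH
  have hη : γ * H ≤ 1 := (le_div_iff₀ hH0).1 (hle.trans (min_le_right _ _))
  have m := hC γ H hγ hH hγL hη
  rw [← FedAvg.globalStep_eq_serverStep] at m
  obtain ⟨π, hp, hπ, hs, huniq⟩ := m.exists_unique_stationary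
  have hm := m.moments_stationary hπ hs hK1 hK2 hK4
  have hmean := m.mean_stationary hπ hs (zero_le_one.trans hK1) hm Ct
    fun x => by rw [← hCt, FedAvg.contract_tensor_self]
  have hcov := m.covariance_stationary hπ hs (zero_le_one.trans hK1) hm (FedAvg.lyapunov S)
    (FedAvg.lyapunov_tensor_self hsymm)
  -- Of the two factors `N⁻¹` in the variance of an average, one belongs to `noiseCov` and the other
  -- gives `γ / N`.
  have hQ : γ • (((N : ℝ)⁻¹ * (N : ℝ)⁻¹) • ∑ c, ∫ z, FedAvg.tensor (FedAvg.Vec d)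
      (gradient (F c z) θs - gradient (FedAvg.localObj F ξ c) θs)
      (gradient (F c z) θs - gradient (FedAvg.localObj F ξ c) θs) ∂ξ c) =
      (γ / N) • FedAvg.noiseCov F ξ θs := by
    rw [FedAvg.noiseCov, smul_smul, smul_smul, div_eq_mul_inv, mul_assoc]
    rfl
  rw [hQ] at hcov
  obtain ⟨h1, h2⟩ := FedAvg.norm_sub_leading_terms_le hS hLy hCt hmean hcov
  -- This is `ηδ` with `η = γH` and `δ = √γ + η`.
  have hε : γ * H * (√γ + γ * H) = γ ^ 2 * (H : ℝ) ^ 2 + γ ^ (3 / 2 : ℝ) * H := by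
    have : γ ^ (3 / 2 : ℝ) = γ * √γ := by
      rw [Real.sqrt_eq_rpow, ← Real.rpow_one_add' hγ.le (by norm_num)]
      norm_num
    rw [this]
    ring
  have hε0 : 0 ≤ γ ^ 2 * (H : ℝ) ^ 2 + γ ^ (3 / 2 : ℝ) * H := by positivity
  rw [hε] at h1 h2
  refine ⟨π, (FedAvg.isStationary_iff m.meas).2 ⟨hp, hs⟩, fun π' h' => ?_,
    hπ.mono_exponent (by norm_num), ?_, ?_⟩
  · obtain ⟨hp', hs'⟩ := (FedAvg.isStationary_iff m.meas).1 h'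
    exact huniq π' hp' hs'
  · rw [FedAvg.heterBias_eq hsum, ← div_div, div_right_comm]
    exact h1.trans (mul_le_mul_of_nonneg_right (le_max_left _ _) hε0)
  · exact h2.trans (mul_le_mul_of_nonneg_right (le_max_right _ _) hε0)
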